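/- Let $A$ and $B$ be associative rings with unit. A \emph{pseudo-dualizing complex} $L^\bullet$ for $A$ and $B$ is a finite complex of $A$-$B$-bimodules such that (ii) $L^\bullet$ is quasi-isomorphic, as a complex of left $A$-modules and as a complex of right $B$-modules, to a bounded above complex of finitely generated projective modules, and (iii) the homothety maps $A\to\mathrm{Hom}_{D^b(\mathrm{Mod}\text{-}B)}(L^\bullet,L^\bullet[*])$ and $B^{\mathrm{op}}\to\mathrm{Hom}_{D^b(A\text{-}\mathrm{Mod})}(L^\bullet,L^\bullet[*])$ are isomorphisms of graded rings. For integers $l_1,l_2$, consider the following conditions on a pair of full subcategories $\mathsf E\subset A\text{-}\mathrm{Mod}$ and $\mathsf F\subset B\text{-}\mathrm{Mod}$ of left modules: (I) $\mathsf E$ is closed under extensions and cokernels of injective morphisms, and contains all injective left $A$-modules; (II) $\mathsf F$ is closed under extensions and kernels of surjective morphisms, and contains all projective left $B$-modules; (III) for every $E\in\mathsf E$, the object $\mathbb R\mathrm{Hom}_A(L^\bullet,E)$ of the derived category of left $B$-modules can be represented by a complex concentrated in cohomological degrees $-l_2\le m\le l_1$ with terms in $\mathsf F$; (IV) for every $F\in\mathsf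 F$, the object $L^\bullet\otimes_B^{\mathbb L}F$ of the derived category of left $A$-modules can be represented by a complex concentrated in cohomological degrees $-l_1\le m\le l_2$ with terms in $\mathsf E$. \textbf{Proposition.} Let $L^\bullet$ be a pseudo-dualizing complex for $A$ and $B$ concentrated in cohomological degrees $-d_1\le m\le d_2$. Fix $l_1=d_1$ and $l_2\ge d_2$. Then there exists a unique minimal pair of full subcategories $\mathsf E^{l_2}\subset A\text{-}\mathrm{Mod}$ and $\mathsf F^{l_2}\subset B\text{-}\mathrm{Mod}$ satisfying (I)--(IV) and such that $\mathsf E^{l_2}$ is closed under infinite direct sums in $A\text{-}\mathrm{Mod}$ and $\mathsf F^{l_2}$ is closed under infinite products in $B\text{-}\mathrm{Mod}$. Moreover, for every pair $\mathsf E\subset A\text{-}\mathrm{Mod}$, $\mathsf F\subset B\text{-}\mathrm{Mod}$ satisfying (I)--(IV) such that $\mathsf E$ is closed under infinite direct sums and $\mathsf F$ is closed under infinite products, one has $\mathsf E^{l_2}\subset\mathsf E$ and $\mathsf F^{l_2}\subset\mathsf F$. -/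

import Mathlib

open CategoryTheory CategoryTheory.Limits
open scoped TensorProduct ZeroObject

universe u

noncomputable section

namespace PseudoDualizing

/-! ### Representation in the derived category -/

section Derived

variable {R : Type u} [Ring R]

/-- Mathlib's (unbounded) derived category of `R`-modules needs a choice of a localization of the
category of complexes at quasi-isomorphisms; we use the standard one. -/
instance hasDerivedCategoryModuleCat : HasDerivedCategory.{u + 1} (ModuleCat.{u} R) :=
  HasDerivedCategory.standard _

/-- The complexes `K` and `K'` of `R`-modules are isomorphic as objects of the
derived category `D(R-Mod)`. -/
def DerivedIso (K K' : CochainComplex (ModuleCat.{u} R) ℤ) : Prop :=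
  Nonempty (DerivedCategory.Q.obj K ≅ DerivedCategory.Q.obj K')

/-- The class of `K` in `D(R-Mod)` can be represented by a complex concentrated in the
cohomological degrees `a ≤ m ≤ b` with terms in the full subcategory `P`. -/
def RepresentableIn (P : ObjectProperty (ModuleCat.{u} R)) (a b : ℤ)
    (K : CochainComplex (ModuleCat.{u} R) ℤ) : Prop :=
  ∃ G : CochainComplex (ModuleCat.{u} R) ℤ,
    G.IsStrictlyGE a ∧ G.IsStrictlyLE b ∧ (∀ m, a ≤ m → m ≤ b → P (G.X m)) ∧ DerivedIso G K

/-- A complex of `R`-modules is strongly finitely presented if it is quasi-isomorphic to a bounded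
above complex of finitely generated projective `R`-modules. -/
def StronglyFinitelyPresented (K : CochainComplex (ModuleCat.{u} R) ℤ) : Prop :=
  ∃ P : CochainComplex (ModuleCat.{u} R) ℤ,
    (∃ n : ℤ, P.IsStrictlyLE n) ∧
    (∀ m, Module.Finite R (P.X m) ∧ Module.Projective R (P.X m)) ∧ DerivedIso P K

end Derived

/-! ### Bimodules -/

section Bimodules

variable (A B : Type u) [Ring A] [Ring B]

/-- The ring `A ⊗_ℤ Bᵒᵖ`; `A`-`B`-bimodules are the left modules over it, with
`a • x • b = (a ⊗ b) • x`. -/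
abbrev BimodRing : Type u := A ⊗[ℤ] Bᵐᵒᵖ

/-- The category of `A`-`B`-bimodules. -/
abbrev Bimod : Type (u + 1) := ModuleCat.{u} (BimodRing A B)

/-- The ring homomorphism `a ↦ a ⊗ 1`. -/
def inclA : A →+* BimodRing A B :=
  (Algebra.TensorProduct.includeLeft : A →ₐ[ℤ] A ⊗[ℤ] Bᵐᵒᵖ).toRingHom

/-- The ring homomorphism `b ↦ 1 ⊗ b`. -/
def inclB : Bᵐᵒᵖ →+* BimodRing A B :=
  (Algebra.TensorProduct.includeRight : Bᵐᵒᵖ →ₐ[ℤ] A ⊗[ℤ] Bᵐᵒᵖ).toRingHom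

lemma inclA_mul_inclB (a : A) (b : Bᵐᵒᵖ) :
    inclA A B a * inclB A B b = inclB A B b * inclA A B a := by
  simp [inclA, inclB]

/-- The underlying left `A`-module of a bimodule. -/
abbrev toLeft : Bimod A B ⥤ ModuleCat.{u} A := ModuleCat.restrictScalars (inclA A B)

/-- The underlying right `B`-module of a bimodule (right `B`-modules are left `Bᵐᵒᵖ`-modules). -/
abbrev toRight : Bimod A B ⥤ ModuleCat.{u} Bᵐᵒᵖ := ModuleCat.restrictScalars (inclB A B)

variable {A B}

/-- The underlying complex of left `A`-modules of a complex of bimodules. -/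
abbrev leftComplex (L : CochainComplex (Bimod A B) ℤ) : CochainComplex (ModuleCat.{u} A) ℤ :=
  ((toLeft A B).mapHomologicalComplex _).obj L

/-- The underlying complex of right `B`-modules of a complex of bimodules. -/
abbrev rightComplex (L : CochainComplex (Bimod A B) ℤ) :
    CochainComplex (ModuleCat.{u} Bᵐᵒᵖ) ℤ :=
  ((toRight A B).mapHomologicalComplex _).obj L

/-- If the images of `φ : R → S` and `ψ : T → S` commute, then `T` acts by `R`-linear
endomorphisms on any complex of `S`-modules. -/
def actionHom {R S T : Type u} [Ring R] [Ring S] [Ring T] (φ : R →+* S) (ψ : T →+* S)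
    (h : ∀ r t, φ r * ψ t = ψ t * φ r) (K : CochainComplex (ModuleCat.{u} S) ℤ) :
    T →+* End (((ModuleCat.restrictScalars φ).mapHomologicalComplex (ComplexShape.up ℤ)).obj K) where
  toFun t :=
    { f := fun n => ModuleCat.ofHom
        (X := (ModuleCat.restrictScalars φ).obj (K.X n))
        (Y := (ModuleCat.restrictScalars φ).obj (K.X n))
        { toFun := fun x => (ψ t • (show K.X n from x) : K.X n)
          map_add' := fun x y => smul_add (ψ t) (show K.X n from x) (show K.X n from y)
          map_smul' := fun r x => by
            change (ψ t • (φ r • (show K.X n from x)) : K.X n) =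
              φ r • (ψ t • (show K.X n from x))
            rw [smul_smul, smul_smul, h] }
      comm' := fun i j _ => by
        ext x
        exact ((K.d i j).hom.map_smul (ψ t) x) }
  map_one' := by
    apply HomologicalComplex.hom_ext
    intro n
    ext x
    change (ψ 1 • (show K.X n from x) : K.X n) = x
    rw [map_one, one_smul]
  map_mul' s t := by
    apply HomologicalComplex.hom_ext
    intro n
    ext x
    change (ψ (s * t) • (show K.X n from x) : K.X n) = ψ s • (ψ t • (show K.X n from x))
    rw [map_mul, mul_smul]
  map_zero' := by
    apply HomologicalComplex.hom_ext
    intro n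
    ext x
    change (ψ 0 • (show K.X n from x) : K.X n) = 0
    rw [map_zero, zero_smul]
  map_add' s t := by
    apply HomologicalComplex.hom_ext
    intro n
    ext x
    change (ψ (s + t) • (show K.X n from x) : K.X n) =
      ψ s • (show K.X n from x) + ψ t • (show K.X n from x)
    rw [map_add, add_smul]

/-- The left action of `A` on a complex of bimodules, by endomorphisms of the underlying complex
of right `B`-modules. -/
def actA (L : CochainComplex (Bimod A B) ℤ) : A →+* End (rightComplex L) :=
  actionHom (inclB A B) (inclA A B) (fun b a => (inclA_mul_inclB A B a b).symm) L

/-- The right action of `B` on a complex of bimodules, by endomorphisms of the underlying complex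
of left `A`-modules. -/
def actB (L : CochainComplex (Bimod A B) ℤ) : Bᵐᵒᵖ →+* End (leftComplex L) :=
  actionHom (inclA A B) (inclB A B) (inclA_mul_inclB A B) L

/-! ### The functor `RHom_A(L, -)` on modules -/

/-- The degree `n` term `∏_{q - p = n} Hom_A(L^p, J^q)` of the complex `Hom_A(L, J)`. -/
def HomTerm (L : CochainComplex (Bimod A B) ℤ) (J : CochainComplex (ModuleCat.{u} A) ℤ) (n : ℤ) :
    Type u :=
  CochainComplex.HomComplex.Cochain (leftComplex L) J n

open CochainComplex.HomComplex in
instance (L : CochainComplex (Bimod A B) ℤ) (J : CochainComplex (ModuleCat.{u} A) ℤ) (n : ℤ) :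
    AddCommGroup (HomTerm L J n) :=
  inferInstanceAs (AddCommGroup (Cochain (leftComplex L) J n))

open CochainComplex.HomComplex in
/-- The left `B`-module structure `(b • f)(x) = f(x b)`. -/
instance (L : CochainComplex (Bimod A B) ℤ) (J : CochainComplex (ModuleCat.{u} A) ℤ) (n : ℤ) :
    Module B (HomTerm L J n) where
  smul b f := (Cochain.ofHom (actB L (MulOpposite.op b))).comp
    (show Cochain (leftComplex L) J n from f) (zero_add n)
  one_smul f := by
    change (Cochain.ofHom (actB L 1)).comp (show Cochain (leftComplex L) J n from f) _ = f
    rw [map_one]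
    exact Cochain.id_comp _
  mul_smul b c f := by
    change (Cochain.ofHom (actB L (MulOpposite.op c * MulOpposite.op b))).comp
        (show Cochain (leftComplex L) J n from f) _ =
      (Cochain.ofHom (actB L (MulOpposite.op b))).comp
        ((Cochain.ofHom (actB L (MulOpposite.op c))).comp
          (show Cochain (leftComplex L) J n from f) (zero_add n)) (zero_add n)
    rw [map_mul, End.mul_def, Cochain.ofHom_comp, Cochain.comp_assoc_of_first_is_zero_cochain]
  smul_zero b := Cochain.comp_zero _ _
  smul_add b f g := Cochain.comp_add _ _ _ _
  add_smul b c f := by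
    change (Cochain.ofHom (actB L (MulOpposite.op b + MulOpposite.op c))).comp
        (show Cochain (leftComplex L) J n from f) _ =
      (Cochain.ofHom (actB L (MulOpposite.op b))).comp
          (show Cochain (leftComplex L) J n from f) (zero_add n) +
        (Cochain.ofHom (actB L (MulOpposite.op c))).comp
          (show Cochain (leftComplex L) J n from f) (zero_add n)
    rw [map_add]
    exact (congrArg (fun z => Cochain.comp z (show Cochain (leftComplex L) J n from f) (zero_add n))
      (Cochain.ofHom_add _ _)).trans (Cochain.add_comp _ _ _ _)
  zero_smul f := by
    change (Cochain.ofHom (actB L 0)).comp (show Cochain (leftComplex L) J n from f) _ = 0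
    rw [map_zero]
    exact (congrArg (fun z => Cochain.comp z (show Cochain (leftComplex L) J n from f) (zero_add n))
      (Cochain.ofHom_zero _ _)).trans (Cochain.zero_comp _ _)

open CochainComplex.HomComplex in
/-- The complex of left `B`-modules `Hom_A(L, J)`, with Mathlib's differential
`f ↦ f ≫ d_J + (-1)^(n+1) d_L ≫ f` in degree `n`. -/
def homComplex (L : CochainComplex (Bimod A B) ℤ) (J : CochainComplex (ModuleCat.{u} A) ℤ) :
    CochainComplex (ModuleCat.{u} B) ℤ where
  X n := ModuleCat.of B (HomTerm L J n)
  d m n := ModuleCat.ofHom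
    { toFun := fun f => δ m n (show Cochain (leftComplex L) J m from f)
      map_add' := fun f g => δ_add m n (show Cochain (leftComplex L) J m from f)
        (show Cochain (leftComplex L) J m from g)
      map_smul' := fun b f => δ_ofHom_comp _ _ _ }
  shape m n h := by
    ext f
    exact δ_shape m n h _
  d_comp_d' i j k _ _ := by
    ext f
    exact δ_δ i j k (show Cochain (leftComplex L) J i from f)

/-- `RHom_A(L, E)`, computed by an injective resolution of the left `A`-module `E`. -/
def RHom (L : CochainComplex (Bimod A B) ℤ) (E : ModuleCat.{u} A) :
    CochainComplex (ModuleCat.{u} B) ℤ :=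
  homComplex L (injectiveResolution E).cochainComplex

/-! ### The functor `L ⊗_B^L -` on modules -/

/-- The `A`-submodule of `M ⊗_ℤ N` generated by the elements `xb ⊗ y - x ⊗ by`. -/
def balancing (M : Bimod A B) (N : ModuleCat.{u} B) :
    Submodule A ((toLeft A B).obj M ⊗[ℤ] N) :=
  Submodule.span A {t | ∃ (x : M) (b : B) (y : N),
    t = (show (toLeft A B).obj M from inclB A B (MulOpposite.op b) • x) ⊗ₜ[ℤ] y -
      (show (toLeft A B).obj M from x) ⊗ₜ[ℤ] (b • y)}

/-- The left `A`-module `M ⊗_B N`, where `M` is an `A`-`B`-bimodule and `N` a left `B`-module. -/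
abbrev tensorObj (M : Bimod A B) (N : ModuleCat.{u} B) : ModuleCat.{u} A :=
  ModuleCat.of A (((toLeft A B).obj M ⊗[ℤ] N) ⧸ balancing M N)

/-- The element `x ⊗ y` of `M ⊗_B N`. -/
def tmul {M : Bimod A B} {N : ModuleCat.{u} B} (x : M) (y : N) : tensorObj M N :=
  (balancing M N).mkQ ((show (toLeft A B).obj M from x) ⊗ₜ[ℤ] y)

/-- The map `f ⊗ g` on tensor products over `ℤ`. -/
def preMap {M M' : Bimod A B} {N N' : ModuleCat.{u} B} (f : M ⟶ M') (g : N ⟶ N') :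
    ((toLeft A B).obj M ⊗[ℤ] N) →ₗ[A] ((toLeft A B).obj M' ⊗[ℤ] N') :=
  TensorProduct.AlgebraTensorModule.map ((toLeft A B).map f).hom (g.hom.toAddMonoidHom.toIntLinearMap)

lemma balancing_le {M M' : Bimod A B} {N N' : ModuleCat.{u} B} (f : M ⟶ M') (g : N ⟶ N') :
    balancing M N ≤ (balancing M' N').comap (preMap f g) := by
  refine Submodule.span_le.2 ?_
  rintro _ ⟨x, b, y, rfl⟩
  refine Submodule.subset_span ⟨f.hom x, b, g.hom y, ?_⟩
  rw [map_sub]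
  refine congrArg₂ (· - ·) ?_ ?_
  · exact congrArg (fun z : M' => (show (toLeft A B).obj M' from z) ⊗ₜ[ℤ] (g.hom y))
      (f.hom.map_smul (inclB A B (MulOpposite.op b)) x)
  · exact congrArg (fun z : N' => (show (toLeft A B).obj M' from f.hom x) ⊗ₜ[ℤ] z)
      (g.hom.map_smul b y)

/-- The map `f ⊗ g : M ⊗_B N ⟶ M' ⊗_B N'`. -/
def tensorMap {M M' : Bimod A B} {N N' : ModuleCat.{u} B} (f : M ⟶ M') (g : N ⟶ N') :
    tensorObj M N ⟶ tensorObj M' N' :=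
  ModuleCat.ofHom ((balancing M N).mapQ (balancing M' N') (preMap f g) (balancing_le f g))

lemma tensorMap_tmul {M M' : Bimod A B} {N N' : ModuleCat.{u} B} (f : M ⟶ M') (g : N ⟶ N')
    (x : M) (y : N) : (tensorMap f g).hom (tmul x y) = tmul (f.hom x) (g.hom y) := rfl

lemma tensor_hom_ext {M : Bimod A B} {N : ModuleCat.{u} B} {X : ModuleCat.{u} A}
    {p q : tensorObj M N ⟶ X} (h : ∀ (x : M) (y : N), p.hom (tmul x y) = q.hom (tmul x y)) :
    p = q := by
  apply ModuleCat.hom_ext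
  apply Submodule.linearMap_qext
  apply TensorProduct.AlgebraTensorModule.ext
  exact h

lemma tmul_add {M : Bimod A B} {N : ModuleCat.{u} B} (x : M) (y y' : N) :
    tmul x (y + y') = tmul x y + tmul x y' :=
  (congrArg (balancing M N).mkQ (TensorProduct.tmul_add (R := ℤ)
    (show (toLeft A B).obj M from x) y y')).trans (map_add _ _ _)

lemma add_tmul {M : Bimod A B} {N : ModuleCat.{u} B} (x x' : M) (y : N) :
    tmul (x + x') y = tmul x y + tmul x' y :=
  (congrArg (balancing M N).mkQ (TensorProduct.add_tmul (R := ℤ)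
    (show (toLeft A B).obj M from x) (show (toLeft A B).obj M from x') y)).trans (map_add _ _ _)

/-- The additive bifunctor `(M, N) ↦ M ⊗_B N`. -/
def tensorBifunctor (A B : Type u) [Ring A] [Ring B] :
    Bimod A B ⥤ ModuleCat.{u} B ⥤ ModuleCat.{u} A where
  obj M :=
    { obj := fun N => tensorObj M N
      map := fun g => tensorMap (𝟙 M) g
      map_id := fun N => tensor_hom_ext fun _ _ => rfl
      map_comp := fun g g' => tensor_hom_ext fun _ _ => rfl }
  map f :=
    { app := fun N => tensorMap f (𝟙 N)
      naturality := fun _ _ g => tensor_hom_ext fun _ _ => rfl }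
  map_id M := by
    ext N : 2
    exact tensor_hom_ext fun _ _ => rfl
  map_comp f f' := by
    ext N : 2
    exact tensor_hom_ext fun _ _ => rfl

instance : (tensorBifunctor A B).Additive where
  map_add {M M' f f'} := by
    ext N : 2
    exact tensor_hom_ext fun x y => add_tmul (f.hom x) (f'.hom x) y

instance (M : Bimod A B) : ((tensorBifunctor A B).obj M).Additive where
  map_add {_ _ g g'} := tensor_hom_ext fun x y => tmul_add x (g.hom y) (g'.hom y)

/-- The total tensor product `L ⊗_B P` of a complex of bimodules and a complex of left
`B`-modules: it is `⨁_{p + q = n} L^p ⊗_B P^q` in degree `n`, with the usual signs. -/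
def tensorComplex (L : CochainComplex (Bimod A B) ℤ) (P : CochainComplex (ModuleCat.{u} B) ℤ) :
    CochainComplex (ModuleCat.{u} A) ℤ :=
  HomologicalComplex.mapBifunctor L P (tensorBifunctor A B) (ComplexShape.up ℤ)

/-- `L ⊗_B^L F`, computed by a projective resolution of the left `B`-module `F`. -/
def LTensor (L : CochainComplex (Bimod A B) ℤ) (F : ModuleCat.{u} B) :
    CochainComplex (ModuleCat.{u} A) ℤ :=
  tensorComplex L (projectiveResolution F).cochainComplex

end Bimodules

/-! ### Pseudo-dualizing complexes and corresponding classes -/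

section Classes

variable {A B : Type u} [Ring A] [Ring B]

open DerivedCategory in
/-- `L` is a pseudo-dualizing complex of `A`-`B`-bimodules: a finite complex, strongly finitely
presented on both sides, such that the homothety maps `A → Hom_{D(Mod-B)}(L, L[*])` and
`Bᵒᵖ → Hom_{D(A-Mod)}(L, L[*])` are isomorphisms of graded rings (with `A` and `Bᵒᵖ` placed in
degree `0`). -/
structure IsPseudoDualizing (L : CochainComplex (Bimod A B) ℤ) : Prop where
  finite : ∃ a b : ℤ, L.IsStrictlyGE a ∧ L.IsStrictlyLE b
  sfp_left : StronglyFinitelyPresented (leftComplex L)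
  sfp_right : StronglyFinitelyPresented (rightComplex L)
  homothety_left_zero :
    Function.Bijective fun a : A => Q.map (X := rightComplex L) (Y := rightComplex L) (actA L a)
  homothety_left_ne_zero :
    ∀ n : ℤ, n ≠ 0 → ∀ f : Q.obj (rightComplex L) ⟶ (Q.obj (rightComplex L))⟦n⟧, f = 0
  homothety_right_zero :
    Function.Bijective fun b : Bᵐᵒᵖ => Q.map (X := leftComplex L) (Y := leftComplex L) (actB L b)
  homothety_right_ne_zero :
    ∀ n : ℤ, n ≠ 0 → ∀ f : Q.obj (leftComplex L) ⟶ (Q.obj (leftComplex L))⟦n⟧, f = 0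

/-- Conditions (I)-(IV) with the parameters `l₁` and `l₂` for a pair of full subcategories
`E ⊆ A-Mod` and `F ⊆ B-Mod`. -/
structure CorrespondingClasses (L : CochainComplex (Bimod A B) ℤ) (l₁ l₂ : ℤ)
    (E : ObjectProperty (ModuleCat.{u} A)) (F : ObjectProperty (ModuleCat.{u} B)) : Prop where
  E_extensions : ∀ S : ShortComplex (ModuleCat.{u} A), S.ShortExact → E S.X₁ → E S.X₃ → E S.X₂
  E_cokernels : ∀ S : ShortComplex (ModuleCat.{u} A), S.ShortExact → E S.X₁ → E S.X₂ → E S.X₃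
  E_injectives : ∀ J : ModuleCat.{u} A, Injective J → E J
  F_extensions : ∀ S : ShortComplex (ModuleCat.{u} B), S.ShortExact → F S.X₁ → F S.X₃ → F S.X₂
  F_kernels : ∀ S : ShortComplex (ModuleCat.{u} B), S.ShortExact → F S.X₂ → F S.X₃ → F S.X₁
  F_projectives : ∀ P : ModuleCat.{u} B, Projective P → F P
  E_to_F : ∀ M : ModuleCat.{u} A, E M → RepresentableIn F (-l₂) l₁ (RHom L M)
  F_to_E : ∀ N : ModuleCat.{u} B, F N → RepresentableIn E (-l₁) l₂ (LTensor L N)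

/-- A pair of full subcategories (`p.1 ⊆ A-Mod`, `p.2 ⊆ B-Mod`) satisfying (I)-(IV), with `p.1`
closed under infinite direct sums and `p.2` closed under infinite products. -/
structure ClosedCorrespondingClasses (L : CochainComplex (Bimod A B) ℤ) (l₁ l₂ : ℤ)
    (p : ObjectProperty (ModuleCat.{u} A) × ObjectProperty (ModuleCat.{u} B)) : Prop where
  corresponding : CorrespondingClasses L l₁ l₂ p.1 p.2
  directSums : ∀ (I : Type u) (M : I → ModuleCat.{u} A), (∀ i, p.1 (M i)) →
    p.1 (ModuleCat.of A (DirectSum I fun i => M i))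
  products : ∀ (I : Type u) (N : I → ModuleCat.{u} B), (∀ i, p.2 (N i)) →
    p.2 (ModuleCat.of B (∀ i, N i))

end Classes

end PseudoDualizing

end

/-! The closed pairs contain a least element as soon as there is one closed pair and intersections
of nonempty families of closed pairs are closed. A least element is then the only minimal one.

Intersections. Only (III) and (IV) need an argument, because a single representative must serve all
members of the family. For (III), take a representative `P` of `RHom(L, M)` by projectives in
degrees at most `l₁` and truncate it canonically at `-l₂`. Compare it with a representative `G`
having terms in a given class `F`. The cone is acyclic and bounded, and its terms lie in `F` except
possibly the lowest one. Splicing it into short exact sequences from the right end, closure under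
kernels and extensions puts the lowest term in `F` as well. So the truncation has terms in every `F`
of the family (`IsResolving.truncGE_X`). Injectives give the dual statement
(`IsCoresolving.truncLE_X`).

Existence. There is a large closed pair, in the style of the Auslander and Bass classes. Call `X` in
`D(B)` and `Y` in `D(A)` matched if `Y` is `L ⊗ X` and the unit `X → RHom(L, L ⊗ X)` is invertible.
`E₀` consists of the modules `M` matched with some `X` in degrees at most `l`, and `F₀` of the
modules `N` matched with some `Y` in degrees at least `-l`. Matched pairs are stable under shifts
and cones, which gives the closure properties in (I) and (II). The pseudo-dualizing conditions imply
that bounded complexes of injectives and of projectives are matched, and the bound `L ≥ -l` gives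
the required degrees. (III) and (IV) follow by truncating a resolution: only the extreme term is not
projective (injective), and a stupid truncation triangle handles it (`Matched.F₀_bottom`,
`Matched.E₀_top`).

Matching is controlled in homotopy categories by two test maps (`HomothetyData`). One is `t : K → L
⊗ B`, where `K` resolves `L` by finitely generated projective left modules. The other is `w : A → L
⊗ W`, where `W` is the `B`-dual of a resolution of `L` by finitely generated projective right
modules. Maps `B → P[n]` induce maps `K → L ⊗ P[n]`, and bijectivity of this says that the unit is
invertible at `P`. Maps `W → P[n]` induce maps `A → L ⊗ P[n]`, and bijectivity of this computes the
cohomology of `L ⊗ P` by maps out of `W`. At `P = B` the first is the right homothety, while the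
second only uses that `W` is dual to a resolution; the left homothety makes `w` a quasi-isomorphism.
Both extend through direct sums, retracts and triangles to bounded complexes of projectives, and the
second even to bounded above ones.

Direct sums in `E₀` come from finite generation and boundedness of `K`. Products in `F₀` come from
the fact that maps out of `W` commute with products, although the tensor product need not. -/

noncomputable section
namespace PseudoDualizing

open CochainComplex.HomComplex

variable {A B : Type u} [Ring A] [Ring B]

/-! ### The functor `Hom_A(L, -)` on complexes: homotopies and shifts. -/

section HomFunctor

variable {L : CochainComplex (Bimod A B) ℤ} {J J' : CochainComplex (ModuleCat.{u} A) ℤ}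

/-- The cochain underlying an element of `Hom_A(L, J)`. -/
def toCochain {n : ℤ} (f : (homComplex L J).X n) : Cochain (leftComplex L) J n := f

/-- The element of `Hom_A(L, J)` given by a cochain. -/
def ofCochain {n : ℤ} (f : Cochain (leftComplex L) J n) : (homComplex L J).X n := f

lemma toCochain_injective {n : ℤ} :
    Function.Injective (toCochain : (homComplex L J).X n → _) := fun _ _ h => h

@[simp] lemma toCochain_units_smul {n : ℤ} (k : ℤˣ) (f : (homComplex L J).X n) :
    toCochain (k • f) = k • toCochain f := by
  obtain rfl | rfl := Int.units_eq_one_or k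
  · rw [one_smul, one_smul]
  · rw [Units.neg_smul, Units.neg_smul, one_smul, one_smul]; rfl

lemma homComplex_hom_ext {n : ℤ} {X : ModuleCat.{u} B} {f g : X ⟶ (homComplex L J).X n}
    (h : ∀ x : X, toCochain (f.hom x) = toCochain (g.hom x)) : f = g := by
  ext x
  exact h x

/-- Postcomposition with a cochain, as a `B`-linear map. -/
def homPostcomp (L : CochainComplex (Bimod A B) ℤ) {k : ℤ} (z : Cochain J J' k)
    (n m : ℤ) (h : n + k = m) : (homComplex L J).X n ⟶ (homComplex L J').X m :=
  ModuleCat.ofHom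
    { toFun := fun f => ofCochain ((toCochain f).comp z h)
      map_add' := fun _ _ => Cochain.add_comp _ _ _ _
      map_smul' := fun _ _ => Cochain.comp_assoc_of_first_is_zero_cochain _ _ _ _ }

/-- The map `Hom_A(L, J) ⟶ Hom_A(L, J')` induced by `J ⟶ J'`. -/
def homComplexMap (L : CochainComplex (Bimod A B) ℤ) (φ : J ⟶ J') :
    homComplex L J ⟶ homComplex L J' where
  f n := homPostcomp L (Cochain.ofHom φ) n n (add_zero n)
  comm' _ j _ := homComplex_hom_ext fun f => δ_comp_ofHom (toCochain f) φ j

@[simp] lemma toCochain_homComplexMap (φ : J ⟶ J') {n : ℤ} (f : (homComplex L J).X n) :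
    toCochain (((homComplexMap L φ).f n).hom f) =
      (toCochain f).comp (Cochain.ofHom φ) (add_zero n) := rfl

/-- The functor `Hom_A(L, -)` on complexes. -/
def homFunctor (L : CochainComplex (Bimod A B) ℤ) :
    CochainComplex (ModuleCat.{u} A) ℤ ⥤ CochainComplex (ModuleCat.{u} B) ℤ where
  obj J := homComplex L J
  map φ := homComplexMap L φ
  map_id J := by
    ext n : 1
    exact homComplex_hom_ext fun f => Cochain.comp_id (toCochain f)
  map_comp φ ψ := by
    ext n : 1
    refine homComplex_hom_ext fun f => ?_
    rw [toCochain_homComplexMap, Cochain.ofHom_comp,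
      ← Cochain.comp_assoc_of_third_is_zero_cochain]
    rfl

variable (L)

lemma homComplexMap_add (φ ψ : J ⟶ J') :
    homComplexMap L (φ + ψ) = homComplexMap L φ + homComplexMap L ψ := by
  ext n : 1
  refine homComplex_hom_ext fun f => ?_
  rw [toCochain_homComplexMap, Cochain.ofHom_add, Cochain.comp_add]
  rfl

instance : (homFunctor L).Additive where
  map_add := homComplexMap_add L _ _

/-- `Hom_A(L, -)` preserves homotopies. -/
def homComplexMapHomotopy {φ ψ : J ⟶ J'} (h : Homotopy φ ψ) :
    Homotopy (homComplexMap L φ) (homComplexMap L ψ) where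
  hom i j := if hij : i + (-1) = j then homPostcomp L (Cochain.ofHomotopy h) i j hij else 0
  zero i j hij := dif_neg fun h => hij (by simp; omega)
  comm n := by
    rw [dNext_eq _ (show (ComplexShape.up ℤ).Rel n (n + 1) by simp),
      prevD_eq _ (show (ComplexShape.up ℤ).Rel (n - 1) n by simp),
      dif_pos (show n + 1 + (-1) = n by omega), dif_pos (show n + (-1) = n - 1 by omega)]
    refine homComplex_hom_ext fun f => ?_
    -- Leibniz rule for `f` followed by the degree `-1` cochain of the homotopy. Since the
    -- coboundary of that cochain is `φ - ψ`, this is the homotopy identity, and the sign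
    -- `(-1)^(-1)` moves the term in `δ f` to the other side.
    have := δ_comp (toCochain f) (Cochain.ofHomotopy h)
      (show n + (-1) = n - 1 by omega) (n + 1) 0 n (by omega) rfl (by omega)
    rw [δ_ofHomotopy, Cochain.comp_sub] at this
    simp only [Int.negOnePow_neg, Int.negOnePow_one, Units.neg_smul, one_smul] at this
    rw [eq_add_neg_iff_add_eq, eq_sub_iff_add_eq] at this
    refine this.symm.trans ?_
    refine congrArg₂ _ (add_comm _ _) rfl


/-- The ring `B` acts by precomposition, whereas unshifting changes only the target. This gives the
`B`-linearity of the comparison with shifts. -/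
lemma rightUnshift_ofHom_comp {K K' : CochainComplex (ModuleCat.{u} A) ℤ} (φ : K ⟶ K')
    {a n' : ℤ} (γ : Cochain K' (J⟦a⟧) n') (n : ℤ) (hn : n' + a = n) :
    ((Cochain.ofHom φ).comp γ (zero_add n')).rightUnshift n hn =
      (Cochain.ofHom φ).comp (γ.rightUnshift n hn) (zero_add n) := by
  ext p q hpq
  rw [Cochain.rightUnshift_v _ _ _ p q hpq _ rfl, Cochain.zero_cochain_comp_v,
    Cochain.zero_cochain_comp_v, Cochain.rightUnshift_v _ _ _ p q hpq _ rfl, Category.assoc]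

/-- Elements of `Hom_A(L, J[a])` as elements of `Hom_A(L, J)[a]`. -/
def homComplexUnshift (J : CochainComplex (ModuleCat.{u} A) ℤ) (a n : ℤ) :
    (homComplex L (J⟦a⟧)).X n ≃ₗ[B] (homComplex L J).X (n + a) where
  toFun f := ofCochain ((toCochain f).rightUnshift (n + a) rfl)
  invFun f := ofCochain ((toCochain f).rightShift a n rfl)
  map_add' f g := Cochain.rightUnshift_add _ _ _ _
  map_smul' b f := rightUnshift_ofHom_comp _ _ _ _
  left_inv f := Cochain.rightShift_rightUnshift (toCochain f) _ _
  right_inv f := Cochain.rightUnshift_rightShift (toCochain f) _ _ _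

/-- Compatibility of `Hom_A(L, -)` with shifts. -/
def homComplexShiftIso (J : CochainComplex (ModuleCat.{u} A) ℤ) (a : ℤ) :
    homComplex L (J⟦a⟧) ≅ (homComplex L J)⟦a⟧ :=
  HomologicalComplex.Hom.isoOfComponents
    (fun n => (homComplexUnshift L J a n).toModuleIso) (by
    intro i j hij
    refine homComplex_hom_ext (J := J) (n := j + a) fun f => ?_
    -- Unshifting commutes with the differential up to `(-1)^a`, which is exactly the sign in the
    -- differential of a shifted complex.
    have := Cochain.δ_rightUnshift (toCochain f) (i + a) rfl (j + a) j rfl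
    have h2 : a.negOnePow • δ (i + a) (j + a) ((toCochain f).rightUnshift (i + a) rfl) =
        (δ i j (toCochain f)).rightUnshift (j + a) rfl := by
      rw [this, smul_smul, Int.units_mul_self, one_smul]
    refine Eq.trans ?_ h2
    exact toCochain_units_smul _ _)

end HomFunctor

variable {A B : Type u} [Ring A] [Ring B]

/-! ### Coherence of `Hom_A(L, -)` with shifts. -/

section HomFunctorShift

variable (L : CochainComplex (Bimod A B) ℤ)

/-- Compatibility of the functor `Hom_A(L, -)` with shifts. -/
def homFunctorShiftIso (a : ℤ) :
    shiftFunctor (CochainComplex (ModuleCat.{u} A) ℤ) a ⋙ homFunctor L ≅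
      homFunctor L ⋙ shiftFunctor (CochainComplex (ModuleCat.{u} B) ℤ) a :=
  NatIso.ofComponents (fun J => homComplexShiftIso L J a) (by
    intro J J' φ
    ext n : 1
    refine homComplex_hom_ext (J := J') (n := n + a) fun f => ?_
    change ((toCochain f).comp (Cochain.ofHom (φ⟦a⟧')) (add_zero n)).rightUnshift (n + a) rfl =
      ((toCochain f).rightUnshift (n + a) rfl).comp (Cochain.ofHom φ) (add_zero (n + a))
    ext p q hpq
    rw [Cochain.rightUnshift_v _ _ _ p q hpq _ rfl, Cochain.comp_zero_cochain_v,
      Cochain.comp_zero_cochain_v, Cochain.rightUnshift_v _ _ _ p q hpq _ rfl, Category.assoc,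
      Category.assoc]
    congr 1
    obtain rfl : q = p + n + a := by omega
    simp [CochainComplex.shiftFunctorObjXIso])


lemma toCochain_XIsoOfEq_hom_v (J : CochainComplex (ModuleCat.{u} A) ℤ) {m n : ℤ} (h : m = n)
    (f : (homComplex L J).X m) (p q : ℤ) (hpq : p + n = q) :
    (toCochain (((homComplex L J).XIsoOfEq h).hom.hom f)).v p q hpq =
      (toCochain f).v p q (by omega) := by
  subst h
  rfl

instance : (homFunctor L).CommShift ℤ where
  commShiftIso := homFunctorShiftIso L
  commShiftIso_zero := by
    ext J : 3
    ext n : 1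
    refine homComplex_hom_ext (J := J) (n := n + 0) fun f => ?_
    rw [Functor.CommShift.isoZero_hom_app]
    apply Cochain.ext
    intro p q hpq
    refine (Cochain.rightUnshift_v (toCochain (J := J⟦(0 : ℤ)⟧) (n := n) f)
      _ rfl p q hpq _ rfl).trans ?_
    refine Eq.trans ?_ (toCochain_XIsoOfEq_hom_v L J (add_zero n).symm _ p q hpq).symm
    refine Eq.trans ?_ (Cochain.comp_zero_cochain_v (toCochain (J := J⟦(0 : ℤ)⟧) (n := n) f)
      (Cochain.ofHom ((shiftFunctorZero (CochainComplex (ModuleCat.{u} A) ℤ) ℤ).hom.app J))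
      p q _).symm
    obtain rfl : q = p + n := by omega
    rw [Cochain.ofHom_v, CochainComplex.shiftFunctorZero_hom_app_f]
    rfl
  commShiftIso_add a b := by
    ext J : 3
    ext n : 1
    refine homComplex_hom_ext (J := J) (n := n + (a + b)) fun f => ?_
    rw [Functor.CommShift.isoAdd_hom_app]
    apply Cochain.ext
    intro p q hpq
    refine (Cochain.rightUnshift_v (toCochain (J := J⟦(a + b : ℤ)⟧) (n := n) f)
      _ rfl p q hpq _ rfl).trans ?_
    refine Eq.trans ?_ (toCochain_XIsoOfEq_hom_v L J (show n + b + a = n + (a + b) by omega)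
      _ p q hpq).symm
    refine Eq.trans ?_ (Cochain.rightUnshift_v (n' := n + b) (L := J) (a := a) 
      (Cochain.rightUnshift (K := leftComplex L) (L := J⟦a⟧) (a := b) 
        ((toCochain (J := J⟦(a + b : ℤ)⟧) (n := n) f).comp (Cochain.ofHom
          ((shiftFunctorAdd (CochainComplex (ModuleCat.{u} A) ℤ) a b).hom.app J)) (add_zero n))
        (n + b) rfl) (n + b + a) rfl p q (by omega) _ rfl).symm
    rw [Cochain.rightUnshift_v _ (n + b) _ p (p + (n + b)) _ _ rfl,
      Cochain.comp_zero_cochain_v, Cochain.ofHom_v, CochainComplex.shiftFunctorAdd_hom_app_f]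
    -- All the degree identifications are transports along equalities, so the route taken between
    -- the same endpoints is irrelevant.
    have key : ∀ {X X₁ X₂ X₃ X₄ : ModuleCat.{u} A} (γ : X ⟶ X₁) (h₁ : X₁ = X₄) (h₂ : X₁ = X₂)
        (h₃ : X₂ = X₃) (h₄ : X₃ = X₄), γ ≫ eqToHom h₁ =
          ((γ ≫ eqToHom h₂) ≫ eqToHom h₃) ≫ eqToHom h₄ := by
      rintro X X₁ _ _ _ γ - rfl rfl rfl
      simp
    exact key _ (congrArg J.X (show p + n + (a + b) = q by omega))
      (congrArg J.X (show p + n + (a + b) = p + n + b + a by omega))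
      (congrArg J.X (show p + n + b + a = p + (n + b) + a by omega))
      (congrArg J.X (show p + (n + b) + a = q by omega))

end HomFunctorShift

variable {A B : Type u} [Ring A] [Ring B]

/-- The homotopy category of complexes of `R`-modules. -/
abbrev HoCat (R : Type u) [Ring R] := HomotopyCategory (ModuleCat.{u} R) (ComplexShape.up ℤ)

/-- The quotient functor to the homotopy category. -/
abbrev toHo (R : Type u) [Ring R] : CochainComplex (ModuleCat.{u} R) ℤ ⥤ HoCat R :=
  HomotopyCategory.quotient _ _

/-! ### `Hom_A(L, -)` is a triangulated functor on homotopy categories. -/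

section HomFunctorTriangulated

variable (L : CochainComplex (Bimod A B) ℤ)

/-- The functor `Hom_A(L, -)` on homotopy categories. -/
def homFunctorHo : HoCat A ⥤ HoCat B :=
  CategoryTheory.Quotient.lift _ (homFunctor L ⋙ toHo B)
    (fun _ _ _ _ ⟨h⟩ => HomotopyCategory.eq_of_homotopy _ _ (homComplexMapHomotopy L h))

/-- `homFunctorHo` is induced by `homFunctor`. -/
def homFunctorHoFactors : toHo A ⋙ homFunctorHo L ≅ homFunctor L ⋙ toHo B :=
  CategoryTheory.Quotient.lift.isLift _ _ _

instance : (homFunctorHo L).CommShift ℤ :=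
  Quotient.liftCommShift _ _ _ _

instance : NatTrans.CommShift (homFunctorHoFactors L).hom ℤ :=
  Quotient.liftCommShift_compatibility _ _ _ _

/-- The degreewise section of a degreewise split sequence. -/
def sectionHoms {S : ShortComplex (CochainComplex (ModuleCat.{u} A) ℤ)}
    (σ : ∀ n, (S.map (HomologicalComplex.eval _ _ n)).Splitting) (n : ℤ) : S.X₃.X n ⟶ S.X₂.X n :=
  (σ n).s

/-- The degreewise retraction of a degreewise split sequence. -/
def retractionHoms {S : ShortComplex (CochainComplex (ModuleCat.{u} A) ℤ)}
    (σ : ∀ n, (S.map (HomologicalComplex.eval _ _ n)).Splitting) (n : ℤ) : S.X₂.X n ⟶ S.X₁.X n :=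
  (σ n).r

/-- `Hom_A(L, -)` of a degreewise split sequence is degreewise split. -/
def homFunctorSplitting (S : ShortComplex (CochainComplex (ModuleCat.{u} A) ℤ))
    (σ : ∀ n, (S.map (HomologicalComplex.eval _ _ n)).Splitting) (n : ℤ) :
    ((S.map (homFunctor L)).map (HomologicalComplex.eval _ _ n)).Splitting where
  r := homPostcomp L (Cochain.ofHoms (retractionHoms σ)) n n (add_zero n)
  s := homPostcomp L (Cochain.ofHoms (sectionHoms σ)) n n (add_zero n)
  f_r := homComplex_hom_ext fun f => by
    refine (Cochain.comp_assoc_of_second_is_zero_cochain (toCochain f) (Cochain.ofHom S.f)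
      (Cochain.ofHoms (retractionHoms σ)) (add_zero n)).trans ?_
    refine Eq.trans ?_ (Cochain.comp_id (toCochain f))
    refine congrArg (fun z => (toCochain f).comp z (add_zero n)) ?_
    refine (Cochain.ofHoms_comp _ _).trans ?_
    exact congrArg Cochain.ofHoms (funext fun p => (σ p).f_r)
  s_g := homComplex_hom_ext fun f => by
    refine (Cochain.comp_assoc_of_second_is_zero_cochain (toCochain f)
      (Cochain.ofHoms (sectionHoms σ)) (Cochain.ofHom S.g) (add_zero n)).trans ?_
    refine Eq.trans ?_ (Cochain.comp_id (toCochain f))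
    refine congrArg (fun z => (toCochain f).comp z (add_zero n)) ?_
    refine (Cochain.ofHoms_comp _ _).trans ?_
    exact congrArg Cochain.ofHoms (funext fun p => (σ p).s_g)
  id := homComplex_hom_ext fun f => by
    refine Eq.trans ?_ (Cochain.comp_id (toCochain f))
    refine (congrArg₂ (· + ·)
      (Cochain.comp_assoc_of_second_is_zero_cochain (toCochain f)
        (Cochain.ofHoms (retractionHoms σ)) (Cochain.ofHom S.f) (add_zero n))
      (Cochain.comp_assoc_of_second_is_zero_cochain (toCochain f) (Cochain.ofHom S.g)
        (Cochain.ofHoms (sectionHoms σ)) (add_zero n))).trans ?_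
    refine (Cochain.comp_add _ _ _ _).symm.trans ?_
    refine congrArg (fun z => (toCochain f).comp z (add_zero n)) ?_
    refine (congrArg₂ (· + ·) (Cochain.ofHoms_comp _ _) (Cochain.ofHoms_comp _ _)).trans ?_
    ext p x
    exact congrArg (fun g => g.hom x) (σ p).id

/-- The connecting cocycle is the section, then the differential, then the retraction. Expanding the
differential of `f` followed by the section gives a second term, involving the differential of `L`,
which dies because section followed by retraction is zero. -/
lemma toCochain_cocycle_homFunctorSplitting
    (S : ShortComplex (CochainComplex (ModuleCat.{u} A) ℤ))
    (σ : ∀ n, (S.map (HomologicalComplex.eval _ _ n)).Splitting) (n m : ℤ) (h : n + 1 = m)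
    (f : (homComplex L S.X₃).X n) :
    toCochain (J := S.X₁) (n := m) (((CochainComplex.cocycleOfDegreewiseSplit
      (S.map (homFunctor L)) (homFunctorSplitting L S σ)).1.v n m h).hom f) =
    (toCochain f).comp (CochainComplex.cocycleOfDegreewiseSplit S σ).1 h := by
  change ((δ n m ((toCochain f).comp (Cochain.ofHoms (sectionHoms σ)) (add_zero n))).comp
    (Cochain.ofHoms (retractionHoms σ)) (add_zero m) : Cochain (leftComplex L) S.X₁ m) = _
  ext p q hpq : 1
  subst h
  rw [Cochain.comp_zero_cochain_v, δ_v n (n + 1) rfl _ p q hpq (p + n) (p + 1) (by omega) rfl,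
    Cochain.comp_zero_cochain_v, Cochain.comp_zero_cochain_v,
    Cochain.comp_v (toCochain f) _ rfl p (p + n) q rfl (by omega)]
  have hr : sectionHoms σ q ≫ retractionHoms σ q = 0 := (σ q).s_r
  rw [Preadditive.add_comp, Linear.units_smul_comp, Category.assoc, Category.assoc,
    Category.assoc, Category.assoc, Cochain.ofHoms_v, Cochain.ofHoms_v, Cochain.ofHoms_v, hr,
    comp_zero, comp_zero, smul_zero, add_zero]
  rfl

lemma rightUnshift_comp_homOfDegreewiseSplit {K : CochainComplex (ModuleCat.{u} A) ℤ}
    (S : ShortComplex (CochainComplex (ModuleCat.{u} A) ℤ))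
    (σ : ∀ n, (S.map (HomologicalComplex.eval _ _ n)).Splitting) (n : ℤ) (f : Cochain K S.X₃ n) :
    (f.comp (Cochain.ofHom (CochainComplex.homOfDegreewiseSplit S σ))
      (add_zero n)).rightUnshift (n + 1) rfl =
    f.comp (CochainComplex.cocycleOfDegreewiseSplit S σ).1 rfl := by
  ext p q hpq : 1
  rw [Cochain.rightUnshift_v _ _ _ p q hpq (p + n) rfl, Cochain.comp_zero_cochain_v,
    Cochain.ofHom_v, CochainComplex.homOfDegreewiseSplit_f,
    Cochain.comp_v f _ rfl p (p + n) q rfl (by omega)]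
  obtain rfl : q = p + n + 1 := by omega
  exact Category.comp_id _

/-- The triangle of a degreewise split sequence is preserved by `Hom_A(L, -)`. -/
def homFunctorMapTriangleIso (S : ShortComplex (CochainComplex (ModuleCat.{u} A) ℤ))
    (σ : ∀ n, (S.map (HomologicalComplex.eval _ _ n)).Splitting) :
    (homFunctor L).mapTriangle.obj (CochainComplex.triangleOfDegreewiseSplit S σ) ≅
      CochainComplex.triangleOfDegreewiseSplit (S.map (homFunctor L))
        (homFunctorSplitting L S σ) :=
  Pretriangulated.Triangle.isoMk _ _ (Iso.refl _) (Iso.refl _) (Iso.refl _)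
    ((Category.comp_id _).trans (Category.id_comp _).symm)
    ((Category.comp_id _).trans (Category.id_comp _).symm) (by
      refine Eq.trans ?_ (Category.id_comp _).symm
      refine (congrArg (_ ≫ ·) ((shiftFunctor _ (1 : ℤ)).map_id _)).trans
        ((Category.comp_id _).trans ?_)
      ext n : 1
      refine homComplex_hom_ext (J := S.X₁) (n := n + 1) fun f => ?_
      refine Eq.trans ?_ (Eq.trans (toCochain_cocycle_homFunctorSplitting L S σ n (n + 1) rfl f).symm
        (congrArg (fun g => toCochain (J := S.X₁) (n := n + 1) (ModuleCat.Hom.hom g f))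
          (CochainComplex.homOfDegreewiseSplit_f (S.map (homFunctor L))
            (homFunctorSplitting L S σ) n).symm))
      exact rightUnshift_comp_homOfDegreewiseSplit S σ _ (toCochain (J := S.X₃) (n := n) f))

/-- Distinguished triangles in the homotopy category come from degreewise split sequences, and
degreewise splittings survive because they act by postcomposition with cochains of degree `0`. -/
instance : (homFunctorHo L).IsTriangulated where
  map_distinguished T hT := by
    rw [HomotopyCategory.distinguished_iff_iso_trianglehOfDegreewiseSplit] at hT ⊢
    obtain ⟨S, σ, ⟨e⟩⟩ := hT
    refine ⟨S.map (homFunctor L), homFunctorSplitting L S σ, ⟨?_⟩⟩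
    refine (homFunctorHo L).mapTriangle.mapIso e ≪≫
      (Functor.mapTriangleCompIso _ _).symm.app _ ≪≫
      (Functor.mapTriangleIso (homFunctorHoFactors L)).app _ ≪≫
      (Functor.mapTriangleCompIso _ _).app _ ≪≫
      (toHo B).mapTriangle.mapIso (homFunctorMapTriangleIso L S σ)

end HomFunctorTriangulated

variable {A B : Type u} [Ring A] [Ring B]

/-! ### Elements of the tensor product of complexes. -/

section TensorElements

/-- A biadditive, balanced, `A`-homogeneous map induces a map on `M ⊗_B N`. -/
def tensorLift {M : Bimod A B} {N : ModuleCat.{u} B} {Z : ModuleCat.{u} A} (φ : M → N → Z)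
    (h₁ : ∀ x x' y, φ (x + x') y = φ x y + φ x' y) (h₂ : ∀ x y y', φ x (y + y') = φ x y + φ x y')
    (h₃ : ∀ (a : A) x y, φ (inclA A B a • x) y = a • φ x y)
    (h₄ : ∀ x (b : B) y, φ (inclB A B (MulOpposite.op b) • x) y = φ x (b • y)) :
    tensorObj M N ⟶ Z :=
  ModuleCat.ofHom ((balancing M N).liftQ (TensorProduct.AlgebraTensorModule.lift
      { toFun := fun x => (AddMonoidHom.mk' (φ x) (h₂ x)).toIntLinearMap
        map_add' := fun x x' => LinearMap.ext fun y => h₁ x x' y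
        map_smul' := fun a x => LinearMap.ext fun y => h₃ a x y }) (by
    refine Submodule.span_le.2 ?_
    rintro _ ⟨x, b, y, rfl⟩
    change _ = _
    rw [map_sub]
    exact sub_eq_zero.2 (h₄ x b y)))

lemma smul_tmul_eq {M : Bimod A B} {N : ModuleCat.{u} B} (x : M) (b : B) (y : N) :
    tmul (inclB A B (MulOpposite.op b) • x) y = tmul x (b • y) :=
  sub_eq_zero.1 ((map_sub (balancing M N).mkQ _ _).symm.trans
    ((Submodule.Quotient.mk_eq_zero _).2 (Submodule.subset_span ⟨x, b, y, rfl⟩)))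

variable (L : CochainComplex (Bimod A B) ℤ) (P : CochainComplex (ModuleCat.{u} B) ℤ)

/-- The inclusion of a summand of the tensor product of complexes. -/
def ιTensor (p q n : ℤ) (h : p + q = n) :
    tensorObj (L.X p) (P.X q) ⟶ (tensorComplex L P).X n :=
  HomologicalComplex.ιMapBifunctor L P (tensorBifunctor A B) (ComplexShape.up ℤ) p q n h

variable {L P}

/-- The element `x ⊗ y` of the tensor product of complexes. -/
def tens {p q : ℤ} (n : ℤ) (h : p + q = n) (x : L.X p) (y : P.X q) : (tensorComplex L P).X n :=
  (ιTensor L P p q n h).hom (tmul x y)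

lemma tensorComplex_hom_ext {n : ℤ} {Z : ModuleCat.{u} A} {f g : (tensorComplex L P).X n ⟶ Z}
    (h : ∀ (p q : ℤ) (hpq : p + q = n) (x : L.X p) (y : P.X q),
      f.hom (tens n hpq x y) = g.hom (tens n hpq x y)) : f = g :=
  HomologicalComplex.mapBifunctor.hom_ext fun p q hpq => tensor_hom_ext fun x y => h p q hpq x y

lemma tens_add {p q n : ℤ} (h : p + q = n) (x : L.X p) (y y' : P.X q) :
    tens n h x (y + y') = tens n h x y + tens n h x y' := by
  simp [tens, tmul_add]

lemma add_tens {p q n : ℤ} (h : p + q = n) (x x' : L.X p) (y : P.X q) :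
    tens n h (x + x') y = tens n h x y + tens n h x' y := by
  simp [tens, add_tmul]

lemma smul_tens {p q n : ℤ} (h : p + q = n) (a : A) (x : L.X p) (y : P.X q) :
    tens n h (inclA A B a • x) y = a • tens n h x y := 
  (ιTensor L P p q n h).hom.map_smul a (tmul x y)

lemma tens_balanced {p q n : ℤ} (h : p + q = n) (b : B) (x : L.X p) (y : P.X q) :
    tens n h (inclB A B (MulOpposite.op b) • x) y = tens n h x (b • y) := by
  rw [tens, smul_tmul_eq, tens]

/-- The map out of a term of the tensor product of complexes. -/
def tensorDesc {n : ℤ} {Z : ModuleCat.{u} A}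
    (φ : ∀ (p q : ℤ), p + q = n → (tensorObj (L.X p) (P.X q) ⟶ Z)) :
    (tensorComplex L P).X n ⟶ Z :=
  HomologicalComplex.mapBifunctorDesc φ

@[simp] lemma tensorDesc_tens {n : ℤ} {Z : ModuleCat.{u} A}
    (φ : ∀ (p q : ℤ), p + q = n → (tensorObj (L.X p) (P.X q) ⟶ Z))
    (p q : ℤ) (h : p + q = n) (x : L.X p) (y : P.X q) :
    (tensorDesc φ).hom (tens n h x y) = (φ p q h).hom (tmul x y) :=
  congrArg (fun g : tensorObj (L.X p) (P.X q) ⟶ Z => g.hom (tmul x y))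
    (HomologicalComplex.ι_mapBifunctorDesc (K₁ := L) (K₂ := P) (F := tensorBifunctor A B)
      (c := ComplexShape.up ℤ) φ p q h)

lemma d_tens (p q n n' p' q' : ℤ) (h : p + q = n) (hn : n + 1 = n') (hp : p + 1 = p')
    (hq : q + 1 = q') (x : L.X p) (y : P.X q) :
    ((tensorComplex L P).d n n').hom (tens n h x y) =
      tens n' (by omega) ((L.d p p').hom x) y +
        p.negOnePow • tens n' (by omega) x ((P.d q q').hom y) := by
  have e₁ : HomologicalComplex.mapBifunctor.d₁ L P (tensorBifunctor A B) (ComplexShape.up ℤ)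
      p q n' = _ :=
    HomologicalComplex.mapBifunctor.d₁_eq L P (tensorBifunctor A B) (ComplexShape.up ℤ)
    (show (ComplexShape.up ℤ).Rel p p' by simpa using hp) q n' (by simp; omega)
  have e₂ : HomologicalComplex.mapBifunctor.d₂ L P (tensorBifunctor A B) (ComplexShape.up ℤ)
      p q n' = _ :=
    HomologicalComplex.mapBifunctor.d₂_eq L P (tensorBifunctor A B) (ComplexShape.up ℤ) p
    (show (ComplexShape.up ℤ).Rel q q' by simpa using hq) n' (by simp; omega)
  have e : ιTensor L P p q n h ≫ (tensorComplex L P).d n n' =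
      tensorMap (L.d p p') (𝟙 (P.X q)) ≫ ιTensor L P p' q n' (by omega) +
        p.negOnePow • (tensorMap (𝟙 (L.X p)) (P.d q q') ≫ ιTensor L P p q' n' (by omega)) := by
    refine (congrArg (ιTensor L P p q n h ≫ ·) (HomologicalComplex.mapBifunctor.d_eq L P
      (tensorBifunctor A B) (ComplexShape.up ℤ) n n')).trans ?_
    refine (Preadditive.comp_add _ _ _ _ _ _).trans ?_
    refine congrArg₂ (· + ·) ((HomologicalComplex.mapBifunctor.ι_D₁ L P
      (tensorBifunctor A B) (ComplexShape.up ℤ) n n' p q h).trans (e₁.trans ?_))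
      ((HomologicalComplex.mapBifunctor.ι_D₂ L P
      (tensorBifunctor A B) (ComplexShape.up ℤ) n n' p q h).trans e₂)
    exact one_smul _ _
  refine (congrArg (fun g : tensorObj (L.X p) (P.X q) ⟶ (tensorComplex L P).X n' =>
    g.hom (tmul x y)) e).trans ?_
  obtain hp' | hp' := Int.units_eq_one_or p.negOnePow
  · rw [hp', one_smul, one_smul]; rfl
  · rw [hp', Units.neg_smul, one_smul, Units.neg_smul, one_smul]; rfl

/-- The functor `L ⊗_B -` on complexes. -/
def tensorFunctor (L : CochainComplex (Bimod A B) ℤ) :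
    CochainComplex (ModuleCat.{u} B) ℤ ⥤ CochainComplex (ModuleCat.{u} A) ℤ :=
  ((tensorBifunctor A B).map₂CochainComplex).obj L

lemma tensorFunctor_map_tens {P' : CochainComplex (ModuleCat.{u} B) ℤ} (f : P ⟶ P') {p q n : ℤ}
    (h : p + q = n) (x : L.X p) (y : P.X q) :
    (((tensorFunctor L).map f).f n).hom (tens n h x y) = tens (P := P') n h x ((f.f q).hom y) := by
  have := HomologicalComplex.ι_mapBifunctorMap (𝟙 L) f (tensorBifunctor A B)
    (ComplexShape.up ℤ) p q n h
  exact (congrArg (fun g => g.hom (tmul x y)) this)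

end TensorElements

variable {A B : Type u} [Ring A] [Ring B]

/-! ### The tensor-Hom adjunction on complexes. -/

section Adjunction

lemma hom_units_smul {R : Type u} [Ring R] {M N : ModuleCat.{u} R} (f : M ⟶ N) (k : ℤˣ) (x : M) :
    f.hom (k • x) = k • f.hom x := by
  obtain rfl | rfl := Int.units_eq_one_or k
  · rw [one_smul, one_smul]
  · rw [Units.neg_smul, one_smul, Units.neg_smul, one_smul, map_neg]

variable {L : CochainComplex (Bimod A B) ℤ} {P P' : CochainComplex (ModuleCat.{u} B) ℤ}
  {J J' : CochainComplex (ModuleCat.{u} A) ℤ}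

/-- The value of a cochain on an element. -/
def evalCochain {q : ℤ} (f : (homComplex L J).X q) {p n : ℤ} (h : p + q = n) (x : L.X p) : J.X n :=
  ((toCochain f).v p n h).hom x

lemma homComplex_ext {q : ℤ} {f g : (homComplex L J).X q}
    (h : ∀ (p n : ℤ) (hpq : p + q = n) (x : L.X p), evalCochain f hpq x = evalCochain g hpq x) :
    f = g := by
  apply toCochain_injective
  ext p n hpq : 1
  ext x
  exact h p n hpq x

lemma evalCochain_add {q : ℤ} (f g : (homComplex L J).X q) {p n : ℤ} (h : p + q = n) (x : L.X p) :
    evalCochain (f + g) h x = evalCochain f h x + evalCochain g h x := rfl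

lemma evalCochain_add_right {q : ℤ} (f : (homComplex L J).X q) {p n : ℤ} (h : p + q = n)
    (x y : L.X p) : evalCochain f h (x + y) = evalCochain f h x + evalCochain f h y :=
  map_add ((toCochain f).v p n h).hom x y

lemma evalCochain_smul_right {q : ℤ} (f : (homComplex L J).X q) {p n : ℤ} (h : p + q = n)
    (a : A) (x : L.X p) : evalCochain f h (inclA A B a • x) = a • evalCochain f h x :=
  ((toCochain f).v p n h).hom.map_smul a x

lemma evalCochain_smul {q : ℤ} (b : B) (f : (homComplex L J).X q) {p n : ℤ} (h : p + q = n)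
    (x : L.X p) :
    evalCochain (b • f) h x = evalCochain f h (inclB A B (MulOpposite.op b) • x) := by
  refine (congrArg (fun g : (leftComplex L).X p ⟶ J.X n => g.hom x)
    (Cochain.zero_cochain_comp_v (Cochain.ofHom (actB L (MulOpposite.op b))) (toCochain f)
      p n h)).trans ?_
  rfl

lemma evalCochain_d {q q' : ℤ} (hq : q + 1 = q') (f : (homComplex L J).X q) {p p' n n' : ℤ}
    (h : p + q = n) (hn : n + 1 = n') (hp : p + 1 = p') (h' : p + q' = n') (x : L.X p) :
    evalCochain (((homComplex L J).d q q').hom f) h' x =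
      (J.d n n').hom (evalCochain f h x) +
        q'.negOnePow • evalCochain f (by omega) ((L.d p p').hom x) := by
  refine (congrArg (fun g : (leftComplex L).X p ⟶ J.X n' => g.hom x)
    (δ_v q q' hq (toCochain f) p n' h' n p' (by omega) hp)).trans ?_
  obtain hp' | hp' := Int.units_eq_one_or q'.negOnePow
  · rw [hp', one_smul, one_smul]; rfl
  · rw [hp', Units.neg_smul, one_smul, Units.neg_smul, one_smul]; rfl

lemma evalCochain_map (φ : J ⟶ J') {q : ℤ} (f : (homComplex L J).X q) {p n : ℤ} (h : p + q = n)
    (x : L.X p) :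
    evalCochain (((homComplexMap L φ).f q).hom f) h x = (φ.f n).hom (evalCochain f h x) := by
  refine (congrArg (fun g : (leftComplex L).X p ⟶ J'.X n => g.hom x)
    (Cochain.comp_zero_cochain_v (toCochain f) (Cochain.ofHom φ) p n h)).trans ?_
  rw [Cochain.ofHom_v]
  rfl

/-- The cochain `x ↦ φ(x)` for an `A`-linear family. -/
def mkHomElement {q : ℤ} (φ : ∀ (p n : ℤ), p + q = n → L.X p → J.X n)
    (h₁ : ∀ p n h x y, φ p n h (x + y) = φ p n h x + φ p n h y)
    (h₂ : ∀ p n h (a : A) x, φ p n h (inclA A B a • x) = a • φ p n h x) : (homComplex L J).X q :=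
  ofCochain (Cochain.mk fun p n h => ModuleCat.ofHom (X := (toLeft A B).obj (L.X p))
    { toFun := φ p n h
      map_add' := h₁ p n h
      map_smul' := h₂ p n h })

@[simp] lemma evalCochain_mkHomElement {q : ℤ} (φ : ∀ (p n : ℤ), p + q = n → L.X p → J.X n)
    (h₁ h₂) {p n : ℤ} (h : p + q = n) (x : L.X p) :
    evalCochain (mkHomElement φ h₁ h₂) h x = φ p n h x := rfl

/-- The map `P ⟶ Hom_A(L, J)` corresponding to `L ⊗_B P ⟶ J`. -/
def tensorHomToFun (g : tensorComplex L P ⟶ J) : P ⟶ homComplex L J where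
  f q := ModuleCat.ofHom
    { toFun := fun y => mkHomElement
        -- The Koszul sign `(-1)^(pq)` reconciles the sign `(-1)^p` in the differential of the
        -- tensor product with the sign `(-1)^(q+1)` in that of the Hom complex.
        (fun p n h x => (p * q).negOnePow • (g.f n).hom (tens n h x y))
        (fun p n h x x' => by rw [add_tens, map_add, smul_add])
        (fun p n h a x => by rw [smul_tens, map_smul, smul_comm])
      map_add' := fun y y' => homComplex_ext fun p n h x => by
        refine Eq.trans ?_ (evalCochain_add _ _ h x).symm
        simp only [evalCochain_mkHomElement]
        rw [tens_add, map_add, smul_add]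
      map_smul' := fun b y => homComplex_ext fun p n h x => by
        refine Eq.trans ?_ (evalCochain_smul _ _ h x).symm
        simp only [evalCochain_mkHomElement, RingHom.id_apply]
        exact congrArg (fun z => (p * q).negOnePow • (g.f n).hom z) (tens_balanced h b x y).symm }
  comm' q q' hq := by
    have hq : q + 1 = q' := hq
    ext y
    refine homComplex_ext fun p n' h x => ?_
    refine (evalCochain_d hq _ (n := p + q) rfl (by omega) rfl _ _).trans ?_
    change (J.d (p + q) n').hom ((p * q).negOnePow • (g.f (p + q)).hom (tens (p + q) rfl x y)) +
      q'.negOnePow • ((p + 1) * q).negOnePow •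
        (g.f n').hom (tens n' (by omega) ((L.d p (p + 1)).hom x) y) =
      (p * q').negOnePow • (g.f n').hom (tens n' h x ((P.d q q').hom y))
    have e₁ := congrArg (fun φ => φ.hom (tens (p + q) rfl x y)) (g.comm (p + q) n')
    have e₂ := (g.f n').hom.congr_arg
      (d_tens p q (p + q) n' (p + 1) q' rfl (by omega) rfl hq x y)
    have e₃ := e₁.trans e₂
    simp only [ModuleCat.hom_comp, LinearMap.comp_apply] at e₃
    rw [map_add, hom_units_smul] at e₃
    rw [hom_units_smul, e₃, smul_add, smul_smul, smul_smul, ← Int.negOnePow_add,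
      ← Int.negOnePow_add]
    subst hq
    have s₁ : (p * q + p).negOnePow = (p * (q + 1)).negOnePow := by rw [mul_add, mul_one]
    have s₂ : (q + 1 + (p + 1) * q).negOnePow = - (p * q).negOnePow := by
      rw [show q + 1 + (p + 1) * q = p * q + (2 * q + 1) by ring, Int.negOnePow_add,
        Int.negOnePow_odd (2 * q + 1) (odd_two_mul_add_one q), mul_neg, mul_one]
    rw [s₁, s₂, Units.neg_smul]
    abel

@[simp] lemma evalCochain_tensorHomToFun (g : tensorComplex L P ⟶ J) {p q n : ℤ} (h : p + q = n)
    (x : L.X p) (y : P.X q) :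
    evalCochain (((tensorHomToFun g).f q).hom y) h x =
      (p * q).negOnePow • (g.f n).hom (tens n h x y) := rfl

/-- The terms of the map `L ⊗_B P ⟶ J` corresponding to `P ⟶ Hom_A(L, J)`. -/
def tensorHomInvFunTerm (f : P ⟶ homComplex L J) (n : ℤ) : (tensorComplex L P).X n ⟶ J.X n :=
  tensorDesc fun p q h => tensorLift
    (fun x y => (p * q).negOnePow • evalCochain ((f.f q).hom y) h x)
    (fun x x' y => by rw [evalCochain_add_right, smul_add])
    (fun x y y' => by rw [map_add, evalCochain_add, smul_add])
    (fun a x y => by rw [evalCochain_smul_right, smul_comm])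
    (fun x b y => by rw [map_smul]; exact congrArg _ (evalCochain_smul _ _ h x).symm)

lemma tensorHomInvFunTerm_tens (f : P ⟶ homComplex L J) {p q n : ℤ} (h : p + q = n)
    (x : L.X p) (y : P.X q) :
    (tensorHomInvFunTerm f n).hom (tens n h x y) =
      (p * q).negOnePow • evalCochain ((f.f q).hom y) h x :=
  tensorDesc_tens _ p q h x y

/-- The map `L ⊗_B P ⟶ J` corresponding to `P ⟶ Hom_A(L, J)`. -/
def tensorHomInvFun (f : P ⟶ homComplex L J) : tensorComplex L P ⟶ J where
  f n := tensorHomInvFunTerm f n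
  comm' n n' hn := by
    have hn : n + 1 = n' := hn
    refine tensorComplex_hom_ext fun p q h x y => ?_
    simp only [ModuleCat.hom_comp, LinearMap.comp_apply]
    rw [d_tens p q n n' (p + 1) (q + 1) h hn rfl rfl, map_add, hom_units_smul,
      tensorHomInvFunTerm_tens, tensorHomInvFunTerm_tens, tensorHomInvFunTerm_tens,
      hom_units_smul, smul_smul, ← Int.negOnePow_add]
    have e₁ := congrArg (fun φ => φ.hom y) (f.comm q (q + 1))
    simp only [ModuleCat.hom_comp, LinearMap.comp_apply] at e₁
    rw [← e₁]
    rw [evalCochain_d rfl _ h hn rfl, smul_add, smul_smul, ← Int.negOnePow_add]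
    have s₁ : (p + p * (q + 1)).negOnePow = (p * q).negOnePow := by
      rw [show p + p * (q + 1) = p * q + 2 * p by ring, Int.negOnePow_add,
        Int.negOnePow_even (2 * p) (even_two_mul p), mul_one]
    have s₂ : (p + p * (q + 1) + (q + 1)).negOnePow = - ((p + 1) * q).negOnePow := by
      rw [show p + p * (q + 1) + (q + 1) = (p + 1) * q + (2 * p + 1) by ring, Int.negOnePow_add,
        Int.negOnePow_odd (2 * p + 1) (odd_two_mul_add_one p), mul_neg, mul_one]
    rw [s₁, s₂, Units.neg_smul]
    abel

@[simp] lemma tensorHomInvFun_tens (f : P ⟶ homComplex L J) {p q n : ℤ} (h : p + q = n)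
    (x : L.X p) (y : P.X q) :
    ((tensorHomInvFun f).f n).hom (tens n h x y) =
      (p * q).negOnePow • evalCochain ((f.f q).hom y) h x :=
  tensorHomInvFunTerm_tens f h x y

/-- The adjunction between `L ⊗_B -` and `Hom_A(L, -)` on complexes. -/
def tensorHomEquiv : (tensorComplex L P ⟶ J) ≃ (P ⟶ homComplex L J) where
  toFun := tensorHomToFun
  invFun := tensorHomInvFun
  left_inv g := by
    ext n : 1
    refine tensorComplex_hom_ext fun p q h x y => ?_
    rw [tensorHomInvFun_tens, evalCochain_tensorHomToFun, smul_smul, Int.units_mul_self, one_smul]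
  right_inv f := by
    ext q y
    refine homComplex_ext fun p n h x => ?_
    rw [evalCochain_tensorHomToFun, tensorHomInvFun_tens, smul_smul, Int.units_mul_self, one_smul]

variable (L)

/-- The data defining the adjunction between `L ⊗_B -` and `Hom_A(L, -)` on complexes. -/
def tensorHomCore : Adjunction.CoreHomEquiv (tensorFunctor L) (homFunctor L) :=
    { homEquiv := fun _ _ => tensorHomEquiv
      homEquiv_naturality_left_symm := by
        intro P P' J f g
        ext n : 1
        refine tensorComplex_hom_ext fun p q h x y => ?_
        refine (tensorHomInvFun_tens (f ≫ g) h x y).trans ?_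
        refine Eq.trans ?_ (congrArg (fun z =>
          ((tensorHomInvFun g).f n).hom z) (tensorFunctor_map_tens f h x y)).symm
        exact (tensorHomInvFun_tens g h x ((f.f q).hom y)).symm
      homEquiv_naturality_right := by
        intro P J J' f g
        ext q y
        refine homComplex_ext fun p n h x => ?_
        refine Eq.trans ?_ (evalCochain_map _ _ _ _).symm
        exact (hom_units_smul (g.f n) _ _).symm }

/-- The adjunction between `L ⊗_B -` and `Hom_A(L, -)` on complexes. -/
def tensorHomAdjunction : tensorFunctor L ⊣ homFunctor L :=
  Adjunction.mkOfHomEquiv (tensorHomCore L)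

end Adjunction

variable {A B : Type u} [Ring A] [Ring B] (L : CochainComplex (Bimod A B) ℤ)

/-! ### The adjunction on homotopy categories. -/

section TensorFunctorTriangulated

/-- The functor `L ⊗_B -` on homotopy categories. -/
def tensorFunctorHo : HoCat B ⥤ HoCat A :=
  CategoryTheory.Quotient.lift _ (tensorFunctor L ⋙ toHo A)
    (fun _ _ _ _ ⟨h⟩ => HomotopyCategory.eq_of_homotopy _ _
      (HomologicalComplex.mapBifunctorMapHomotopy₂ (𝟙 L) h (tensorBifunctor A B) _))

/-- The adjunction between `L ⊗_B -` and `Hom_A(L, -)` on homotopy categories. -/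
def tensorHomAdjunctionHo : tensorFunctorHo L ⊣ homFunctorHo L where
  unit := CategoryTheory.Quotient.natTransLift _
    { app := fun P => (toHo B).map ((tensorHomAdjunction L).unit.app P)
      naturality := fun P P' f => by
        refine ((toHo B).map_comp _ _).symm.trans (Eq.trans ?_ ((toHo B).map_comp _ _))
        exact congrArg (toHo B).map ((tensorHomAdjunction L).unit.naturality f) }
  counit := CategoryTheory.Quotient.natTransLift _
    { app := fun J => (toHo A).map ((tensorHomAdjunction L).counit.app J)
      naturality := fun P P' f => by
        refine ((toHo A).map_comp _ _).symm.trans (Eq.trans ?_ ((toHo A).map_comp _ _))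
        exact congrArg (toHo A).map ((tensorHomAdjunction L).counit.naturality f) }
  left_triangle_components := by
    rintro ⟨P⟩
    refine ((toHo A).map_comp _ _).symm.trans (Eq.trans ?_ ((toHo A).map_id _))
    exact congrArg (toHo A).map ((tensorHomAdjunction L).left_triangle_components P)
  right_triangle_components := by
    rintro ⟨J⟩
    refine ((toHo B).map_comp _ _).symm.trans (Eq.trans ?_ ((toHo B).map_id _))
    exact congrArg (toHo B).map ((tensorHomAdjunction L).right_triangle_components J)

/-- The compatibility with shifts is transported through the adjunction, so that the unit and counit
respect shifts, as needed in `transfer_counit`. -/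
instance : (tensorFunctorHo L).CommShift ℤ :=
  (tensorHomAdjunctionHo L).leftAdjointCommShift ℤ

instance : (tensorHomAdjunctionHo L).CommShift ℤ :=
  (tensorHomAdjunctionHo L).commShift_of_rightAdjoint ℤ

/-- A left adjoint of a triangulated functor is triangulated, so the cones of `L ⊗_B -` need no
separate analysis. -/
instance : (tensorFunctorHo L).IsTriangulated :=
  (tensorHomAdjunctionHo L).isTriangulated_leftAdjoint

end TensorFunctorTriangulated

end PseudoDualizing

end

noncomputable section
namespace PseudoDualizing

/-! ### Objects on which a given map `a ⟶ F W` is locally universal, and the five lemma for them. -/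

section FiveLemma

open Pretriangulated

universe v₁ v₂ w₁ w₂

variable {C : Type w₁} {D : Type w₂} [Category.{v₁} C] [Category.{v₂} D] (F : C ⥤ D)

/-- The transformation `(W ⟶ X) → (a ⟶ F X)` attached to `w : a ⟶ F W`. -/
def yonedaMap {W : C} {a : D} (w : a ⟶ F.obj W) (X : C) (g : W ⟶ X) : a ⟶ F.obj X := w ≫ F.map g

variable {W : C} {a : D} (w : a ⟶ F.obj W)

lemma yonedaMap_comp {X Y : C} (g : W ⟶ X) (h : X ⟶ Y) :
    yonedaMap F w Y (g ≫ h) = yonedaMap F w X g ≫ F.map h := by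
  simp [yonedaMap]

section Additive

variable [Preadditive C] [Preadditive D]

lemma yonedaMap_zero [F.Additive] {X : C} : yonedaMap F w X 0 = 0 := by
  simp [yonedaMap]

lemma yonedaMap_sub [F.Additive] {X : C} (g h : W ⟶ X) :
    yonedaMap F w X (g - h) = yonedaMap F w X g - yonedaMap F w X h := by
  simp [yonedaMap]

lemma yonedaMap_injective [F.Additive] {X : C}
    (h : ∀ g : W ⟶ X, yonedaMap F w X g = 0 → g = 0) :
    Function.Injective (yonedaMap F w X) := fun g g' hg => by
  rw [← sub_eq_zero, ← yonedaMap_sub] at hg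
  exact sub_eq_zero.1 (h _ hg)

lemma yonedaMap_eq_zero_iff [F.Additive] {X : C} (h : Function.Injective (yonedaMap F w X))
    {g : W ⟶ X} (hg : yonedaMap F w X g = 0) : g = 0 :=
  h (hg.trans (yonedaMap_zero F w).symm)

end Additive

lemma yonedaMap_injective_of_retract {X Y : C} (i : X ⟶ Y) (r : Y ⟶ X) (hir : i ≫ r = 𝟙 X)
    (h : Function.Injective (yonedaMap F w Y)) : Function.Injective (yonedaMap F w X) := by
  intro g g' hg
  have : g ≫ i = g' ≫ i := h (by rw [yonedaMap_comp, yonedaMap_comp, hg])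
  rw [← Category.comp_id g, ← Category.comp_id g', ← hir, ← Category.assoc, this, Category.assoc]

lemma yonedaMap_surjective_of_retract {X Y : C} (i : X ⟶ Y) (r : Y ⟶ X) (hir : i ≫ r = 𝟙 X)
    (h : Function.Surjective (yonedaMap F w Y)) : Function.Surjective (yonedaMap F w X) := by
  intro φ
  obtain ⟨g, hg⟩ := h (φ ≫ F.map i)
  refine ⟨g ≫ r, ?_⟩
  rw [yonedaMap_comp, hg, Category.assoc, ← F.map_comp, hir, F.map_id, Category.comp_id]

lemma yonedaMap_bijective_of_retract {X Y : C} (i : X ⟶ Y) (r : Y ⟶ X) (hir : i ≫ r = 𝟙 X)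
    (h : Function.Bijective (yonedaMap F w Y)) : Function.Bijective (yonedaMap F w X) :=
  ⟨yonedaMap_injective_of_retract F w i r hir h.1, yonedaMap_surjective_of_retract F w i r hir h.2⟩

lemma yonedaMap_bijective_of_iso {X Y : C} (e : X ≅ Y)
    (h : Function.Bijective (yonedaMap F w Y)) : Function.Bijective (yonedaMap F w X) :=
  yonedaMap_bijective_of_retract F w e.hom e.inv e.hom_inv_id h

section Local

variable [HasShift C ℤ]

/-- The objects `X` such that `(W ⟶ X⟦n⟧) → (a ⟶ F (X⟦n⟧))` is bijective for all `n`. -/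
def yonedaLocal : ObjectProperty C := fun X =>
  ∀ n : ℤ, Function.Bijective (yonedaMap F w (X⟦n⟧))

instance : (yonedaLocal F w).IsStableUnderRetracts where
  of_retract {X Y} r h n := yonedaMap_bijective_of_retract F w (r.i⟦n⟧') (r.r⟦n⟧')
    (by rw [← Functor.map_comp, r.retract, CategoryTheory.Functor.map_id]) (h n)

instance : (yonedaLocal F w).IsClosedUnderIsomorphisms where
  of_iso e h n := yonedaMap_bijective_of_iso F w ((shiftFunctor C n).mapIso e.symm) (h n)

lemma yonedaLocal_shift {X : C} (h : yonedaLocal F w X) (k : ℤ) : yonedaLocal F w (X⟦k⟧) :=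
  fun n => yonedaMap_bijective_of_iso F w ((shiftFunctorAdd C k n).symm.app X) (h (k + n))

end Local

variable [Preadditive C] [HasZeroObject C] [HasShift C ℤ] [∀ n : ℤ, (shiftFunctor C n).Additive]
  [Pretriangulated C]
  [Preadditive D] [HasZeroObject D] [HasShift D ℤ] [∀ n : ℤ, (shiftFunctor D n).Additive]
  [Pretriangulated D] [F.CommShift ℤ] [F.IsTriangulated]

/-- One of the two four-lemmas, as a chase in the long exact sequences of the triangle and of its
image. Injectivity at `obj₁[1]` allows a lift at the third vertex to be pulled back to the second
one. -/
lemma yonedaMap_surjective_of_distinguished (T : Triangle C) (hT : T ∈ distTriang C)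
    (h₁ : Function.Surjective (yonedaMap F w T.obj₁))
    (h₃ : Function.Surjective (yonedaMap F w T.obj₃))
    (h₁' : Function.Injective (yonedaMap F w (T.obj₁⟦(1 : ℤ)⟧))) :
    Function.Surjective (yonedaMap F w T.obj₂) := by
  intro φ
  obtain ⟨g₃, hg₃⟩ := h₃ (φ ≫ F.map T.mor₂)
  have h0 : g₃ ≫ T.mor₃ = 0 := by
    apply yonedaMap_eq_zero_iff F w h₁'
    rw [yonedaMap_comp, hg₃, Category.assoc, ← F.map_comp, comp_distTriang_mor_zero₂₃ _ hT,
      F.map_zero, comp_zero]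
  obtain ⟨g₂, rfl⟩ := Triangle.coyoneda_exact₃ T hT g₃ h0
  have h0' : (φ - yonedaMap F w _ g₂) ≫ F.map T.mor₂ = 0 := by
    rw [Preadditive.sub_comp, ← hg₃, yonedaMap_comp, sub_self]
  obtain ⟨ψ, hψ⟩ := Triangle.coyoneda_exact₂ _ (F.map_distinguished T hT) _ h0'
  obtain ⟨g₁, rfl⟩ := h₁ ψ
  refine ⟨g₂ + g₁ ≫ T.mor₁, ?_⟩
  have : φ - yonedaMap F w _ g₂ = yonedaMap F w _ (g₁ ≫ T.mor₁) := by
    rw [yonedaMap_comp]; exact hψ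
  rw [sub_eq_iff_eq_add'] at this
  rw [this]
  simp [yonedaMap]

/-- The other four-lemma. Surjectivity at `obj₃[-1]` enters through the inverse rotation of the
triangle. -/
lemma yonedaMap_injective_of_distinguished (T : Triangle C) (hT : T ∈ distTriang C)
    (h₁ : Function.Injective (yonedaMap F w T.obj₁))
    (h₃ : Function.Injective (yonedaMap F w T.obj₃))
    (h₃' : Function.Surjective (yonedaMap F w (T.obj₃⟦(-1 : ℤ)⟧))) :
    Function.Injective (yonedaMap F w T.obj₂) := by
  apply yonedaMap_injective
  intro g hg
  have h0 : g ≫ T.mor₂ = 0 := by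
    apply yonedaMap_eq_zero_iff F w h₃
    rw [yonedaMap_comp, hg, zero_comp]
  obtain ⟨g₁, rfl⟩ := Triangle.coyoneda_exact₂ T hT g h0
  have hT' := inv_rot_of_distTriang T hT
  rw [yonedaMap_comp] at hg
  obtain ⟨ψ, hψ⟩ := Triangle.coyoneda_exact₂ _ (F.map_distinguished _ hT') _ hg
  obtain ⟨g₀, rfl⟩ := h₃' ψ
  have h1 : g₁ = g₀ ≫ T.invRotate.mor₁ :=
    h₁ (hψ.trans (yonedaMap_comp F w g₀ T.invRotate.mor₁).symm)
  rw [h1]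
  exact (Category.assoc _ _ _).trans
    ((congrArg (g₀ ≫ ·) (comp_distTriang_mor_zero₁₂ _ hT')).trans comp_zero)

lemma yonedaLocal₂ (T : Triangle C) (hT : T ∈ distTriang C) (h₁ : yonedaLocal F w T.obj₁)
    (h₃ : yonedaLocal F w T.obj₃) : yonedaLocal F w T.obj₂ := fun n => by
  have hT' := Triangle.shift_distinguished T hT n
  -- The chase in degree `n` also involves the neighbouring degrees. They are obtained by shifting
  -- the object, specialising to shift `0` and removing that shift.
  have h₁' := yonedaLocal_shift F w (yonedaLocal_shift F w h₁ n) 1 0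
  have h₃' := yonedaLocal_shift F w (yonedaLocal_shift F w h₃ n) (-1) 0
  have h₁'' := yonedaMap_bijective_of_iso F w ((shiftFunctorZero C ℤ).symm.app _) h₁'
  have h₃'' := yonedaMap_bijective_of_iso F w ((shiftFunctorZero C ℤ).symm.app _) h₃'
  exact ⟨yonedaMap_injective_of_distinguished F w _ hT' (h₁ n).1 (h₃ n).1 h₃''.2,
    yonedaMap_surjective_of_distinguished F w _ hT' (h₁ n).2 (h₃ n).2 h₁''.1⟩

lemma yonedaLocal₃ (T : Triangle C) (hT : T ∈ distTriang C) (h₁ : yonedaLocal F w T.obj₁)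
    (h₂ : yonedaLocal F w T.obj₂) : yonedaLocal F w T.obj₃ :=
  yonedaLocal₂ F w T.rotate (rot_of_distTriang T hT) h₂ (yonedaLocal_shift F w h₁ 1)

end FiveLemma

end PseudoDualizing

end

noncomputable section
namespace PseudoDualizing

/-! ### Stupid truncations, with terms modelled as functions on `PLift p` to keep case splits out of
the objects. -/

section StupidTruncation

variable {R : Type u} [Ring R]

open Classical in
/-- The inclusion of the functions `PLift p → M`, that is, `M` if `p` holds and `0` otherwise. -/
def pieceIn (p : Prop) (M : ModuleCat.{u} R) : ModuleCat.of R (PLift p → M) ⟶ M :=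
  ModuleCat.ofHom
    { toFun := fun f => if h : p then f ⟨h⟩ else 0
      map_add' := fun f g => by split_ifs <;> simp
      map_smul' := fun r f => by split_ifs <;> simp }

/-- The projection onto the functions `PLift p → M`. -/
def pieceOut (p : Prop) (M : ModuleCat.{u} R) : M ⟶ ModuleCat.of R (PLift p → M) :=
  ModuleCat.ofHom
    { toFun := fun x _ => x
      map_add' := fun _ _ => rfl
      map_smul' := fun _ _ => rfl }

@[simp]
lemma pieceIn_out (p : Prop) (M : ModuleCat.{u} R) : pieceIn p M ≫ pieceOut p M = 𝟙 _ := by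
  refine ModuleCat.hom_ext (LinearMap.ext fun f => funext fun h => ?_)
  exact dif_pos h.1

lemma pieceOut_in {p : Prop} (h : p) (M : ModuleCat.{u} R) : pieceOut p M ≫ pieceIn p M = 𝟙 _ := by
  ext x
  exact dif_pos h

lemma pieceOut_in_assoc {p : Prop} (h : p) (M : ModuleCat.{u} R) {N : ModuleCat.{u} R}
    (f : M ⟶ N) : pieceOut p M ≫ pieceIn p M ≫ f = f := by
  rw [← Category.assoc, pieceOut_in h, Category.id_comp]

lemma pieceIn_eq_zero {p : Prop} (h : ¬ p) (M : ModuleCat.{u} R) : pieceIn p M = 0 := by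
  ext f
  exact dif_neg h

lemma pieceOut_eq_zero {p : Prop} (h : ¬ p) (M : ModuleCat.{u} R) : pieceOut p M = 0 := by
  exact ModuleCat.hom_ext (LinearMap.ext fun x => funext fun h' => (h h'.1).elim)

lemma isZero_piece {p : Prop} (h : ¬ p) (M : ModuleCat.{u} R) :
    IsZero (ModuleCat.of R (PLift p → M)) := by
  rw [IsZero.iff_id_eq_zero, ← pieceIn_out, pieceIn_eq_zero h, zero_comp]

variable (P : CochainComplex (ModuleCat.{u} R) ℤ)

/-- The complex which coincides with `P` in the degrees satisfying the convex predicate `S`,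
and is zero in the other degrees. -/
def pieceComplex (S : ℤ → Prop) (hS : ∀ n, S n → S (n + 2) → S (n + 1)) :
    CochainComplex (ModuleCat.{u} R) ℤ where
  X n := ModuleCat.of R (PLift (S n) → P.X n)
  d i j := pieceIn _ _ ≫ P.d i j ≫ pieceOut _ _
  shape i j h := by rw [P.shape i j h, zero_comp, comp_zero]
  d_comp_d' i j k hij hjk := by
    obtain rfl : i + 1 = j := hij
    obtain rfl : i + 1 + 1 = k := hjk
    simp only [Category.assoc]
    by_cases hi : S i
    · by_cases hk : S (i + 1 + 1)
      -- By convexity the middle degree satisfies `S` once the two outer ones do.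
      · rw [pieceOut_in_assoc (hS i hi (by rwa [show i + 2 = i + 1 + 1 by ring])), P.d_comp_d_assoc,
          zero_comp, comp_zero]
      · rw [pieceOut_eq_zero hk]; simp
    · rw [pieceIn_eq_zero hi]; simp

lemma pieceComplex_isStrictlyGE (S : ℤ → Prop) (hS) (k : ℤ) (h : ∀ n, S n → k ≤ n) :
    (pieceComplex P S hS).IsStrictlyGE k := by
  rw [CochainComplex.isStrictlyGE_iff]
  intro i hi
  exact isZero_piece (fun hi' => by have := h i hi'; omega) _

lemma pieceComplex_isStrictlyLE (S : ℤ → Prop) (hS) (k : ℤ) (h : ∀ n, S n → n ≤ k) :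
    (pieceComplex P S hS).IsStrictlyLE k := by
  rw [CochainComplex.isStrictlyLE_iff]
  intro i hi
  exact isZero_piece (fun hi' => by have := h i hi'; omega) _

/-- The terms of `pieceComplex` are retracts. -/
def pieceRetract (S : ℤ → Prop) (hS) (n : ℤ) : Retract ((pieceComplex P S hS).X n) (P.X n) where
  i := pieceIn _ _
  r := pieceOut _ _
  retract := pieceIn_out _ _

/-- The terms of `pieceComplex` in the degrees satisfying the predicate. -/
def pieceXIso (S : ℤ → Prop) (hS) (n : ℤ) (h : S n) : (pieceComplex P S hS).X n ≅ P.X n where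
  hom := pieceIn _ _
  inv := pieceOut _ _
  hom_inv_id := pieceIn_out _ _
  inv_hom_id := pieceOut_in h _

/-- The stupid truncation in degrees `≥ k`. -/
def stupidGE (k : ℤ) : CochainComplex (ModuleCat.{u} R) ℤ :=
  pieceComplex P (fun n => k ≤ n) (fun n _ _ => by omega)

/-- The stupid truncation in degrees `< k`. -/
def stupidLT (k : ℤ) : CochainComplex (ModuleCat.{u} R) ℤ :=
  pieceComplex P (fun n => n < k) (fun n _ _ => by omega)

instance (k : ℤ) : (stupidGE P k).IsStrictlyGE k :=
  pieceComplex_isStrictlyGE _ _ _ _ fun _ h => h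

lemma stupidLT_isStrictlyLE (k l : ℤ) (h : k ≤ l + 1) : (stupidLT P k).IsStrictlyLE l :=
  pieceComplex_isStrictlyLE _ _ _ _ fun _ h' => by omega

lemma isZero_of_retract {C : Type*} [Category* C] [HasZeroMorphisms C] {X Y : C} (r : Retract X Y)
    (h : IsZero Y) : IsZero X := by
  rw [IsZero.iff_id_eq_zero, ← r.retract, h.eq_of_tgt r.i 0, zero_comp]

lemma pieceComplex_isStrictlyGE' (S : ℤ → Prop) (hS) (k : ℤ) [P.IsStrictlyGE k] :
    (pieceComplex P S hS).IsStrictlyGE k := by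
  rw [CochainComplex.isStrictlyGE_iff]
  intro i hi
  exact isZero_of_retract (pieceRetract P S hS i) (P.isZero_of_isStrictlyGE k i hi)

lemma pieceComplex_isStrictlyLE' (S : ℤ → Prop) (hS) (k : ℤ) [P.IsStrictlyLE k] :
    (pieceComplex P S hS).IsStrictlyLE k := by
  rw [CochainComplex.isStrictlyLE_iff]
  intro i hi
  exact isZero_of_retract (pieceRetract P S hS i) (P.isZero_of_isStrictlyLE k i hi)

lemma pieceComplex_projective (S : ℤ → Prop) (hS) [∀ n, Projective (P.X n)] (n : ℤ) :
    Projective ((pieceComplex P S hS).X n) :=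
  (pieceRetract P S hS n).projective

/-- The inclusion of the stupid truncation. -/
def stupidι (k : ℤ) : stupidGE P k ⟶ P where
  f n := pieceIn _ _
  comm' i j hij := by
    obtain rfl : i + 1 = j := hij
    change _ = (pieceIn _ _ ≫ P.d _ _ ≫ pieceOut _ _) ≫ pieceIn _ _
    by_cases h : k ≤ i
    · rw [Category.assoc, Category.assoc, pieceOut_in (by omega), Category.comp_id]
      rfl
    · rw [pieceIn_eq_zero h, zero_comp, zero_comp]
      exact zero_comp

/-- The projection onto the stupid truncation. -/
def stupidπ (k : ℤ) : P ⟶ stupidLT P k where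
  f n := pieceOut _ _
  comm' i j hij := by
    obtain rfl : i + 1 = j := hij
    change pieceOut _ _ ≫ (pieceIn _ _ ≫ P.d _ _ ≫ pieceOut _ _) = _
    by_cases h : i + 1 < k
    · rw [pieceOut_in_assoc (by omega)]
      rfl
    · rw [pieceOut_eq_zero h, comp_zero, comp_zero, comp_zero]
      exact comp_zero.symm

/-- The degreewise split sequence of stupid truncations. -/
def stupidShortComplex (k : ℤ) : ShortComplex (CochainComplex (ModuleCat.{u} R) ℤ) :=
  ShortComplex.mk (stupidι P k) (stupidπ P k) (by
    ext n : 1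
    change pieceIn _ _ ≫ pieceOut _ _ = 0
    by_cases h : n < k
    · rw [pieceIn_eq_zero (by omega), zero_comp]
    · rw [pieceOut_eq_zero h, comp_zero])

/-- The degreewise splitting of `stupidShortComplex`. -/
def stupidSplitting (k n : ℤ) :
    ((stupidShortComplex P k).map (HomologicalComplex.eval _ _ n)).Splitting where
  r := pieceOut _ _
  s := pieceIn _ _
  f_r := pieceIn_out _ _
  s_g := pieceIn_out _ _
  id := by
    change pieceOut _ _ ≫ pieceIn _ _ + pieceOut _ _ ≫ pieceIn _ _ = 𝟙 _
    by_cases h : n < k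
    · rw [pieceOut_in h, pieceIn_eq_zero (by omega), comp_zero, zero_add]
    · rw [pieceOut_in (by omega), pieceIn_eq_zero h, comp_zero, add_zero]

/-- The triangle of stupid truncations. -/
def stupidTriangle (k : ℤ) : Pretriangulated.Triangle (HomotopyCategory (ModuleCat.{u} R)
    (ComplexShape.up ℤ)) :=
  CochainComplex.trianglehOfDegreewiseSplit (stupidShortComplex P k) (stupidSplitting P k)

lemma stupidTriangle_distinguished (k : ℤ) :
    stupidTriangle P k ∈ Pretriangulated.distinguishedTriangles := by
  rw [HomotopyCategory.distinguished_iff_iso_trianglehOfDegreewiseSplit]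
  exact ⟨_, _, ⟨Iso.refl _⟩⟩

end StupidTruncation

end PseudoDualizing

end

noncomputable section
namespace PseudoDualizing

open CochainComplex.HomComplex

/-! ### The ring as a test object: cohomology as maps in the homotopy category. -/

section UnitComplex

variable {R : Type u} [Ring R]

/-- The ring as a complex of modules concentrated in degree `0`. -/
def unitComplex (R : Type u) [Ring R] : CochainComplex (ModuleCat.{u} R) ℤ :=
  (CochainComplex.singleFunctor (ModuleCat.{u} R) 0).obj (ModuleCat.of R R)

/-- The ring as an object of the homotopy category. -/
def unitHo (R : Type u) [Ring R] : HoCat R := (toHo R).obj (unitComplex R)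

instance (M : ModuleCat.{u} R) (n i : ℤ) [Projective M] :
    Projective (((CochainComplex.singleFunctor (ModuleCat.{u} R) n).obj M).X i) := by
  by_cases h : i = n
  · subst h
    exact Projective.of_iso (HomologicalComplex.singleObjXSelf (ComplexShape.up ℤ) i M).symm
      inferInstance
  · exact Projective.of_iso (HomologicalComplex.isZero_single_obj_X (ComplexShape.up ℤ) n M i h
      |>.isoZero).symm inferInstance

instance (M : ModuleCat.{u} R) (n i : ℤ) [Injective M] :
    Injective (((CochainComplex.singleFunctor (ModuleCat.{u} R) n).obj M).X i) := by
  by_cases h : i = n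
  · subst h
    exact Injective.of_iso (HomologicalComplex.singleObjXSelf (ComplexShape.up ℤ) i M).symm
      inferInstance
  · exact Injective.of_iso (HomologicalComplex.isZero_single_obj_X (ComplexShape.up ℤ) n M i h
      |>.isoZero).symm inferInstance

instance (M : ModuleCat.{u} R) (n : ℤ) [Projective M] :
    ((CochainComplex.singleFunctor (ModuleCat.{u} R) n).obj M).IsKProjective :=
  CochainComplex.isKProjective_of_projective _ n

instance : Projective (ModuleCat.of R R) := (IsProjective.iff_projective (R := R) R).1 inferInstance

instance : (unitComplex R).IsKProjective := by
  unfold unitComplex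
  infer_instance

variable {Y Z : CochainComplex (ModuleCat.{u} R) ℤ} {n : ℤ}

/-- The linear map `R → M` given by an element. -/
def ofElement {M : ModuleCat.{u} R} (y : M) : ModuleCat.of R R ⟶ M :=
  ModuleCat.ofHom (LinearMap.toSpanSingleton R M y)

lemma ofElement_comp {M N : ModuleCat.{u} R} (y : M) (f : M ⟶ N) :
    ofElement y ≫ f = ofElement (f.hom y) := by
  ext
  simp [ofElement]

lemma ofElement_injective {M : ModuleCat.{u} R} {y y' : M} (h : ofElement y = ofElement y') :
    y = y' := by
  have := congrArg (fun f => f.hom (1 : R)) h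
  simpa [ofElement] using this

lemma ofElement_surjective {M : ModuleCat.{u} R} (f : ModuleCat.of R R ⟶ M) :
    ∃ y, ofElement y = f :=
  ⟨f.hom (1 : R), by ext; simp [ofElement]⟩

lemma ofElement_zero {M : ModuleCat.{u} R} : ofElement (0 : M) = 0 := by
  ext
  simp [ofElement]

lemma ofElement_sub {M : ModuleCat.{u} R} (y y' : M) :
    ofElement (y - y') = ofElement y - ofElement y' := by
  ext
  simp [ofElement]

/-- The cocycle attached to an element. -/
def elementCocycle (y : Y.X n) (hy : (Y.d n (n + 1)).hom y = 0) : Cocycle (unitComplex R) Y n :=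
  Cocycle.fromSingleMk (ofElement y) (zero_add n) (n + 1) rfl
    (by rw [ofElement_comp, hy, ofElement_zero])

/-- The morphism in the homotopy category attached to an element. -/
def cycleHom (y : Y.X n) (hy : (Y.d n (n + 1)).hom y = 0) : unitHo R ⟶ ((toHo R).obj Y)⟦n⟧ :=
  CohomologyClass.toHom (CohomologyClass.mk (elementCocycle y hy)) ≫
    ((toHo R).commShiftIso n).hom.app Y

/-- The ring is free of rank one in degree `0`, so cocycles out of it are cycles of `Y`. Together
with `cycleHom_eq_zero_iff` this identifies maps from the ring to `Y[n]` with the cohomology of `Y`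
in degree `n`. -/
lemma cycleHom_surjective (φ : unitHo R ⟶ ((toHo R).obj Y)⟦n⟧) :
    ∃ (y : Y.X n) (hy : (Y.d n (n + 1)).hom y = 0), cycleHom y hy = φ := by
  obtain ⟨x, hx⟩ := (CohomologyClass.toHom_bijective (unitComplex R) Y n).2
    (φ ≫ ((toHo R).commShiftIso n).inv.app Y)
  obtain ⟨x, rfl⟩ := x.mk_surjective
  obtain ⟨f, hf, rfl⟩ := Cocycle.fromSingleMk_surjective x n (zero_add n) (n + 1) rfl
  obtain ⟨y, rfl⟩ := ofElement_surjective f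
  have hf' := hf
  rw [ofElement_comp] at hf'
  refine ⟨y, ofElement_injective (hf'.trans ofElement_zero.symm), ?_⟩
  refine (congrArg (· ≫ ((toHo R).commShiftIso n).hom.app Y) hx).trans ?_
  exact (Category.assoc _ _ _).trans
    ((congrArg (φ ≫ ·) (((toHo R).commShiftIso n).inv_hom_id_app Y)).trans (Category.comp_id φ))

lemma cycleHom_eq_zero_iff (y : Y.X n) (hy : (Y.d n (n + 1)).hom y = 0) (m : ℤ) (hm : m + 1 = n) :
    cycleHom y hy = 0 ↔ ∃ z : Y.X m, (Y.d m n).hom z = y := by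
  have h : cycleHom y hy = 0 ↔
      CohomologyClass.toHom (CohomologyClass.mk (elementCocycle y hy)) = 0 :=
    ⟨fun h => (cancel_mono (((toHo R).commShiftIso n).hom.app Y)).1 (h.trans zero_comp.symm),
      fun h => (congrArg (· ≫ ((toHo R).commShiftIso n).hom.app Y) h).trans zero_comp⟩
  refine h.trans ((CohomologyClass.toHom_mk_eq_zero_iff (elementCocycle y hy)).trans
    ((Cocycle.fromSingleMk_mem_coboundaries_iff (ofElement y) (zero_add n) (n + 1) rfl _ m
      hm).trans ?_))
  constructor
  · rintro ⟨g, hg⟩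
    obtain ⟨z, rfl⟩ := ofElement_surjective g
    exact ⟨z, ofElement_injective ((ofElement_comp _ _).symm.trans hg)⟩
  · rintro ⟨z, rfl⟩
    exact ⟨ofElement z, ofElement_comp _ _⟩

lemma cycleHom_sub (y y' : Y.X n) (hy : (Y.d n (n + 1)).hom y = 0)
    (hy' : (Y.d n (n + 1)).hom y' = 0) :
    cycleHom (y - y') (by rw [map_sub, hy, hy', sub_zero]) = cycleHom y hy - cycleHom y' hy' := by
  have : elementCocycle (y - y') (by rw [map_sub, hy, hy', sub_zero]) =
      elementCocycle y hy - elementCocycle y' hy' := by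
    ext : 1
    refine Eq.trans ?_ (Cochain.fromSingleMk_sub (ofElement y) (ofElement y') (zero_add n))
    exact congrArg (fun f => Cochain.fromSingleMk f (zero_add n)) (ofElement_sub y y')
  rw [cycleHom, this, CohomologyClass.mk_sub, map_sub]
  exact Preadditive.sub_comp _ _ _

lemma d_hom_comm {m : ℤ} (g : Y ⟶ Z) (y : Y.X n) :
    (Z.d n m).hom ((g.f n).hom y) = (g.f m).hom ((Y.d n m).hom y) :=
  congrArg (fun f => f.hom y) (g.comm n m)

lemma cycleHom_comp (y : Y.X n) (hy : (Y.d n (n + 1)).hom y = 0) (g : Y ⟶ Z) :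
    cycleHom y hy ≫ ((toHo R).map g)⟦n⟧' = cycleHom ((g.f n).hom y) (by
      rw [d_hom_comm, hy, map_zero]) := by
  refine (Category.assoc _ _ _).trans ?_
  refine (congrArg (_ ≫ ·) (((toHo R).commShiftIso n).hom.naturality g).symm).trans ?_
  refine (Category.assoc _ _ _).symm.trans ?_
  refine congrArg (· ≫ ((toHo R).commShiftIso n).hom.app Z) ?_
  rw [CohomologyClass.toHom_mk, CohomologyClass.toHom_mk]
  refine ((toHo R).map_comp (Cocycle.equivHomShift.symm (elementCocycle y hy))
    (g⟦n⟧')).symm.trans ?_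
  refine congrArg (toHo R).map ?_
  rw [← Cocycle.equivHomShift_symm_postcomp]
  refine congrArg Cocycle.equivHomShift.symm ?_
  ext : 1
  refine (Cochain.fromSingleMk_postcomp (ofElement y) (zero_add n) g).symm.trans ?_
  exact congrArg (fun f => Cochain.fromSingleMk f (zero_add n)) (ofElement_comp y (g.f n))

lemma acyclic_of_forall_unit_hom_eq_zero (X : HoCat R)
    (h : ∀ (n : ℤ) (φ : unitHo R ⟶ X⟦n⟧), φ = 0) :
    HomotopyCategory.subcategoryAcyclic (ModuleCat.{u} R) X := by
  obtain ⟨Y, rfl⟩ := HomotopyCategory.quotient_obj_surjective X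
  rw [HomotopyCategory.quotient_obj_mem_subcategoryAcyclic_iff_exactAt]
  intro n
  rw [HomologicalComplex.exactAt_iff' _ (n - 1) n (n + 1) (by simp) (by simp),
    ShortComplex.moduleCat_exact_iff]
  intro y hy
  exact (cycleHom_eq_zero_iff y hy (n - 1) (by omega)).1 (h n _)

open Pretriangulated in
/-- A morphism in the homotopy category is a quasi-isomorphism if it induces bijections on
the morphisms from the shifts of the ring. -/
lemma isIso_Qh_map_of_bijective {X X' : HoCat R} (f : X ⟶ X')
    (h : ∀ n : ℤ, Function.Bijective fun φ : unitHo R ⟶ X⟦n⟧ => φ ≫ f⟦n⟧') :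
    IsIso (DerivedCategory.Qh.map f) := by
  obtain ⟨C, g, k, hT⟩ := distinguished_cocone_triangle f
  -- It suffices that the cone is acyclic. A map from the ring to `C[n]` has zero image in `X[n][1]`
  -- by injectivity in degree `n + 1`, so it comes from `X'[n]`. By surjectivity in degree `n` it
  -- then comes from `X[n]`, and consecutive maps of the triangle compose to zero.
  have hC : HomotopyCategory.subcategoryAcyclic (ModuleCat.{u} R) C := by
    apply acyclic_of_forall_unit_hom_eq_zero
    intro n φ
    -- Shifting the triangle introduces signs `(-1)^n`, which are cancelled as units below.
    have h1 : (n.negOnePow • f⟦n⟧') ≫ (n.negOnePow • g⟦n⟧') = 0 :=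
      comp_distTriang_mor_zero₁₂ _ (Triangle.shift_distinguished _ hT n)
    have h3 : ((Triangle.shiftFunctor _ n).obj (Triangle.mk f g k)).mor₃ ≫
        (n.negOnePow • f⟦n⟧')⟦(1 : ℤ)⟧' = 0 :=
      comp_distTriang_mor_zero₃₁ _ (Triangle.shift_distinguished _ hT n)
    have h0 : φ ≫ ((Triangle.shiftFunctor _ n).obj (Triangle.mk f g k)).mor₃ = 0 := by
      have key : ∀ ψ : unitHo R ⟶ X⟦n⟧⟦(1 : ℤ)⟧, ψ ≫ (n.negOnePow • f⟦n⟧')⟦(1 : ℤ)⟧' = 0 →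
          ψ = 0 := by
        intro ψ hψ
        rw [Functor.map_units_smul, Linear.comp_units_smul, smul_eq_zero_iff_eq] at hψ
        have := (h (n + 1)).1 (a₁ := ψ ≫ (shiftFunctorAdd (HoCat R) n 1).inv.app X) (a₂ := 0) (by
          dsimp only
          rw [zero_comp, Category.assoc, ← (shiftFunctorAdd (HoCat R) n 1).inv.naturality f]
          exact (Category.assoc _ _ _).symm.trans
            ((congrArg (· ≫ (shiftFunctorAdd (HoCat R) n 1).inv.app X') hψ).trans zero_comp))
        rw [← cancel_mono ((shiftFunctorAdd (HoCat R) n 1).inv.app X), zero_comp]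
        exact this
      refine key _ ((Category.assoc _ _ _).trans ?_)
      exact (congrArg (φ ≫ ·) h3).trans comp_zero
    obtain ⟨ψ, hψ⟩ := Triangle.coyoneda_exact₃ _ (Triangle.shift_distinguished _ hT n) φ h0
    obtain ⟨χ, hχ⟩ := (h n).2 ψ
    refine hψ.trans ?_
    rw [Linear.units_smul_comp, Linear.comp_units_smul, smul_eq_zero_iff_eq,
      smul_eq_zero_iff_eq] at h1
    have h2 : ψ ≫ g⟦n⟧' = 0 := by
      refine (congrArg (· ≫ g⟦n⟧') hχ).symm.trans ((Category.assoc _ _ _).trans ?_)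
      exact (congrArg (χ ≫ ·) h1).trans comp_zero
    have h4 : n.negOnePow • (ψ ≫ g⟦n⟧') = 0 := by rw [h2, smul_zero]
    exact (Linear.comp_units_smul _ _ _).trans h4
  have hf : HomotopyCategory.quasiIso (ModuleCat.{u} R) _ f := by
    rw [HomotopyCategory.quasiIso_eq_trW_subcategoryAcyclic]
    exact ⟨_, _, _, hT, hC⟩
  exact Localization.inverts DerivedCategory.Qh _ f hf

/-- Maps out of a K-projective complex are the same in the homotopy category and in the derived
category, where `f` is invertible. -/
lemma bijective_of_isIso_Qh_map {X X' : HoCat R} (f : X ⟶ X') [IsIso (DerivedCategory.Qh.map f)]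
    {K : CochainComplex (ModuleCat.{u} R) ℤ} [K.IsKProjective] :
    Function.Bijective fun φ : (toHo R).obj K ⟶ X => φ ≫ f := by
  have h₁ := CochainComplex.IsKProjective.Qh_map_bijective K X
  have h₂ := CochainComplex.IsKProjective.Qh_map_bijective K X'
  rw [← h₂.of_comp_iff']
  have : (DerivedCategory.Qh.map ∘ fun φ : (toHo R).obj K ⟶ X => φ ≫ f) =
      (fun φ => φ ≫ DerivedCategory.Qh.map f) ∘ DerivedCategory.Qh.map := by
    ext φ
    simp
  rw [this]
  refine Function.Bijective.comp ⟨fun a b hab => ?_, fun b => ?_⟩ h₁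
  · exact (cancel_mono _).1 hab
  · exact ⟨b ≫ inv (DerivedCategory.Qh.map f), by simp⟩

lemma bijective_of_isIso_Qh_map' {X X' : HoCat R} (f : X ⟶ X')
    [IsIso (DerivedCategory.Qh.map f)]
    {K : CochainComplex (ModuleCat.{u} R) ℤ} [K.IsKInjective] :
    Function.Bijective fun φ : X' ⟶ (toHo R).obj K => f ≫ φ := by
  have h₁ := CochainComplex.IsKInjective.Qh_map_bijective X K
  have h₂ := CochainComplex.IsKInjective.Qh_map_bijective X' K
  rw [← h₁.of_comp_iff']
  have : (DerivedCategory.Qh.map ∘ fun φ : X' ⟶ (toHo R).obj K => f ≫ φ) =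
      (fun φ => DerivedCategory.Qh.map f ≫ φ) ∘ DerivedCategory.Qh.map := by
    ext φ
    simp
  rw [this]
  refine Function.Bijective.comp ⟨fun a b hab => ?_, fun b => ?_⟩ h₂
  · exact (cancel_epi _).1 hab
  · exact ⟨inv (DerivedCategory.Qh.map f) ≫ b, by simp⟩

end UnitComplex

/-! ### Direct sums of complexes and maps into them from finitely generated terms. -/

section SumComplex

variable {R : Type u} [Ring R] {I : Type u} (Z : I → CochainComplex (ModuleCat.{u} R) ℤ)

/-- The direct sum of a family of complexes. -/
def sumComplex : CochainComplex (ModuleCat.{u} R) ℤ where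
  X n := ModuleCat.of R (DirectSum I fun i => (Z i).X n)
  d m n := ModuleCat.ofHom (DirectSum.lmap fun i => ((Z i).d m n).hom)
  shape m n h := by
    refine ModuleCat.hom_ext (LinearMap.ext fun x => DFinsupp.ext fun i => ?_)
    refine (DirectSum.lmap_apply _ _ _).trans ?_
    rw [(Z i).shape m n h]
    rfl
  d_comp_d' i j k _ _ := by
    refine ModuleCat.hom_ext (LinearMap.ext fun x => DFinsupp.ext fun l => ?_)
    refine (DirectSum.lmap_apply _ _ _).trans ((congrArg _ (DirectSum.lmap_apply _ _ _)).trans ?_)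
    exact congrArg (fun f => f.hom (x l)) ((Z l).d_comp_d i j k)

/-- The projections from a direct sum of complexes. -/
def sumπ (i : I) : sumComplex Z ⟶ Z i where
  f n := ModuleCat.ofHom (DirectSum.component R I (fun i => (Z i).X n) i)
  comm' m n _ := by
    refine ModuleCat.hom_ext (LinearMap.ext fun x => ?_)
    exact (DirectSum.lmap_apply (fun i => ((Z i).d m n).hom) x i).symm

open Classical in
/-- The inclusions in a direct sum of complexes. -/
def sumι (i : I) : Z i ⟶ sumComplex Z where
  f n := ModuleCat.ofHom (DirectSum.lof R I (fun i => (Z i).X n) i)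
  comm' m n _ := by
    refine ModuleCat.hom_ext (LinearMap.ext fun x => ?_)
    exact DirectSum.lmap_lof (fun i => ((Z i).d m n).hom) i x

open Classical in
/-- The map from a direct sum of complexes given by a family of maps. -/
def sumDesc {Y : CochainComplex (ModuleCat.{u} R) ℤ} (f : ∀ i, Z i ⟶ Y) : sumComplex Z ⟶ Y where
  f n := ModuleCat.ofHom (DirectSum.toModule R I (Y.X n) fun i => ((f i).f n).hom)
  comm' m n _ := by
    refine ModuleCat.hom_ext (DirectSum.linearMap_ext _ fun i => LinearMap.ext fun x => ?_)
    change (Y.d m n).hom (DirectSum.toModule R I (Y.X m) (fun i => ((f i).f m).hom)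
      (DirectSum.lof R I (fun i => (Z i).X m) i x)) =
      DirectSum.toModule R I (Y.X n) (fun i => ((f i).f n).hom)
        (DirectSum.lmap (fun i => ((Z i).d m n).hom) (DirectSum.lof R I (fun i => (Z i).X m) i x))
    rw [DirectSum.toModule_lof, DirectSum.lmap_lof, DirectSum.toModule_lof]
    exact congrArg (fun g => g.hom x) ((f i).comm m n)

variable {Z}

open Classical in
lemma sum_hom_ext {Y : CochainComplex (ModuleCat.{u} R) ℤ} {f g : sumComplex Z ⟶ Y}
    (h : ∀ i, sumι Z i ≫ f = sumι Z i ≫ g) : f = g := by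
  ext n : 1
  refine ModuleCat.hom_ext (DirectSum.linearMap_ext _ fun i => LinearMap.ext fun x => ?_)
  exact congrArg (fun φ => (φ.f n).hom x) (h i)

open Classical in
lemma sumι_desc {Y : CochainComplex (ModuleCat.{u} R) ℤ} (f : ∀ i, Z i ⟶ Y) (i : I) :
    sumι Z i ≫ sumDesc Z f = f i := by
  ext n x
  exact DirectSum.toModule_lof (M := fun i => (Z i).X n) (φ := fun i => ((f i).f n).hom) R i x

open Classical in
lemma sumι_π_self (i : I) : sumι Z i ≫ sumπ Z i = 𝟙 _ := by
  ext n x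
  exact DirectSum.component.lof_self (M := fun i => (Z i).X n) R i x

open Classical in
lemma sumι_π_ne {i j : I} (h : i ≠ j) : sumι Z i ≫ sumπ Z j = 0 := by
  ext n x
  exact (DirectSum.component.of (M := fun i => (Z i).X n) R j i x).trans (dif_neg h)

lemma to_sum_ext {M : ModuleCat.{u} R} {n : ℤ} {f g : M ⟶ (sumComplex Z).X n}
    (h : ∀ i, f ≫ (sumπ Z i).f n = g ≫ (sumπ Z i).f n) : f = g := by
  refine ModuleCat.hom_ext (LinearMap.ext fun x => DFinsupp.ext fun i => ?_)
  exact congrArg (fun φ => φ.hom x) (h i)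

/-- Each of finitely many generators has an image with finite support, and the union of these
supports works. -/
lemma exists_finset_of_finite {M : ModuleCat.{u} R} [Module.Finite R M] {n : ℤ}
    (f : M ⟶ (sumComplex Z).X n) : ∃ s : Finset I, ∀ i ∉ s, f ≫ (sumπ Z i).f n = 0 := by
  classical
  obtain ⟨G, hG⟩ := Module.Finite.fg_top (R := R) (M := M)
  refine ⟨G.biUnion fun x => DFinsupp.support (f.hom x : DirectSum I fun i => (Z i).X n),
    fun i hi => ?_⟩
  have : (⊤ : Submodule R M) ≤ LinearMap.ker (f ≫ (sumπ Z i).f n).hom := by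
    rw [← hG, Submodule.span_le]
    intro x hx
    by_contra h
    refine hi (Finset.mem_biUnion.2 ⟨x, hx, DFinsupp.mem_support_iff.2 h⟩)
  exact ModuleCat.hom_ext (LinearMap.ext fun x => this (Submodule.mem_top))

/-- In each degree finite generation leaves finitely many summands. The finite set `T` contains all
the degrees where a nonzero component is possible, so one finite set of indices suffices for the
whole map. -/
lemma sum_decomposition {K : CochainComplex (ModuleCat.{u} R) ℤ} {n : ℤ}
    [∀ m, Module.Finite R (K.X m)] (T : Finset ℤ)
    (hT : ∀ m ∉ T, IsZero (K.X m) ∨ ∀ i, IsZero ((Z i).X (m + n)))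
    (φ : K ⟶ (sumComplex Z)⟦n⟧) :
    ∃ s : Finset I, φ = ∑ i ∈ s, φ ≫ (sumπ Z i)⟦n⟧' ≫ (sumι Z i)⟦n⟧' := by
  classical
  have hs : ∀ m, ∃ s : Finset I, (m ∉ T → s = ∅) ∧
      ∀ i ∉ s, φ.f m ≫ (sumπ Z i).f (m + n) = 0 := by
    intro m
    by_cases hm : m ∈ T
    · obtain ⟨s, hs⟩ := exists_finset_of_finite (φ.f m)
      exact ⟨s, fun h => (h hm).elim, hs⟩
    · refine ⟨∅, fun _ => rfl, fun i _ => ?_⟩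
      obtain h | h := hT m hm
      · exact h.eq_of_src _ _
      · exact (h i).eq_of_tgt _ _
  choose s hs₁ hs₂ using hs
  have hs₃ : ∀ i ∉ T.biUnion s, φ ≫ (sumπ Z i)⟦n⟧' = 0 := by
    intro i hi
    ext m : 1
    refine hs₂ m i fun hi' => ?_
    by_cases hm : m ∈ T
    · exact hi (Finset.mem_biUnion.2 ⟨m, hm, hi'⟩)
    · rw [hs₁ m hm] at hi'
      simp at hi'
  refine ⟨T.biUnion s, ?_⟩
  have key : ∀ {f g : K ⟶ (sumComplex Z)⟦n⟧},
      (∀ i, f ≫ (sumπ Z i)⟦n⟧' = g ≫ (sumπ Z i)⟦n⟧') → f = g := by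
    intro f g h
    ext m : 1
    exact to_sum_ext fun i => congrArg (fun ψ => ψ.f m) (h i)
  refine key fun j => ?_
  rw [Preadditive.sum_comp]
  have h1 : ∀ i, (φ ≫ (sumπ Z i)⟦n⟧' ≫ (sumι Z i)⟦n⟧') ≫ (sumπ Z j)⟦n⟧' =
      φ ≫ (sumπ Z i)⟦n⟧' ≫ (sumι Z i ≫ sumπ Z j)⟦n⟧' := by
    intro i
    rw [Functor.map_comp, Category.assoc, Category.assoc]
  simp only [h1]
  by_cases hj : j ∈ T.biUnion s
  · rw [Finset.sum_eq_single_of_mem j hj, sumι_π_self, CategoryTheory.Functor.map_id,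
      Category.comp_id]
    intro i _ hij
    rw [sumι_π_ne hij, Functor.map_zero, comp_zero, comp_zero]
  · rw [hs₃ j hj, Finset.sum_eq_zero]
    intro i hi
    rw [sumι_π_ne (by rintro rfl; exact hj hi), Functor.map_zero, comp_zero, comp_zero]

variable (Z) in
/-- The inclusions in a direct sum, in the homotopy category. -/
def sumιHo (i : I) : (toHo R).obj (Z i) ⟶ (toHo R).obj (sumComplex Z) := (toHo R).map (sumι Z i)

variable (Z) in
/-- The projections from a direct sum, in the homotopy category. -/
def sumπHo (i : I) : (toHo R).obj (sumComplex Z) ⟶ (toHo R).obj (Z i) := (toHo R).map (sumπ Z i)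

lemma sum_decomposition_ho {K : CochainComplex (ModuleCat.{u} R) ℤ} {n : ℤ}
    [∀ m, Module.Finite R (K.X m)] (T : Finset ℤ)
    (hT : ∀ m ∉ T, IsZero (K.X m) ∨ ∀ i, IsZero ((Z i).X (m + n)))
    (φ : (toHo R).obj K ⟶ ((toHo R).obj (sumComplex Z))⟦n⟧) :
    ∃ s : Finset I, φ = ∑ i ∈ s, φ ≫ (sumπHo Z i)⟦n⟧' ≫ (sumιHo Z i)⟦n⟧' := by
  obtain ⟨ψ, hψ⟩ := (toHo R).map_surjective (φ ≫ ((toHo R).commShiftIso n).inv.app (sumComplex Z))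
  obtain ⟨s, hs⟩ := sum_decomposition T hT ψ
  refine ⟨s, ?_⟩
  have e : φ = (toHo R).map ψ ≫ ((toHo R).commShiftIso n).hom.app (sumComplex Z) := by
    rw [hψ, Category.assoc, Iso.inv_hom_id_app]
    exact (Category.comp_id φ).symm
  have e' : ∀ i, φ ≫ (sumπHo Z i)⟦n⟧' ≫ (sumιHo Z i)⟦n⟧' =
      (toHo R).map (ψ ≫ (sumπ Z i)⟦n⟧' ≫ (sumι Z i)⟦n⟧') ≫
        ((toHo R).commShiftIso n).hom.app (sumComplex Z) := by
    intro i
    rw [e, Functor.map_comp, Functor.map_comp, Category.assoc, Category.assoc, Category.assoc]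
    refine congrArg ((toHo R).map ψ ≫ ·) ?_
    refine Eq.trans ?_ (congrArg ((toHo R).map ((sumπ Z i)⟦n⟧') ≫ ·)
      (((toHo R).commShiftIso n).hom.naturality (sumι Z i)).symm)
    refine (Category.assoc _ _ _).symm.trans ((congrArg (· ≫ (sumιHo Z i)⟦n⟧')
      (((toHo R).commShiftIso n).hom.naturality (sumπ Z i)).symm).trans (Category.assoc _ _ _))
  simp only [e']
  rw [← Preadditive.sum_comp, ← Functor.map_sum, ← hs]
  exact e

end SumComplex

end PseudoDualizing

end

noncomputable section
namespace PseudoDualizing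

/-! ### Transfer of maps `W ⟶ X[n]` to maps `a ⟶ Y[n]`, and its behaviour under products and sums.
-/

section Transfer

universe v₁ v₂ w₁ w₂

variable {C : Type w₁} {D : Type w₂} [Category.{v₁} C] [Category.{v₂} D] [HasShift C ℤ]
  [HasShift D ℤ] (F : C ⥤ D) [F.CommShift ℤ] {W : C} {a : D} (w : a ⟶ F.obj W)

/-- The map `Hom(W, X⟦n⟧) → Hom(a, Y⟦n⟧)` attached to `w : a ⟶ F W` and `f : F X ⟶ Y`. -/
def transfer {X : C} {Y : D} (f : F.obj X ⟶ Y) (n : ℤ) (x : W ⟶ X⟦n⟧) : a ⟶ Y⟦n⟧ :=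
  (yonedaMap F w (X⟦n⟧) x ≫ (F.commShiftIso n).hom.app X) ≫ f⟦n⟧'

lemma transfer_comp {X : C} {Y Y' : D} (f : F.obj X ⟶ Y) (g : Y ⟶ Y') (n : ℤ) (x : W ⟶ X⟦n⟧) :
    transfer F w f n x ≫ g⟦n⟧' = transfer F w (f ≫ g) n x := by
  simp [transfer]

lemma transfer_map {X X' : C} {Y : D} (g : X ⟶ X') (f : F.obj X' ⟶ Y) (n : ℤ) (x : W ⟶ X⟦n⟧) :
    transfer F w f n (x ≫ g⟦n⟧') = transfer F w (F.map g ≫ f) n x := by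
  simp [transfer, yonedaMap]

lemma transfer_id {X : C} {Y : D} (f : F.obj X ⟶ Y) (n : ℤ) (x : W ⟶ X⟦n⟧) :
    transfer F w f n x = transfer F w (𝟙 (F.obj X)) n x ≫ f⟦n⟧' := by
  simp [transfer]

lemma transfer_sum [Preadditive C] [Preadditive D] [F.Additive]
    [∀ n : ℤ, (shiftFunctor D n).Additive] {X : C} {Y : D} (f : F.obj X ⟶ Y) (n : ℤ) {ι : Type*}
    (s : Finset ι) (x : ι → (W ⟶ X⟦n⟧)) :
    transfer F w f n (∑ i ∈ s, x i) = ∑ i ∈ s, transfer F w f n (x i) := by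
  simp [transfer, yonedaMap, Functor.map_sum, Preadditive.sum_comp, Preadditive.comp_sum]

lemma bijective_transfer_id_iff {X : C} (n : ℤ) :
    Function.Bijective (transfer F w (𝟙 (F.obj X)) n) ↔
      Function.Bijective (yonedaMap F w (X⟦n⟧)) := by
  have : transfer F w (𝟙 (F.obj X)) n =
      (((F.commShiftIso n).app X).homToEquiv (Z := a)) ∘ yonedaMap F w (X⟦n⟧) := by
    ext x
    simp [transfer, Iso.homToEquiv]
  rw [this]
  exact Equiv.comp_bijective _ _

lemma bijective_transfer_iff {X : C} {Y : D} (f : F.obj X ⟶ Y) (n : ℤ)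
    (hf : Function.Bijective fun φ : a ⟶ (F.obj X)⟦n⟧ => φ ≫ f⟦n⟧') :
    Function.Bijective (transfer F w f n) ↔ Function.Bijective (yonedaMap F w (X⟦n⟧)) := by
  have : transfer F w f n = (fun φ => φ ≫ f⟦n⟧') ∘ transfer F w (𝟙 (F.obj X)) n :=
    funext fun x => transfer_id F w f n x
  rw [this, ← bijective_transfer_id_iff, Function.Bijective.of_comp_iff' hf]

/-- Two out of three. With `a` a ring this will show that `f` is bijective on cohomology by looking
only at maps out of `W`. -/
lemma bijective_comp_of_transfer {X : C} {Y : D} (f : F.obj X ⟶ Y) (n : ℤ)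
    (h : Function.Bijective (yonedaMap F w (X⟦n⟧)))
    (hf : Function.Bijective (transfer F w f n)) :
    Function.Bijective fun φ : a ⟶ (F.obj X)⟦n⟧ => φ ≫ f⟦n⟧' := by
  have : transfer F w f n = (fun φ => φ ≫ f⟦n⟧') ∘ transfer F w (𝟙 (F.obj X)) n :=
    funext fun x => transfer_id F w f n x
  rw [this] at hf
  exact (Function.Bijective.of_comp_iff _ ((bijective_transfer_id_iff F w n).2 h)).1 hf

lemma bijective_transfer_map_iff {X X' : C} {Y : D} (g : X ⟶ X') (f : F.obj X' ⟶ Y) (n : ℤ)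
    (hg : Function.Bijective fun φ : W ⟶ X⟦n⟧ => φ ≫ g⟦n⟧') :
    Function.Bijective (transfer F w (F.map g ≫ f) n) ↔
      Function.Bijective (transfer F w f n) := by
  have : transfer F w (F.map g ≫ f) n = transfer F w f n ∘ fun φ : W ⟶ X⟦n⟧ => φ ≫ g⟦n⟧' :=
    funext fun x => (transfer_map F w g f n x).symm
  rw [this, Function.Bijective.of_comp_iff _ hg]

/-- If maps out of `W` and out of `a` both commute with the product, the transfer is the product of
the transfers of the factors. -/
lemma bijective_transfer_of_prod {I : Type*} {P : C} {J : D} {Z : I → C} {Y : I → D}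
    (p : ∀ i, P ⟶ Z i) (q : ∀ i, J ⟶ Y i) (g : F.obj P ⟶ J) (f : ∀ i, F.obj (Z i) ⟶ Y i) (n : ℤ)
    (hp : Function.Bijective fun (x : W ⟶ P⟦n⟧) i => x ≫ (p i)⟦n⟧')
    (hq : Function.Bijective fun (y : a ⟶ J⟦n⟧) i => y ≫ (q i)⟦n⟧')
    (hg : ∀ i, g ≫ q i = F.map (p i) ≫ f i)
    (hf : ∀ i, Function.Bijective (transfer F w (f i) n)) :
    Function.Bijective (transfer F w g n) := by
  rw [← hq.of_comp_iff']
  have : (fun (y : a ⟶ J⟦n⟧) i => y ≫ (q i)⟦n⟧') ∘ transfer F w g n =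
      (fun (x : ∀ i, W ⟶ (Z i)⟦n⟧) i => transfer F w (f i) n (x i)) ∘
        fun (x : W ⟶ P⟦n⟧) i => x ≫ (p i)⟦n⟧' := by
    ext x i
    simp only [Function.comp_apply, transfer_comp, transfer_map, hg]
  rw [this]
  exact (Function.Bijective.piMap hf).comp hp

/-- Every map on either side is the finite sum of its components, so bijectivity can be checked on
components. Only these decompositions are used, not a universal property of `P` or `J`. -/
lemma bijective_transfer_of_sum [Preadditive C] [Preadditive D] [F.Additive]
    [∀ n : ℤ, (shiftFunctor C n).Additive] [∀ n : ℤ, (shiftFunctor D n).Additive]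
    {I : Type*} {P : C} {J : D} {Z : I → C} {Y : I → D}
    (π : ∀ i, P ⟶ Z i) (ι : ∀ i, Z i ⟶ P) (π' : ∀ i, J ⟶ Y i) (ι' : ∀ i, Y i ⟶ J)
    (g : F.obj P ⟶ J) (f : ∀ i, F.obj (Z i) ⟶ Y i) (n : ℤ)
    (hP : ∀ x : W ⟶ P⟦n⟧, ∃ s : Finset I, x = ∑ i ∈ s, x ≫ (π i)⟦n⟧' ≫ (ι i)⟦n⟧')
    (hJ : ∀ y : a ⟶ J⟦n⟧, ∃ s : Finset I, y = ∑ i ∈ s, y ≫ (π' i)⟦n⟧' ≫ (ι' i)⟦n⟧')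
    (hι : ∀ i, F.map (ι i) ≫ g = f i ≫ ι' i) (hπ : ∀ i, g ≫ π' i = F.map (π i) ≫ f i)
    (hf : ∀ i, Function.Bijective (transfer F w (f i) n)) :
    Function.Bijective (transfer F w g n) := by
  constructor
  · intro x x' hx
    have h : ∀ i, x ≫ (π i)⟦n⟧' = x' ≫ (π i)⟦n⟧' := fun i => (hf i).1 (by
      rw [transfer_map, transfer_map, ← hπ, ← transfer_comp, ← transfer_comp, hx])
    have h' : ∀ i, (x - x') ≫ (π i)⟦n⟧' = 0 := fun i => by
      rw [Preadditive.sub_comp, h, sub_self]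
    obtain ⟨s, hs⟩ := hP (x - x')
    rw [← sub_eq_zero, hs]
    refine Finset.sum_eq_zero fun i _ => ?_
    rw [← Category.assoc, h', zero_comp]
  · intro y
    obtain ⟨s, hs⟩ := hJ y
    choose x hx using fun i => (hf i).2 (y ≫ (π' i)⟦n⟧')
    refine ⟨∑ i ∈ s, x i ≫ (ι i)⟦n⟧', ?_⟩
    rw [transfer_sum]
    refine Eq.trans ?_ hs.symm
    refine Finset.sum_congr rfl fun i _ => ?_
    rw [transfer_map, hι, ← transfer_comp, hx, Category.assoc]

end Transfer

/-! ### Products of complexes and of maps between them. -/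

section ProdComplex

open CochainComplex.HomComplex

variable {R : Type u} [Ring R] {I : Type u} (Z : I → CochainComplex (ModuleCat.{u} R) ℤ)

/-- The product of a family of complexes. -/
def prodComplex : CochainComplex (ModuleCat.{u} R) ℤ where
  X n := ModuleCat.of R (∀ i, (Z i).X n)
  d m n := ModuleCat.ofHom (LinearMap.pi fun i => ((Z i).d m n).hom ∘ₗ LinearMap.proj i)
  shape m n h := by
    refine ModuleCat.hom_ext (LinearMap.ext fun x => funext fun i => ?_)
    exact congrArg (fun f => f.hom (x i)) ((Z i).shape m n h)
  d_comp_d' i j k _ _ := by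
    refine ModuleCat.hom_ext (LinearMap.ext fun x => funext fun l => ?_)
    exact congrArg (fun f => f.hom (x l)) ((Z l).d_comp_d i j k)

/-- The projections from a product of complexes. -/
def prodπ (i : I) : prodComplex Z ⟶ Z i where
  f _ := ModuleCat.ofHom (LinearMap.proj i)
  comm' _ _ _ := rfl

variable {Z} in
/-- The map to a product of complexes given by a family of maps. -/
def prodLift {K : CochainComplex (ModuleCat.{u} R) ℤ} (f : ∀ i, K ⟶ Z i) : K ⟶ prodComplex Z where
  f n := ModuleCat.ofHom (LinearMap.pi fun i => ((f i).f n).hom)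
  comm' m n _ := by
    refine ModuleCat.hom_ext (LinearMap.ext fun x => funext fun i => ?_)
    exact congrArg (fun g => g.hom x) ((f i).comm m n)

lemma prodLift_π {K : CochainComplex (ModuleCat.{u} R) ℤ} (f : ∀ i, K ⟶ Z i) (i : I) :
    prodLift f ≫ prodπ Z i = f i := rfl

variable {Z} in
/-- The map to a term of a product of complexes given by a family of maps. -/
def prodLiftX {M : ModuleCat.{u} R} {n : ℤ} (f : ∀ i, M ⟶ (Z i).X n) : M ⟶ (prodComplex Z).X n :=
  ModuleCat.ofHom (LinearMap.pi fun i => (f i).hom)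

variable {Z} in
lemma homotopic_zero_of_prodπ {K : CochainComplex (ModuleCat.{u} R) ℤ} (f : K ⟶ prodComplex Z)
    (h : ∀ i, Nonempty (Homotopy (f ≫ prodπ Z i) 0)) : Nonempty (Homotopy f 0) := by
  replace h := fun i => (h i).some
  refine ⟨
    { hom := fun m n => prodLiftX fun i => (h i).hom m n
      zero := fun m n hmn => ?_
      comm := fun n => ?_ }⟩
  · refine ModuleCat.hom_ext (LinearMap.ext fun x => funext fun i => ?_)
    exact congrArg (fun g => g.hom x) ((h i).zero m n hmn)
  · refine ModuleCat.hom_ext (LinearMap.ext fun x => funext fun i => ?_)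
    refine (congrArg (fun g => g.hom x) ((h i).comm n)).trans ?_
    rw [dNext_eq _ (show (ComplexShape.up ℤ).Rel n (n + 1) by simp),
      prevD_eq _ (show (ComplexShape.up ℤ).Rel (n - 1) n by simp),
      dNext_eq _ (show (ComplexShape.up ℤ).Rel n (n + 1) by simp),
      prevD_eq _ (show (ComplexShape.up ℤ).Rel (n - 1) n by simp)]
    rfl

/-- The projections from a product, in the homotopy category. -/
def prodπHo (i : I) : (toHo R).obj (prodComplex Z) ⟶ (toHo R).obj (Z i) := (toHo R).map (prodπ Z i)

/-- Maps and null-homotopies into a product are assembled from their components, so the product of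
complexes is still a product in the homotopy category. -/
lemma prod_bijective_zero (K : HoCat R) :
    Function.Bijective fun (x : K ⟶ (toHo R).obj (prodComplex Z)) i => x ≫ prodπHo Z i := by
  obtain ⟨K, rfl⟩ := HomotopyCategory.quotient_obj_surjective K
  constructor
  · intro x x' hx
    obtain ⟨f, rfl⟩ := (toHo R).map_surjective x
    obtain ⟨f', rfl⟩ := (toHo R).map_surjective x'
    have : Nonempty (Homotopy (f - f') 0) := by
      refine homotopic_zero_of_prodπ _ fun i => ⟨?_⟩
      rw [Preadditive.sub_comp]
      refine Homotopy.equivSubZero (HomotopyCategory.homotopyOfEq _ _ ?_)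
      refine ((toHo R).map_comp _ _).trans (Eq.trans ?_ ((toHo R).map_comp _ _).symm)
      exact congrFun hx i
    obtain ⟨h⟩ := this
    exact HomotopyCategory.eq_of_homotopy _ _ (Homotopy.equivSubZero.symm h)
  · intro y
    choose f hf using fun i => (toHo R).map_surjective (y i)
    refine ⟨(toHo R).map (prodLift f), funext fun i => ?_⟩
    exact ((toHo R).map_comp _ _).symm.trans (hf i)

/-- The shift is moved to the source by adjunction, where the unshifted statement applies. -/
lemma prod_bijective (K : HoCat R) (n : ℤ) :
    Function.Bijective fun (x : K ⟶ ((toHo R).obj (prodComplex Z))⟦n⟧) i =>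
      x ≫ (prodπHo Z i)⟦n⟧' := by
  let adj := (shiftEquiv (HoCat R) n).symm.toAdjunction
  have : (fun (x : K ⟶ ((toHo R).obj (prodComplex Z))⟦n⟧) i => x ≫ (prodπHo Z i)⟦n⟧') =
      (fun (y : ∀ i, K⟦-n⟧ ⟶ (toHo R).obj (Z i)) i => adj.homEquiv K _ (y i)) ∘
        (fun (x : K⟦-n⟧ ⟶ (toHo R).obj (prodComplex Z)) i => x ≫ prodπHo Z i) ∘
          (adj.homEquiv K _).symm := by
    ext x i
    refine Eq.trans ?_ (adj.homEquiv_naturality_right _ _).symm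
    exact congrArg (· ≫ (prodπHo Z i)⟦n⟧') ((adj.homEquiv K _).apply_symm_apply x).symm
  rw [this]
  exact (Function.Bijective.piMap fun i => (adj.homEquiv K _).bijective).comp
    ((prod_bijective_zero Z _).comp (adj.homEquiv K _).symm.bijective)

/-- The product of a family of morphisms of complexes. -/
def prodMap {Z Z' : I → CochainComplex (ModuleCat.{u} R) ℤ} (f : ∀ i, Z i ⟶ Z' i) :
    prodComplex Z ⟶ prodComplex Z' := prodLift fun i => prodπ Z i ≫ f i

/-- The direct sum of a family of morphisms of complexes. -/
def sumMap {Z Z' : I → CochainComplex (ModuleCat.{u} R) ℤ} (f : ∀ i, Z i ⟶ Z' i) :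
    sumComplex Z ⟶ sumComplex Z' := sumDesc Z fun i => f i ≫ sumι Z' i

lemma sumMap_π {Z Z' : I → CochainComplex (ModuleCat.{u} R) ℤ} (f : ∀ i, Z i ⟶ Z' i) (i : I) :
    sumMap f ≫ sumπ Z' i = sumπ Z i ≫ f i := by
  refine sum_hom_ext fun j => ?_
  rw [sumMap, ← Category.assoc, sumι_desc, Category.assoc, ← Category.assoc (sumι Z j)]
  by_cases h : j = i
  · subst h
    rw [sumι_π_self, sumι_π_self, Category.comp_id, Category.id_comp]
  · rw [sumι_π_ne h, sumι_π_ne h, comp_zero, zero_comp]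

end ProdComplex

end PseudoDualizing

end

noncomputable section
namespace PseudoDualizing

open CochainComplex.HomComplex

/-! ### The generator of the ring and right multiplications. -/

section UnitElement

variable {R : Type u} [Ring R]

/-- The generator of the ring as a complex in degree zero. -/
def unitElement (R : Type u) [Ring R] : (unitComplex R).X 0 :=
  (HomologicalComplex.singleObjXSelf (ComplexShape.up ℤ) 0 (ModuleCat.of R R)).inv.hom (1 : R)

lemma exists_smul_unitElement (y : (unitComplex R).X 0) : ∃ r : R, y = r • unitElement R := by
  let e := HomologicalComplex.singleObjXSelf (ComplexShape.up ℤ) 0 (ModuleCat.of R R)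
  refine ⟨(e.hom.hom y : R), ?_⟩
  refine Eq.trans ?_ (e.inv.hom.map_smul (e.hom.hom y : R) (1 : R))
  have : e.hom.hom y • (1 : R) = (e.hom.hom y : R) := mul_one _
  exact (congrArg (fun f => f.hom y) e.hom_inv_id).symm.trans (congrArg e.inv.hom this.symm)

lemma isZero_unitComplex_X {n : ℤ} (h : n ≠ 0) : IsZero ((unitComplex R).X n) :=
  HomologicalComplex.isZero_single_obj_X _ _ _ _ h

lemma eq_zero_of_isZero {M : ModuleCat.{u} R} (h : IsZero M) (x : M) : x = 0 :=
  congrArg (fun f => f.hom x) (h.eq_of_src (𝟙 M) 0)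

lemma unitComplex_d (m n : ℤ) (x : (unitComplex R).X m) : ((unitComplex R).d m n).hom x = 0 := by
  have : (unitComplex R).d m n = 0 := HomologicalComplex.single_obj_d _ _ _ _ _
  rw [this]
  rfl

variable {Y : CochainComplex (ModuleCat.{u} R) ℤ}

/-- The map from the ring given by a cycle of degree zero. -/
def unitDesc (y : Y.X 0) (hy : (Y.d 0 1).hom y = 0) : unitComplex R ⟶ Y :=
  (Cocycle.equivHom _ _).symm (elementCocycle y hy)

lemma unitDesc_unitElement (y : Y.X 0) (hy : (Y.d 0 1).hom y = 0) :
    ((unitDesc y hy).f 0).hom (unitElement R) = y := by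
  have h : (unitDesc y hy).f 0 = (elementCocycle y hy : Cochain _ _ 0).v 0 0 (add_zero 0) := by
    simp [unitDesc, Cocycle.equivHom]
  rw [h]
  have h' : (elementCocycle y hy : Cochain (unitComplex R) Y 0).v 0 0 (add_zero 0) =
      (HomologicalComplex.singleObjXSelf (ComplexShape.up ℤ) 0 (ModuleCat.of R R)).hom ≫
        ofElement y := Cochain.fromSingleMk_v _ _
  rw [h']
  let e := HomologicalComplex.singleObjXSelf (ComplexShape.up ℤ) 0 (ModuleCat.of R R)
  refine (congrArg (ofElement y).hom (congrArg (fun f => f.hom (1 : R)) e.inv_hom_id)).trans ?_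
  exact one_smul R y

lemma unit_hom_ext {f g : unitComplex R ⟶ Y}
    (h : (f.f 0).hom (unitElement R) = (g.f 0).hom (unitElement R)) : f = g := by
  ext n : 1
  by_cases hn : n = 0
  · subst hn
    refine ModuleCat.hom_ext (LinearMap.ext fun y => ?_)
    obtain ⟨r, rfl⟩ := exists_smul_unitElement y
    rw [map_smul, map_smul, h]
  · exact (isZero_unitComplex_X hn).eq_of_src _ _

lemma unitHo_hom_eq_zero {n : ℤ} (hY : IsZero (Y.X n)) (φ : unitHo R ⟶ ((toHo R).obj Y)⟦n⟧) :
    φ = 0 := by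
  obtain ⟨y, hy, rfl⟩ := cycleHom_surjective φ
  exact (cycleHom_eq_zero_iff y hy (n - 1) (by omega)).2
    ⟨0, (map_zero _).trans (eq_zero_of_isZero hY y).symm⟩

/-- Right multiplication by an element of the ring. -/
def rightMul (r : R) : unitComplex R ⟶ unitComplex R :=
  unitDesc (r • unitElement R) (unitComplex_d _ _ _)

lemma rightMul_unitElement (r : R) :
    ((rightMul r).f 0).hom (unitElement R) = r • unitElement R :=
  unitDesc_unitElement _ _

lemma rightMul_surjective (f : unitComplex R ⟶ unitComplex R) : ∃ r, rightMul r = f := by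
  obtain ⟨r, hr⟩ := exists_smul_unitElement ((f.f 0).hom (unitElement R))
  exact ⟨r, unit_hom_ext ((rightMul_unitElement r).trans hr.symm)⟩

instance (m : ℤ) : Module.Finite R ((unitComplex R).X m) := by
  by_cases hm : m = 0
  · subst hm
    let e := HomologicalComplex.singleObjXSelf (ComplexShape.up ℤ) 0 (ModuleCat.of R R)
    exact Module.Finite.equiv (M := R) e.toLinearEquiv.symm
  · have := ModuleCat.subsingleton_of_isZero (isZero_unitComplex_X (R := R) hm)
    infer_instance

end UnitElement

/-! ### The isomorphism of `L` with `L ⊗_B B`. -/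

section TensorUnit

variable {A B : Type u} [Ring A] [Ring B] (L : CochainComplex (Bimod A B) ℤ)

/-- The map `L ⟶ L ⊗_B B`. -/
def toTensorUnit : leftComplex L ⟶ tensorComplex L (unitComplex B) where
  f n := ModuleCat.ofHom (X := (toLeft A B).obj (L.X n))
    { toFun := fun x => tens n (add_zero n) (show L.X n from x) (unitElement B)
      map_add' := fun x y => add_tens _ _ _ _
      map_smul' := fun a x => smul_tens _ _ _ _ }
  comm' m n h := by
    refine ModuleCat.hom_ext (LinearMap.ext fun x => ?_)
    have h : m + 1 = n := h
    refine (d_tens m 0 m n n 1 (add_zero m) h h rfl (show L.X m from x) (unitElement B)).trans ?_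
    rw [unitComplex_d]
    have : tens n (by omega) (show L.X m from x) (0 : (unitComplex B).X 1) = 0 := by
      simpa using tens_add (by omega : m + 1 = n) (show L.X m from x) (0 : (unitComplex B).X 1) 0
    rw [this, smul_zero, add_zero]
    rfl

/-- The identity as an element of `Hom_A(L, L)`. -/
def identityElement : (homComplex L (leftComplex L)).X 0 :=
  ofCochain (Cochain.ofHom (𝟙 (leftComplex L)))

lemma d_identityElement :
    ((homComplex L (leftComplex L)).d 0 1).hom (identityElement L) = 0 :=
  δ_ofHom (𝟙 (leftComplex L))

lemma evalCochain_identityElement {n : ℤ} (x : L.X n) :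
    evalCochain (identityElement L) (add_zero n) x = x :=
  congrArg (fun f : (leftComplex L).X n ⟶ (leftComplex L).X n => f.hom x)
    (Cochain.ofHom_v (𝟙 (leftComplex L)) n)

/-- The map `L ⊗_B B ⟶ L`. -/
def fromTensorUnit : tensorComplex L (unitComplex B) ⟶ leftComplex L :=
  tensorHomInvFun (unitDesc (identityElement L) (d_identityElement L))

lemma fromTensorUnit_tens {n : ℤ} (x : L.X n) :
    ((fromTensorUnit L).f n).hom (tens n (add_zero n) x (unitElement B)) = x := by
  refine (tensorHomInvFun_tens _ _ _ _).trans ?_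
  rw [unitDesc_unitElement, mul_zero, Int.negOnePow_zero, one_smul, evalCochain_identityElement]

/-- The isomorphism `L ≅ L ⊗_B B`. -/
def tensorUnitIso : leftComplex L ≅ tensorComplex L (unitComplex B) where
  hom := toTensorUnit L
  inv := fromTensorUnit L
  hom_inv_id := by
    ext n x
    exact fromTensorUnit_tens L x
  inv_hom_id := by
    ext n : 1
    refine tensorComplex_hom_ext fun p q h x y => ?_
    by_cases hq : q = 0
    · subst hq
      obtain rfl : p = n := by omega
      obtain ⟨b, rfl⟩ := exists_smul_unitElement y
      rw [← tens_balanced]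
      exact congrArg ((toTensorUnit L).f p).hom (fromTensorUnit_tens L _)
    · rw [eq_zero_of_isZero (isZero_unitComplex_X hq) y]
      have : tens n h x (0 : (unitComplex B).X q) = 0 := by
        simpa using tens_add h x (0 : (unitComplex B).X q) 0
      rw [this, map_zero, map_zero]

/-- Endomorphisms of the complex `B` become the right action on `L`. This is how the homothety map
appears as the Yoneda map at the ring. -/
lemma toTensorUnit_rightMul (b : B) :
    toTensorUnit L ≫ (tensorFunctor L).map (rightMul b) =
      (show leftComplex L ⟶ leftComplex L from actB L (MulOpposite.op b)) ≫ toTensorUnit L := by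
  ext n x
  refine (tensorFunctor_map_tens (rightMul b) (add_zero n) (show L.X n from x)
    (unitElement B)).trans ?_
  rw [rightMul_unitElement, ← tens_balanced]
  rfl

end TensorUnit

/-! ### Direct sums, retracts and extensions: from the ring to bounded complexes of projectives. -/

section TensorSum

variable {A B : Type u} [Ring A] [Ring B] (L : CochainComplex (Bimod A B) ℤ)
  {I : Type u} (Z : I → CochainComplex (ModuleCat.{u} B) ℤ)

instance : (tensorFunctor L).PreservesZeroMorphisms where
  map_zero P P' := by
    ext n : 1
    refine tensorComplex_hom_ext fun p q h x y => ?_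
    refine (tensorFunctor_map_tens (0 : P ⟶ P') h x y).trans ?_
    have h₀ : tens (P := P') n h x (0 : P'.X q) = 0 := by
      simpa using tens_add (P := P') h x (0 : P'.X q) 0
    exact h₀

/-- The family of the tensor products with the members of a family of complexes. -/
abbrev tensorFamily (i : I) : CochainComplex (ModuleCat.{u} A) ℤ := (tensorFunctor L).obj (Z i)

/-- The map from the tensor product with a direct sum to the direct sum of the tensor products. -/
def tensorSumHom : (tensorFunctor L).obj (sumComplex Z) ⟶ sumComplex (tensorFamily L Z) :=
  ((tensorHomAdjunction L).homEquiv _ _).symm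
    (sumDesc Z fun i => (tensorHomAdjunction L).homEquiv _ _ (sumι (tensorFamily L Z) i))

lemma map_sumι_tensorSumHom (i : I) :
    (tensorFunctor L).map (sumι Z i) ≫ tensorSumHom L Z = sumι (tensorFamily L Z) i := by
  apply ((tensorHomAdjunction L).homEquiv _ _).injective
  rw [Adjunction.homEquiv_naturality_left, tensorSumHom, Equiv.apply_symm_apply, sumι_desc]

-- As `L ⊗_B -` is a left adjoint, maps out of the tensor product with a sum are tested on the
-- summands after passing to the adjoint map.
variable {L Z} in
lemma tensorSum_hom_ext {J : CochainComplex (ModuleCat.{u} A) ℤ}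
    {f g : (tensorFunctor L).obj (sumComplex Z) ⟶ J}
    (h : ∀ i, (tensorFunctor L).map (sumι Z i) ≫ f = (tensorFunctor L).map (sumι Z i) ≫ g) :
    f = g := by
  apply ((tensorHomAdjunction L).homEquiv _ _).injective
  refine sum_hom_ext fun i => ?_
  rw [← Adjunction.homEquiv_naturality_left, h, Adjunction.homEquiv_naturality_left]

instance : IsIso (tensorSumHom L Z) := by
  refine ⟨sumDesc _ fun i => (tensorFunctor L).map (sumι Z i), tensorSum_hom_ext fun i => ?_,
    sum_hom_ext fun i => ?_⟩
  · rw [← Category.assoc, map_sumι_tensorSumHom, sumι_desc, Category.comp_id]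
  · rw [← Category.assoc, sumι_desc, map_sumι_tensorSumHom, Category.comp_id]

lemma tensorSumHom_π (i : I) :
    tensorSumHom L Z ≫ sumπ (tensorFamily L Z) i = (tensorFunctor L).map (sumπ Z i) := by
  refine tensorSum_hom_ext fun j => ?_
  rw [← Category.assoc, map_sumι_tensorSumHom, ← Functor.map_comp]
  by_cases h : j = i
  · subst h
    rw [sumι_π_self, sumι_π_self, CategoryTheory.Functor.map_id]
  · rw [sumι_π_ne h, sumι_π_ne h, Functor.map_zero]

lemma map_sumι_tensorSumHom_sumMap {Y : I → CochainComplex (ModuleCat.{u} A) ℤ}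
    (f : ∀ i, (tensorFunctor L).obj (Z i) ⟶ Y i) (i : I) :
    (tensorFunctor L).map (sumι Z i) ≫ tensorSumHom L Z ≫ sumMap f = f i ≫ sumι Y i := by
  rw [← Category.assoc, map_sumι_tensorSumHom, sumMap, sumι_desc]

lemma tensorSumHom_sumMap_π {Y : I → CochainComplex (ModuleCat.{u} A) ℤ}
    (f : ∀ i, (tensorFunctor L).obj (Z i) ⟶ Y i) (i : I) :
    (tensorSumHom L Z ≫ sumMap f) ≫ sumπ Y i = (tensorFunctor L).map (sumπ Z i) ≫ f i := by
  rw [Category.assoc, sumMap_π, ← Category.assoc, tensorSumHom_π]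

variable {L Z}

lemma isIso_sumMap {R : Type u} [Ring R] {Z Z' : I → CochainComplex (ModuleCat.{u} R) ℤ}
    (e : ∀ i, Z i ≅ Z' i) : IsIso (sumMap fun i => (e i).hom) := by
  refine ⟨sumMap fun i => (e i).inv, sum_hom_ext fun i => ?_, sum_hom_ext fun i => ?_⟩
  · rw [← Category.assoc, sumMap, sumι_desc, Category.assoc, sumMap, sumι_desc,
      Iso.hom_inv_id_assoc, Category.comp_id]
  · rw [← Category.assoc, sumMap, sumι_desc, Category.assoc, sumMap, sumι_desc,
      Iso.inv_hom_id_assoc, Category.comp_id]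

/-- Since `U` and `V` have finitely generated terms and only the degrees in `T` and `T'` matter,
maps out of both decompose into finitely many components. -/
lemma bijective_transfer_sum {U : CochainComplex (ModuleCat.{u} B) ℤ}
    {V : CochainComplex (ModuleCat.{u} A) ℤ}
    [∀ m, Module.Finite B (U.X m)] [∀ m, Module.Finite A (V.X m)]
    (t : (toHo A).obj V ⟶ (tensorFunctorHo L).obj ((toHo B).obj U))
    {Y : I → CochainComplex (ModuleCat.{u} A) ℤ} (f : ∀ i, (tensorFunctor L).obj (Z i) ⟶ Y i)
    (n : ℤ) (T T' : Finset ℤ)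
    (hT : ∀ m ∉ T, IsZero (U.X m) ∨ ∀ i, IsZero ((Z i).X (m + n)))
    (hT' : ∀ m ∉ T', IsZero (V.X m) ∨ ∀ i, IsZero ((Y i).X (m + n)))
    (hf : ∀ i, Function.Bijective
      (transfer (tensorFunctorHo L) t (X := (toHo B).obj (Z i)) ((toHo A).map (f i)) n)) :
    Function.Bijective (transfer (tensorFunctorHo L) t (X := (toHo B).obj (sumComplex Z))
      ((toHo A).map (tensorSumHom L Z ≫ sumMap f)) n) := by
  refine bijective_transfer_of_sum (tensorFunctorHo L) t (P := (toHo B).obj (sumComplex Z))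
    (Z := fun i => (toHo B).obj (Z i)) (sumπHo Z) (sumιHo Z) (sumπHo Y) (sumιHo Y) _
    (fun i => (toHo A).map (f i)) n (sum_decomposition_ho T hT) (sum_decomposition_ho T' hT')
    (fun i => ?_) (fun i => ?_) hf
  · refine ((toHo A).map_comp _ _).symm.trans (Eq.trans ?_ ((toHo A).map_comp _ _))
    exact congrArg (toHo A).map (map_sumι_tensorSumHom_sumMap L Z f i)
  · refine ((toHo A).map_comp _ _).symm.trans (Eq.trans ?_ ((toHo A).map_comp _ _))
    exact congrArg (toHo A).map (tensorSumHom_sumMap_π L Z f i)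

lemma yonedaLocal_sum_unit {U : CochainComplex (ModuleCat.{u} B) ℤ}
    {V : CochainComplex (ModuleCat.{u} A) ℤ}
    [∀ m, Module.Finite B (U.X m)] [∀ m, Module.Finite A (V.X m)]
    (t : (toHo A).obj V ⟶ (tensorFunctorHo L).obj ((toHo B).obj U))
    (hL : ∃ a b : ℤ, L.IsStrictlyGE a ∧ L.IsStrictlyLE b)
    (ht : yonedaLocal (tensorFunctorHo L) t (unitHo B)) :
    yonedaLocal (tensorFunctorHo L) t ((toHo B).obj (sumComplex fun _ : I => unitComplex B)) := by
  obtain ⟨a, b, _, _⟩ := hL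
  intro n
  -- The ring lives in degree `0` and `L` in degrees `[a, b]`, so after a shift by `n` only the
  -- degree `-n` of `U` and the degrees `[a - n, b - n]` of `V` are relevant.
  have h := bijective_transfer_sum (Z := fun _ : I => unitComplex B) t
    (Y := fun _ => leftComplex L) (fun _ => fromTensorUnit L) n {-n} (Finset.Icc (a - n) (b - n))
    (fun m hm => Or.inr fun i => isZero_unitComplex_X (by simp at hm; omega))
    (fun m hm => Or.inr fun i => ?_) (fun i => ?_)
  · refine (bijective_transfer_iff (tensorFunctorHo L) t
      (X := (toHo B).obj (sumComplex fun _ : I => unitComplex B)) _ n ?_).1 h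
    have h₁ : IsIso (sumMap fun _ : I => fromTensorUnit L) :=
      isIso_sumMap fun _ => (tensorUnitIso L).symm
    have h₃ : IsIso (tensorSumHom L (fun _ : I => unitComplex B) ≫
        sumMap fun _ => fromTensorUnit L) := IsIso.comp_isIso' inferInstance h₁
    have h₂ : IsIso ((toHo A).map (tensorSumHom L (fun _ : I => unitComplex B) ≫
        sumMap fun _ => fromTensorUnit L)) :=
      Functor.map_isIso _ _
    exact ((asIso (((toHo A).map (tensorSumHom L (fun _ : I => unitComplex B) ≫
        sumMap fun _ => fromTensorUnit L))⟦n⟧')).homToEquiv).bijective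
  · have : ¬ (a ≤ m + n ∧ m + n ≤ b) := fun h => hm (by simp; omega)
    by_cases h : a ≤ m + n
    · exact CochainComplex.isZero_of_isStrictlyLE _ b _ (by omega)
    · exact CochainComplex.isZero_of_isStrictlyGE _ a _ (by omega)
  · refine (bijective_transfer_iff (tensorFunctorHo L) t (X := unitHo B) _ n ?_).2 (ht n)
    have : IsIso (fromTensorUnit L) := (tensorUnitIso L).isIso_inv
    exact ((asIso (((toHo A).map (fromTensorUnit L))⟦n⟧')).homToEquiv).bijective

/-- The free module on the elements of `M` surjects onto `M`, and projectivity splits the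
surjection. -/
lemma exists_retract_sum_unit {R : Type u} [Ring R] (M : ModuleCat.{u} R) [Projective M] :
    Nonempty (Retract ((CochainComplex.singleFunctor (ModuleCat.{u} R) 0).obj M)
      (sumComplex fun _ : M => unitComplex R)) := by
  let e : ((CochainComplex.singleFunctor (ModuleCat.{u} R) 0).obj M).X 0 ≅ M :=
    HomologicalComplex.singleObjXSelf (ComplexShape.up ℤ) 0 M
  have hz : IsZero (((CochainComplex.singleFunctor (ModuleCat.{u} R) 0).obj M).X 1) :=
    HomologicalComplex.isZero_single_obj_X _ _ _ _ (by simp)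
  let g : ∀ _ : M, unitComplex R ⟶ (CochainComplex.singleFunctor (ModuleCat.{u} R) 0).obj M :=
    fun m => unitDesc (e.inv.hom m) (eq_zero_of_isZero hz _)
  obtain ⟨r, hr⟩ : ∃ r : sumComplex (fun _ : M => unitComplex R) ⟶
      (CochainComplex.singleFunctor (ModuleCat.{u} R) 0).obj M, Epi (r.f 0) := by
    refine ⟨sumDesc _ g, ?_⟩
    rw [ModuleCat.epi_iff_surjective]
    intro x
    refine ⟨((sumι (fun _ : M => unitComplex R) (e.hom.hom x)).f 0).hom (unitElement R), ?_⟩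
    refine (congrArg (fun f => (f.f 0).hom (unitElement R)) (sumι_desc g (e.hom.hom x))).trans ?_
    refine (unitDesc_unitElement _ _).trans ?_
    exact congrArg (fun f => f.hom x) e.hom_inv_id
  have hz' : IsZero ((sumComplex fun _ : M => unitComplex R).X 1) := by
    rw [IsZero.iff_id_eq_zero]
    exact to_sum_ext fun i => (isZero_unitComplex_X (by simp)).eq_of_tgt _ _
  let s : (CochainComplex.singleFunctor (ModuleCat.{u} R) 0).obj M ⟶
      sumComplex fun _ : M => unitComplex R :=
    HomologicalComplex.mkHomFromSingle (Projective.factorThru e.inv (r.f 0))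
      (fun k hk => by
        obtain rfl : 0 + 1 = k := hk
        exact hz'.eq_of_tgt _ _)
  refine ⟨⟨s, r, ?_⟩⟩
  apply HomologicalComplex.from_single_hom_ext
  refine (congrArg (· ≫ r.f 0) (HomologicalComplex.mkHomFromSingle_f _ _)).trans ?_
  rw [Category.assoc, Projective.factorThru_comp]
  exact e.hom_inv_id

section Projectives

variable {U : CochainComplex (ModuleCat.{u} B) ℤ} {V : CochainComplex (ModuleCat.{u} A) ℤ}
  [∀ m, Module.Finite B (U.X m)] [∀ m, Module.Finite A (V.X m)]
  (t : (toHo A).obj V ⟶ (tensorFunctorHo L).obj ((toHo B).obj U))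
  (hL : ∃ a b : ℤ, L.IsStrictlyGE a ∧ L.IsStrictlyLE b)
  (ht : yonedaLocal (tensorFunctorHo L) t (unitHo B))

include hL ht

lemma yonedaLocal_single (M : ModuleCat.{u} B) [Projective M] (n : ℤ) :
    yonedaLocal (tensorFunctorHo L) t
      ((toHo B).obj ((CochainComplex.singleFunctor (ModuleCat.{u} B) n).obj M)) := by
  obtain ⟨r⟩ := exists_retract_sum_unit M
  have h₀ : yonedaLocal (tensorFunctorHo L) t
      ((toHo B).obj ((CochainComplex.singleFunctor (ModuleCat.{u} B) 0).obj M)) :=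
    (yonedaLocal (tensorFunctorHo L) t).prop_of_retract (r.map (toHo B))
      (yonedaLocal_sum_unit t hL ht)
  exact (yonedaLocal (tensorFunctorHo L) t).prop_of_iso
    (((HomotopyCategory.singleFunctors (ModuleCat.{u} B)).shiftIso (-n) n 0 (by omega)).app M)
    (yonedaLocal_shift _ _ h₀ (-n))

/-- Induction on the length: the stupid truncation splits off the top term, a shifted projective
module, and the five lemma applies to the resulting triangle. -/
lemma yonedaLocal_of_bounded (a : ℤ) (k : ℕ) (P : CochainComplex (ModuleCat.{u} B) ℤ)
    [∀ n, Projective (P.X n)] [P.IsStrictlyGE a] [P.IsStrictlyLE (a + k)] :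
    yonedaLocal (tensorFunctorHo L) t ((toHo B).obj P) := by
  induction k generalizing P with
  | zero =>
    have : P.IsStrictlyLE a := by simpa using (inferInstance : P.IsStrictlyLE (a + (0 : ℕ)))
    obtain ⟨M, ⟨e⟩⟩ := P.exists_iso_single a
    have : Projective M := Projective.of_iso
      ((HomologicalComplex.eval _ _ a).mapIso e ≪≫ HomologicalComplex.singleObjXSelf (ComplexShape.up ℤ) a M)
      (inferInstance : Projective (P.X a))
    exact (yonedaLocal (tensorFunctorHo L) t).prop_of_iso ((toHo B).mapIso e.symm)
      (yonedaLocal_single t hL ht M a)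
  | succ k ih =>
    have hn := fun n => pieceComplex_projective P (fun n => a + (k + 1 : ℕ) ≤ n)
      (fun n _ _ => by omega) n
    have hn' := fun n => pieceComplex_projective P (fun n => n < a + (k + 1 : ℕ))
      (fun n _ _ => by omega) n
    refine yonedaLocal₂ _ _ _ (stupidTriangle_distinguished P (a + (k + 1 : ℕ))) ?_ ?_
    · have h1 : (stupidGE P (a + (k + 1 : ℕ))).IsStrictlyLE (a + (k + 1 : ℕ)) :=
        pieceComplex_isStrictlyLE' P _ _ _
      have h3 : ∀ n, Projective ((stupidGE P (a + (k + 1 : ℕ))).X n) := hn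
      obtain ⟨M, ⟨e⟩⟩ := (stupidGE P (a + (k + 1 : ℕ))).exists_iso_single (a + (k + 1 : ℕ))
      have : Projective M := Projective.of_iso ((HomologicalComplex.eval _ _ _).mapIso e ≪≫
        HomologicalComplex.singleObjXSelf (ComplexShape.up ℤ) (a + (k + 1 : ℕ)) M) (h3 (a + (k + 1 : ℕ)))
      exact (yonedaLocal (tensorFunctorHo L) t).prop_of_iso ((toHo B).mapIso e.symm)
        (yonedaLocal_single t hL ht M _)
    · have h1 : (stupidLT P (a + (k + 1 : ℕ))).IsStrictlyGE a :=
        pieceComplex_isStrictlyGE' P _ _ _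
      have h2 : (stupidLT P (a + (k + 1 : ℕ))).IsStrictlyLE (a + k) :=
        stupidLT_isStrictlyLE P _ _ (by push_cast; omega)
      have h3 : ∀ n, Projective ((stupidLT P (a + (k + 1 : ℕ))).X n) := hn'
      exact ih (stupidLT P (a + (k + 1 : ℕ)))

end Projectives

end TensorSum

/-! ### The `B`-dual of a complex of right modules and the map `L ⊗_B Hom(Q, B) ⟶ Hom(Q, L)`. -/

section Dual

variable {A B : Type u} [Ring A] [Ring B] (Q : CochainComplex (ModuleCat.{u} Bᵐᵒᵖ) ℤ)

/-- The complex of left `B`-modules dual to a complex of right `B`-modules. -/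
def dualComplex : CochainComplex (ModuleCat.{u} B) ℤ where
  X n := ModuleCat.of B (Q.X (-n) →ₗ[Bᵐᵒᵖ] B)
  d m n := ModuleCat.ofHom
    -- With this sign `dualMap` commutes with differentials: multiplied by the sign `(-1)^p` of the
    -- tensor product it becomes `(-1)^(p+n)`, the sign in the Hom complex.
    { toFun := fun φ => n.negOnePow • φ ∘ₗ (Q.d (-n) (-m)).hom
      map_add' := fun φ ψ => by rw [LinearMap.add_comp, smul_add]
      map_smul' := fun b φ => by
        rw [LinearMap.smul_comp, RingHom.id_apply]
        exact smul_comm _ _ _ }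
  shape m n h := by
    have : Q.d (-n) (-m) = 0 := Q.shape _ _ (fun h' => h (by simp at h' ⊢; omega))
    ext (φ : Q.X (-m) →ₗ[Bᵐᵒᵖ] B) x
    refine (congrArg (fun y => n.negOnePow • φ y)
      (congrArg (fun f => f.hom x) this)).trans ?_
    exact (congrArg (n.negOnePow • ·) (map_zero φ)).trans (smul_zero _)
  d_comp_d' i j k _ _ := by
    ext (φ : Q.X (-i) →ₗ[Bᵐᵒᵖ] B) x
    refine (congrArg (fun y => k.negOnePow • j.negOnePow • φ y)
      (congrArg (fun f => f.hom x) (Q.d_comp_d (-k) (-j) (-i)))).trans ?_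
    refine (congrArg (k.negOnePow • j.negOnePow • ·) (map_zero φ)).trans ?_
    rw [smul_zero, smul_zero]
    rfl

/-- The functional underlying an element of the dual complex. -/
def dualApply {Q : CochainComplex (ModuleCat.{u} Bᵐᵒᵖ) ℤ} {q : ℤ} (φ : (dualComplex Q).X q) :
    Q.X (-q) →ₗ[Bᵐᵒᵖ] B := φ

lemma dualApply_d {m n : ℤ} (φ : (dualComplex Q).X m) (x : Q.X (-n)) :
    dualApply (((dualComplex Q).d m n).hom φ) x =
      n.negOnePow • dualApply φ ((Q.d (-n) (-m)).hom x) := rfl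

-- The dual basis lemma, read off from a splitting of a surjection from a free module of finite
-- rank.
variable {Q} in
lemma exists_dual_basis (M : ModuleCat.{u} Bᵐᵒᵖ) [Module.Finite Bᵐᵒᵖ M] [Module.Projective Bᵐᵒᵖ M] :
    ∃ (k : ℕ) (e : Fin k → M) (e' : Fin k → (M →ₗ[Bᵐᵒᵖ] B)),
      ∀ x, x = ∑ j, MulOpposite.op (e' j x) • e j := by
  obtain ⟨k, f, g, -, -, h⟩ := Module.Finite.exists_comp_eq_id_of_projective Bᵐᵒᵖ M
  refine ⟨k, fun j => f (Pi.single j 1), fun j =>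
    { toFun := fun x => (g x j).unop
      map_add' := fun x y => by simp
      map_smul' := fun r x => by simp }, fun x => ?_⟩
  refine (LinearMap.congr_fun h x).symm.trans ?_
  rw [LinearMap.comp_apply]
  conv_lhs => rw [← Finset.univ_sum_single (g x), map_sum]
  refine Finset.sum_congr rfl fun j _ => ?_
  refine Eq.trans ?_ (f.map_smul (g x j) (Pi.single j 1))
  congr 1
  rw [← Pi.single_smul, smul_eq_mul, mul_one]

variable {Q} in
lemma eq_sum_smul_dual {M : ModuleCat.{u} Bᵐᵒᵖ} {k : ℕ} {e : Fin k → M}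
    {e' : Fin k → (M →ₗ[Bᵐᵒᵖ] B)} (h : ∀ x, x = ∑ j, MulOpposite.op (e' j x) • e j)
    (φ : M →ₗ[Bᵐᵒᵖ] B) : φ = ∑ j, φ (e j) • e' j := by
  refine LinearMap.ext fun x => ?_
  conv_lhs => rw [h x]
  simp

variable (L : CochainComplex (Bimod A B) ℤ)

/-- The degree `n` term of the complex `Hom_{Bᵒᵖ}(Q, L)`. -/
def HomRightTerm (n : ℤ) : Type u := Cochain Q (rightComplex L) n

instance (n : ℤ) : AddCommGroup (HomRightTerm Q L n) :=
  inferInstanceAs (AddCommGroup (Cochain Q (rightComplex L) n))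

/-- The cochain underlying an element of `Hom_{Bᵒᵖ}(Q, L)`. -/
def HomRightTerm.toCochain {Q : CochainComplex (ModuleCat.{u} Bᵐᵒᵖ) ℤ}
    {L : CochainComplex (Bimod A B) ℤ} {n : ℤ} (f : HomRightTerm Q L n) :
    Cochain Q (rightComplex L) n := f

/-- The morphism of complexes of right modules given by an element of `A`. -/
def actHom (a : A) : rightComplex L ⟶ rightComplex L := actA L a

lemma actHom_one : actHom L 1 = 𝟙 _ := map_one (actA L)
lemma actHom_zero : actHom L 0 = 0 := map_zero (actA L)
lemma actHom_add (a b : A) : actHom L (a + b) = actHom L a + actHom L b := map_add (actA L) a b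
lemma actHom_mul (a b : A) : actHom L (a * b) = actHom L b ≫ actHom L a := map_mul (actA L) a b

instance (n : ℤ) : Module A (HomRightTerm Q L n) where
  smul a f := (f.toCochain.comp (Cochain.ofHom (actHom L a)) (add_zero n))
  one_smul f := by
    change f.toCochain.comp (Cochain.ofHom (actHom L 1)) (add_zero n) = f.toCochain
    rw [actHom_one, Cochain.comp_id]
  mul_smul a b f := by
    change f.toCochain.comp (Cochain.ofHom (actHom L (a * b))) (add_zero n) =
      (f.toCochain.comp (Cochain.ofHom (actHom L b)) (add_zero n)).comp
        (Cochain.ofHom (actHom L a)) (add_zero n)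
    rw [actHom_mul, Cochain.ofHom_comp, Cochain.comp_assoc_of_third_is_zero_cochain]
  smul_zero a := Cochain.zero_comp _ _
  smul_add a f g := Cochain.add_comp _ _ _ _
  add_smul a b f := by
    change f.toCochain.comp (Cochain.ofHom (actHom L (a + b))) (add_zero n) =
      f.toCochain.comp (Cochain.ofHom (actHom L a)) (add_zero n) +
        f.toCochain.comp (Cochain.ofHom (actHom L b)) (add_zero n)
    rw [actHom_add, Cochain.ofHom_add, Cochain.comp_add]
  zero_smul f := by
    change f.toCochain.comp (Cochain.ofHom (actHom L 0)) (add_zero n) = 0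
    rw [actHom_zero, Cochain.ofHom_zero, Cochain.comp_zero]

variable {Q L}

/-- The evaluation of an element of `Hom_{Bᵒᵖ}(Q, L)`. -/
def HomRightTerm.eval {n : ℤ} (f : HomRightTerm Q L n) {i p : ℤ} (h : i + n = p) (x : Q.X i) :
    L.X p := (f.toCochain.v i p h).hom x

lemma HomRightTerm.ext_eval {n : ℤ} {f g : HomRightTerm Q L n}
    (h : ∀ (i p : ℤ) (hp : i + n = p) (x : Q.X i), f.eval hp x = g.eval hp x) : f = g := by
  refine Cochain.ext (z₁ := f.toCochain) (z₂ := g.toCochain) fun i p hp => ?_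
  ext x
  exact h i p hp x

/-- The map `x ↦ l φ(x)`. -/
def elementMap {p : ℤ} {M : ModuleCat.{u} Bᵐᵒᵖ} (l : L.X p) (φ : M →ₗ[Bᵐᵒᵖ] B) :
    M ⟶ (rightComplex L).X p :=
  ModuleCat.ofHom (Y := (toRight A B).obj (L.X p))
    { toFun := fun x => (inclB A B (MulOpposite.op (φ x)) • l : L.X p)
      map_add' := fun x y => by
        rw [map_add, MulOpposite.op_add, map_add, add_smul]
        rfl
      map_smul' := fun r x => by
        change (inclB A B (MulOpposite.op (φ (r • x))) • l : L.X p) =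
          inclB A B r • inclB A B (MulOpposite.op (φ x)) • l
        rw [map_smul, smul_smul, ← map_mul]
        rfl }

/-- The element of `Hom_{Bᵒᵖ}(Q, L)` attached to `l` and `φ`. -/
def elementary (n : ℤ) {p q : ℤ} (l : L.X p) (φ : (dualComplex Q).X q) : HomRightTerm Q L n :=
  Cochain.single (K := Q) (L := rightComplex L) (p := -q) (q := p) (elementMap l (dualApply φ)) n

lemma eval_elementary {n p q : ℤ} (h : p + q = n) (l : L.X p) (φ : (dualComplex Q).X q)
    (x : Q.X (-q)) :
    (elementary n l φ).eval (show -q + n = p by omega) x =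
      inclB A B (MulOpposite.op (dualApply φ x)) • l :=
  congrArg (fun f : Q.X (-q) ⟶ (rightComplex L).X p => f.hom x) (Cochain.single_v _ _ _)

lemma eval_elementary_ne {n p q i p' : ℤ} (hi : i + n = p') (hp : p' ≠ p) (l : L.X p)
    (φ : (dualComplex Q).X q) (x : Q.X i) : (elementary n l φ).eval hi x = 0 :=
  congrArg (fun f : Q.X i ⟶ (rightComplex L).X p' => f.hom x)
    (Cochain.single_v_eq_zero' _ _ _ _ _ hp)

lemma elementary_ext {n p q : ℤ} (h : p + q = n) {f : HomRightTerm Q L n} {l : L.X p}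
    {φ : (dualComplex Q).X q}
    (h₁ : ∀ x : Q.X (-q), f.eval (show -q + n = p by omega) x =
      inclB A B (MulOpposite.op (dualApply φ x)) • l)
    (h₂ : ∀ (i p' : ℤ) (hi : i + n = p') (_ : p' ≠ p) (x : Q.X i), f.eval hi x = 0) :
    f = elementary n l φ := by
  refine HomRightTerm.ext_eval fun i p' hi x => ?_
  by_cases hp : p' = p
  · subst hp
    obtain rfl : i = -q := by omega
    rw [h₁, eval_elementary h]
  · rw [h₂ i p' hi hp, eval_elementary_ne hi hp]

lemma HomRightTerm.eval_add {n : ℤ} (f g : HomRightTerm Q L n) {i p : ℤ} (h : i + n = p)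
    (x : Q.X i) : (f + g).eval h x = f.eval h x + g.eval h x := rfl

lemma HomRightTerm.eval_smul {n : ℤ} (a : A) (f : HomRightTerm Q L n) {i p : ℤ} (h : i + n = p)
    (x : Q.X i) : (a • f).eval h x = inclA A B a • f.eval h x := by
  refine (congrArg (fun g : Q.X i ⟶ (rightComplex L).X p => g.hom x)
    (Cochain.comp_zero_cochain_v f.toCochain (Cochain.ofHom (actHom L a)) i p h)).trans ?_
  rw [Cochain.ofHom_v]
  rfl

lemma HomRightTerm.eval_map_smul {n : ℤ} (f : HomRightTerm Q L n) {i p : ℤ} (h : i + n = p)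
    (r : Bᵐᵒᵖ) (x : Q.X i) : f.eval h (r • x) = inclB A B r • f.eval h x :=
  (f.toCochain.v i p h).hom.map_smul r x

lemma HomRightTerm.eval_map_sum {n : ℤ} (f : HomRightTerm Q L n) {i p : ℤ} (h : i + n = p)
    {ι : Type*} (s : Finset ι) (x : ι → Q.X i) :
    f.eval h (∑ j ∈ s, x j) = ∑ j ∈ s, f.eval h (x j) := map_sum (f.toCochain.v i p h).hom x s

lemma HomRightTerm.eval_sum {n : ℤ} {ι : Type*} (s : Finset ι) (f : ι → HomRightTerm Q L n)
    {i p : ℤ} (h : i + n = p) (x : Q.X i) :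
    (∑ j ∈ s, f j).eval h x = ∑ j ∈ s, (f j).eval h x :=
  map_sum (AddMonoidHom.mk' (fun f : HomRightTerm Q L n => f.eval h x)
    fun f g => HomRightTerm.eval_add f g h x) f s

variable (Q L) in
/-- The canonical map `L ⊗_B Hom_{Bᵒᵖ}(Q, B) → Hom_{Bᵒᵖ}(Q, L)` in degree `n`. -/
def dualMap (n : ℤ) :
    (tensorComplex L (dualComplex Q)).X n ⟶ ModuleCat.of A (HomRightTerm Q L n) :=
  tensorDesc fun p q h => tensorLift (fun l φ => elementary n l φ)
    (fun l l' φ => (elementary_ext h (fun x => by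
      rw [HomRightTerm.eval_add, eval_elementary h, eval_elementary h, smul_add])
      (fun i p' hi hp x => by
        rw [HomRightTerm.eval_add, eval_elementary_ne hi hp, eval_elementary_ne hi hp,
          add_zero])).symm)
    (fun l φ φ' => (elementary_ext h (fun x => by
      rw [HomRightTerm.eval_add, eval_elementary h, eval_elementary h, ← add_smul, ← map_add]
      rfl)
      (fun i p' hi hp x => by
        rw [HomRightTerm.eval_add, eval_elementary_ne hi hp, eval_elementary_ne hi hp,
          add_zero])).symm)
    (fun a l φ => (elementary_ext h (fun x => by
      rw [HomRightTerm.eval_smul, eval_elementary h, smul_smul, smul_smul, inclA_mul_inclB])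
      (fun i p' hi hp x => by
        rw [HomRightTerm.eval_smul, eval_elementary_ne hi hp, smul_zero])).symm)
    (fun l b φ => elementary_ext h (fun x => by
      rw [eval_elementary h, smul_smul, ← map_mul]
      rfl)
      (fun i p' hi hp x => eval_elementary_ne hi hp _ _ x))

lemma dualMap_tens {n p q : ℤ} (h : p + q = n) (l : L.X p) (φ : (dualComplex Q).X q) :
    (dualMap Q L n).hom (tens n h l φ) = elementary n l φ :=
  tensorDesc_tens _ p q h l φ

lemma eval_δ {n n' : ℤ} (hn : n + 1 = n') (f : HomRightTerm Q L n) {i i' p p' : ℤ}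
    (hi : i + 1 = i') (hp : p + 1 = p') (h : i + n = p) (h' : i + n' = p') (x : Q.X i) :
    (show HomRightTerm Q L n' from δ n n' f.toCochain).eval h' x =
      (L.d p p').hom (f.eval h x) +
        n'.negOnePow • f.eval (by omega) ((Q.d i i').hom x) := by
  refine (congrArg (fun g : Q.X i ⟶ (rightComplex L).X p' => g.hom x)
    (δ_v n n' hn f.toCochain i p' h' p i' (by omega) hi)).trans ?_
  obtain hp' | hp' := Int.units_eq_one_or n'.negOnePow
  · rw [hp', one_smul, one_smul]
    rfl
  · rw [hp', Units.neg_smul, one_smul, Units.neg_smul, one_smul]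
    rfl

end Dual

/-! ### The duality map is an isomorphism of complexes for finitely generated projective terms. -/

section DualMap

variable {A B : Type u} [Ring A] [Ring B] (Q : CochainComplex (ModuleCat.{u} Bᵐᵒᵖ) ℤ)
  (L : CochainComplex (Bimod A B) ℤ)

/-- The differential of the complex `Hom_{Bᵒᵖ}(Q, L)`. -/
def homRightD (n n' : ℤ) :
    ModuleCat.of A (HomRightTerm Q L n) ⟶ ModuleCat.of A (HomRightTerm Q L n') :=
  ModuleCat.ofHom
    { toFun := fun f => (show HomRightTerm Q L n' from δ n n' f.toCochain)
      map_add' := fun f g => δ_add n n' f.toCochain g.toCochain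
      map_smul' := fun a f => δ_comp_ofHom f.toCochain (actHom L a) n' }

variable {Q L}

lemma smul_eval {n : ℤ} (k : ℤˣ) (f : HomRightTerm Q L n) {i p : ℤ} (h : i + n = p)
    (x : Q.X i) : (k • f).eval h x = k • f.eval h x := by
  obtain rfl | rfl := Int.units_eq_one_or k
  · rw [one_smul, one_smul]
  · rw [Units.neg_smul, one_smul, Units.neg_smul, one_smul]
    rfl

/-- The cochain of `l ⊗ φ` is concentrated in the source degree `-q`. Its coboundary has two
components, with target degree `p + 1` coming from the differential of `L` and target degree `p`
coming from that of `Q`, and these are compared separately. -/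
lemma dualMap_d_tens {n n' p q : ℤ} (hn : n + 1 = n') (h : p + q = n) (l : L.X p)
    (φ : (dualComplex Q).X q) :
    elementary n' ((L.d p (p + 1)).hom l) φ +
      p.negOnePow • elementary n' l (((dualComplex Q).d q (q + 1)).hom φ) =
      (homRightD Q L n n').hom (elementary n l φ) := by
  refine HomRightTerm.ext_eval fun i p' hi x => ?_
  rw [HomRightTerm.eval_add, smul_eval]
  refine Eq.trans ?_ (eval_δ hn (elementary n l φ) rfl (show p' - 1 + 1 = p' by omega)
    (by omega) hi x).symm
  by_cases hp : p' = p + 1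
  · subst hp
    obtain rfl : i = -q := by omega
    rw [eval_elementary_ne (p' := p + 1) (p := p) hi (by omega), smul_zero,
      eval_elementary (by omega), add_zero, eval_elementary_ne (p' := p + 1) (p := p) _ (by omega),
      smul_zero, add_zero]
    obtain ⟨p'', hp'', rfl⟩ : ∃ p'', p'' = p + 1 - 1 ∧ p = p'' := ⟨p, by omega, rfl⟩
    have key : ∀ (r : ℤ) (hr : r = p) (hr' : -q + n = r),
        inclB A B (MulOpposite.op (dualApply φ x)) • (L.d p (p + 1)).hom l =
          (L.d r (p + 1)).hom ((elementary n l φ).eval hr' x) := by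
      rintro r rfl hr'
      rw [eval_elementary h, map_smul]
    exact key _ hp''.symm _
  · rw [eval_elementary_ne hi hp, zero_add,
      eval_elementary_ne (p' := p' - 1) (p := p) _ (by omega), map_zero, zero_add]
    by_cases hp' : p' = p
    · subst hp'
      obtain rfl : i = -(q + 1) := by omega
      rw [eval_elementary (by omega), dualApply_d]
      have key : ∀ (r : ℤ) (hr : r = -q) (hr' : r + n = p'),
          p'.negOnePow • inclB A B (MulOpposite.op ((q + 1).negOnePow •
            dualApply φ ((Q.d (-(q + 1)) (-q)).hom x))) • l =
          n'.negOnePow • (elementary n l φ).eval hr' ((Q.d (-(q + 1)) r).hom x) := by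
        rintro r rfl hr'
        rw [eval_elementary h]
        have : n' = p' + (q + 1) := by omega
        rw [this, Int.negOnePow_add p' (q + 1), mul_smul]
        refine congrArg (fun y : L.X p' => p'.negOnePow • y) ?_
        obtain h1 | h1 := Int.units_eq_one_or (q + 1).negOnePow
        · rw [h1, one_smul, one_smul]
        · rw [h1, Units.neg_smul, one_smul, Units.neg_smul, one_smul, MulOpposite.op_neg, map_neg,
            neg_smul]
      exact key _ (by omega) _
    · rw [eval_elementary_ne hi hp', smul_zero, eval_elementary_ne _ hp', smul_zero]

lemma dualMap_d {n n' : ℤ} (hn : n + 1 = n') :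
    (tensorComplex L (dualComplex Q)).d n n' ≫ dualMap Q L n' =
      dualMap Q L n ≫ homRightD Q L n n' := by
  refine tensorComplex_hom_ext fun p q h l φ => ?_
  refine (congrArg (dualMap Q L n').hom (d_tens p q n n' _ _ h hn rfl rfl l φ)).trans ?_
  rw [map_add, hom_units_smul, dualMap_tens, dualMap_tens]
  refine (dualMap_d_tens hn h l φ).trans ?_
  exact congrArg (homRightD Q L n n').hom (dualMap_tens h l φ).symm

lemma zero_tens {P : CochainComplex (ModuleCat.{u} B) ℤ} {p q n : ℤ} (h : p + q = n) (y : P.X q) :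
    tens n h (0 : L.X p) y = 0 := by
  simpa using add_tens h (0 : L.X p) 0 y

lemma tens_zero {P : CochainComplex (ModuleCat.{u} B) ℤ} {p q n : ℤ} (h : p + q = n) (x : L.X p) :
    tens n h x (0 : P.X q) = 0 := by
  simpa using tens_add h x (0 : P.X q) 0

lemma tens_sum {P : CochainComplex (ModuleCat.{u} B) ℤ} {p q n : ℤ} (h : p + q = n) (x : L.X p)
    {ι : Type*} (s : Finset ι) (y : ι → P.X q) :
    tens n h x (∑ j ∈ s, y j) = ∑ j ∈ s, tens n h x (y j) := by
  classical
  induction s using Finset.induction_on with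
  | empty => rw [Finset.sum_empty, Finset.sum_empty, tens_zero]
  | insert i s hi ih => rw [Finset.sum_insert hi, Finset.sum_insert hi, tens_add, ih]

variable (Q) in
lemma exists_dualComplex_basis (q : ℤ) [Module.Finite Bᵐᵒᵖ (Q.X (-q))]
    [Module.Projective Bᵐᵒᵖ (Q.X (-q))] :
    ∃ (k : ℕ) (e : Fin k → Q.X (-q)) (e' : Fin k → (dualComplex Q).X q),
      (∀ x, x = ∑ j, MulOpposite.op (dualApply (e' j) x) • e j) ∧
        ∀ φ : (dualComplex Q).X q, φ = ∑ j, dualApply φ (e j) • e' j := by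
  obtain ⟨k, e, e', he⟩ := exists_dual_basis (Q.X (-q))
  exact ⟨k, e, e', he, fun φ => eq_sum_smul_dual he (dualApply φ)⟩

/-- The inverse sends `f` to the sum of the `f(e_j) ⊗ e'_j` over dual bases of the terms of `Q`.
Boundedness of `L` makes the sum over degrees finite, so that the product in the Hom complex causes
no discrepancy with the direct sum in the tensor product. -/
lemma isIso_dualMap [∀ i, Module.Finite Bᵐᵒᵖ (Q.X i)] [∀ i, Module.Projective Bᵐᵒᵖ (Q.X i)]
    (hL : ∃ a b : ℤ, L.IsStrictlyGE a ∧ L.IsStrictlyLE b) (n : ℤ) : IsIso (dualMap Q L n) := by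
  obtain ⟨a, b, _, _⟩ := hL
  have hL₀ : ∀ p, p ∉ Finset.Icc a b → ∀ l : L.X p, l = 0 := by
    intro p hp l
    refine eq_zero_of_isZero ?_ l
    rw [Finset.mem_Icc, not_and_or] at hp
    obtain hp | hp := hp
    · exact CochainComplex.isZero_of_isStrictlyGE L a _ (by omega)
    · exact CochainComplex.isZero_of_isStrictlyLE L b _ (by omega)
  choose k e e' he he' using exists_dualComplex_basis Q
  let β : ModuleCat.of A (HomRightTerm Q L n) ⟶ (tensorComplex L (dualComplex Q)).X n :=
    ModuleCat.ofHom
      { toFun := fun f => ∑ p ∈ Finset.Icc a b, ∑ j : Fin (k (n - p)),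
          tens n (by omega : p + (n - p) = n) (f.eval (by omega : -(n - p) + n = p) (e _ j)) (e' _ j)
        map_add' := fun f g =>
          (Finset.sum_congr rfl fun p _ => (Finset.sum_congr rfl fun j _ => by
            rw [HomRightTerm.eval_add, add_tens]; rfl).trans Finset.sum_add_distrib).trans
              Finset.sum_add_distrib
        map_smul' := fun c f =>
          (Finset.sum_congr rfl fun p _ => (Finset.sum_congr rfl fun j _ => by
            rw [HomRightTerm.eval_smul, smul_tens]; rfl).trans Finset.smul_sum.symm).trans
              Finset.smul_sum.symm }
  have hβ : ∀ f, β.hom f = ∑ p ∈ Finset.Icc a b, ∑ j : Fin (k (n - p)),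
      tens n (by omega : p + (n - p) = n) (f.eval (by omega : -(n - p) + n = p) (e _ j)) (e' _ j) := fun _ => rfl
  refine ⟨β, tensorComplex_hom_ext fun p q h l φ => ?_, ?_⟩
  · refine (congrArg β.hom (dualMap_tens h l φ)).trans ((hβ _).trans ?_)
    change _ = tens n h l φ
    by_cases hp : p ∈ Finset.Icc a b
    · rw [Finset.sum_eq_single_of_mem p hp]
      · obtain rfl : q = n - p := by omega
        have h₁ : ∀ j, tens n h ((elementary n l φ).eval (by omega : -(n - p) + n = p) (e _ j)) (e' _ j) =
            tens n h l (dualApply φ (e _ j) • (e' _ j)) :=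
          fun j => by rw [eval_elementary h, tens_balanced]
        refine (Finset.sum_congr rfl fun j _ => h₁ j).trans ?_
        rw [← tens_sum]
        exact congrArg (tens n h l) (he' _ φ).symm
      · intro p' _ hp'
        refine Finset.sum_eq_zero fun j _ => ?_
        rw [eval_elementary_ne _ hp', zero_tens]
    · obtain rfl := hL₀ p hp l
      rw [zero_tens]
      refine Finset.sum_eq_zero fun p' hp' => Finset.sum_eq_zero fun j _ => ?_
      rw [eval_elementary_ne _ (by rintro rfl; exact hp hp'), zero_tens]
  · refine ModuleCat.hom_ext (LinearMap.ext fun f => ?_)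
    refine (congrArg (dualMap Q L n).hom (hβ f)).trans ?_
    refine ((map_sum (dualMap Q L n).hom _ _).trans (Finset.sum_congr rfl fun p _ =>
      (map_sum (dualMap Q L n).hom _ _).trans
        (Finset.sum_congr rfl fun j _ => dualMap_tens _ _ _))).trans ?_
    refine HomRightTerm.ext_eval fun i p hi x => ?_
    refine (HomRightTerm.eval_sum _ _ hi x).trans ?_
    change _ = f.eval hi x
    by_cases hp : p ∈ Finset.Icc a b
    · rw [Finset.sum_eq_single_of_mem p hp]
      · obtain rfl : i = -(n - p) := by omega
        rw [HomRightTerm.eval_sum]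
        conv_rhs => rw [he _ x]
        rw [HomRightTerm.eval_map_sum]
        refine Finset.sum_congr rfl fun j _ => ?_
        rw [HomRightTerm.eval_map_smul, eval_elementary (by omega)]
      · intro p' _ hp'
        rw [HomRightTerm.eval_sum]
        exact Finset.sum_eq_zero fun j _ => eval_elementary_ne _ hp'.symm _ _ _
    · exact (hL₀ p hp _).trans (hL₀ p hp _).symm

end DualMap

/-! ### Null-homotopies and quasi-isomorphisms in terms of elements. -/

section NullHomotopic

variable {R : Type u} [Ring R]

lemma toHo_map_eq_zero_iff {K Y : CochainComplex (ModuleCat.{u} R) ℤ} (f : K ⟶ Y) :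
    (toHo R).map f = 0 ↔ ∃ γ : Cochain K Y (-1), δ (-1) 0 γ = Cochain.ofHom f := by
  rw [HomotopyCategory.quotient_map_eq_zero_iff]
  constructor
  · rintro ⟨h⟩
    obtain ⟨γ, hγ⟩ := Cochain.equivHomotopy _ _ h
    exact ⟨γ, by rw [hγ, Cochain.ofHom_zero, add_zero]⟩
  · rintro ⟨γ, hγ⟩
    exact ⟨(Cochain.equivHomotopy _ _).symm ⟨γ, by rw [hγ, Cochain.ofHom_zero, add_zero]⟩⟩

lemma toHo_map_cocycle_eq_zero_iff {K Y : CochainComplex (ModuleCat.{u} R) ℤ} (z : Cocycle K Y 0) :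
    (toHo R).map ((Cocycle.equivHom K Y).symm z) = 0 ↔ z ∈ coboundaries K Y 0 := by
  rw [toHo_map_eq_zero_iff, mem_coboundaries_iff z (-1) (by omega)]
  have : Cochain.ofHom ((Cocycle.equivHom K Y).symm z) = z.1 :=
    congrArg Subtype.val ((Cocycle.equivHom K Y).apply_symm_apply z)
  rw [this]

lemma toHo_map_unit_eq_zero_iff {Y : CochainComplex (ModuleCat.{u} R) ℤ} (f : unitComplex R ⟶ Y) :
    (toHo R).map f = 0 ↔
      ∃ z : Y.X (-1), (Y.d (-1) 0).hom z = (f.f 0).hom (unitElement R) := by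
  have hy : (Y.d 0 1).hom ((f.f 0).hom (unitElement R)) = 0 := by
    rw [d_hom_comm, unitComplex_d, map_zero]
  have hf : f = unitDesc _ hy := unit_hom_ext (unitDesc_unitElement _ _).symm
  have h := (toHo_map_cocycle_eq_zero_iff (elementCocycle _ hy)).trans
    (Cocycle.fromSingleMk_mem_coboundaries_iff (ofElement ((f.f 0).hom (unitElement R)))
      (zero_add 0) (0 + 1) rfl _ (-1) (by omega))
  refine Iff.trans ?_ (h.trans ?_)
  · exact (congrArg (fun g => (toHo R).map g = 0) hf).to_iff
  · constructor
    · rintro ⟨g, hg⟩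
      obtain ⟨z, rfl⟩ := ofElement_surjective g
      exact ⟨z, ofElement_injective ((ofElement_comp _ _).symm.trans hg)⟩
    · rintro ⟨z, hz⟩
      exact ⟨ofElement z, (ofElement_comp _ _).trans (congrArg _ hz)⟩

lemma isIso_Qh_map_shift {X Y : HoCat R} (f : X ⟶ Y) [IsIso (DerivedCategory.Qh.map f)] (n : ℤ) :
    IsIso (DerivedCategory.Qh.map (f⟦n⟧')) :=
  (NatIso.isIso_map_iff (DerivedCategory.Qh.commShiftIso n) f).2
    (Functor.map_isIso (shiftFunctor _ n) (DerivedCategory.Qh.map f))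

variable {Y Z : CochainComplex (ModuleCat.{u} R) ℤ} (f : Y ⟶ Z)
  [IsIso (DerivedCategory.Qh.map ((toHo R).map f))] {n m : ℤ}

include f

lemma exists_cycle_lift (hm : m + 1 = n) (z : Z.X n) (hz : (Z.d n (n + 1)).hom z = 0) :
    ∃ (y : Y.X n) (_ : (Y.d n (n + 1)).hom y = 0) (z' : Z.X m),
      z = (f.f n).hom y + (Z.d m n).hom z' := by
  have := isIso_Qh_map_shift ((toHo R).map f) n
  obtain ⟨φ, hφ⟩ := (bijective_of_isIso_Qh_map (((toHo R).map f)⟦n⟧') (K := unitComplex R)).2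
    (cycleHom z hz)
  obtain ⟨y, hy, rfl⟩ := cycleHom_surjective φ
  refine ⟨y, hy, ?_⟩
  have h := (cycleHom_comp y hy f).symm.trans hφ
  have h' := (cycleHom_eq_zero_iff (z - (f.f n).hom y) (by
    rw [map_sub, hz, d_hom_comm, hy, map_zero, sub_zero]) m hm).1 (by
      rw [cycleHom_sub _ _ hz (by rw [d_hom_comm, hy, map_zero]), h, sub_self])
  obtain ⟨z', hz'⟩ := h'
  exact ⟨z', by rw [hz']; abel⟩

lemma exists_boundary_lift (hm : m + 1 = n) (y : Y.X n) (hy : (Y.d n (n + 1)).hom y = 0)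
    (h : ∃ z : Z.X m, (Z.d m n).hom z = (f.f n).hom y) : ∃ y' : Y.X m, (Y.d m n).hom y' = y := by
  have := isIso_Qh_map_shift ((toHo R).map f) n
  rw [← cycleHom_eq_zero_iff y hy m hm]
  refine (bijective_of_isIso_Qh_map (((toHo R).map f)⟦n⟧') (K := unitComplex R)).1 ?_
  refine (cycleHom_comp y hy f).trans (Eq.trans ?_ zero_comp.symm)
  exact (cycleHom_eq_zero_iff _ _ m hm).2 h

end NullHomotopic

/-! ### The ring placed in an arbitrary degree and its tensor product with `L`. -/

section UnitAt

variable {A B : Type u} [Ring A] [Ring B]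

/-- The ring as a complex of modules concentrated in degree `q`. -/
def unitAt (B : Type u) [Ring B] (q : ℤ) : CochainComplex (ModuleCat.{u} B) ℤ :=
  (CochainComplex.singleFunctor (ModuleCat.{u} B) q).obj (ModuleCat.of B B)

/-- The identification of the nonzero term of `unitAt B q`. -/
def unitAtIso (q : ℤ) : (unitAt B q).X q ≅ ModuleCat.of B B :=
  HomologicalComplex.singleObjXSelf (ComplexShape.up ℤ) q (ModuleCat.of B B)

/-- The generator of `unitAt B q`. -/
def elementAt (B : Type u) [Ring B] (q : ℤ) : (unitAt B q).X q := (unitAtIso q).inv.hom (1 : B)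

lemma unitAtIso_inv_apply (q : ℤ) (b : B) : (unitAtIso q).inv.hom b = b • elementAt B q := by
  refine Eq.trans ?_ ((unitAtIso q).inv.hom.map_smul b (1 : B))
  exact congrArg (unitAtIso q).inv.hom (mul_one b).symm

lemma exists_smul_elementAt {q : ℤ} (y : (unitAt B q).X q) : ∃ b : B, y = b • elementAt B q := by
  refine ⟨((unitAtIso q).hom.hom y : B), ?_⟩
  rw [← unitAtIso_inv_apply]
  exact (congrArg (fun f => f.hom y) (unitAtIso q).hom_inv_id).symm

lemma isZero_unitAt_X {q n : ℤ} (h : n ≠ q) : IsZero ((unitAt B q).X n) :=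
  HomologicalComplex.isZero_single_obj_X _ _ _ _ h

lemma unitAt_d (q m n : ℤ) (x : (unitAt B q).X m) : ((unitAt B q).d m n).hom x = 0 := by
  have : (unitAt B q).d m n = 0 := HomologicalComplex.single_obj_d _ _ _ _ _
  rw [this]
  rfl

variable {L : CochainComplex (Bimod A B) ℤ}

/-- Tensors of this form are a submodule, and balancing moves every coefficient from `B` to `L`, so
this submodule contains all generators. -/
lemma exists_tens_elementAt {p q n : ℤ} (h : p + q = n) (z : (tensorComplex L (unitAt B q)).X n) :
    ∃ l : L.X p, z = tens n h l (elementAt B q) := by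
  let N : Submodule A ((tensorComplex L (unitAt B q)).X n) :=
    { carrier := {z | ∃ l : L.X p, z = tens n h l (elementAt B q)}
      add_mem' := by
        rintro _ _ ⟨l, rfl⟩ ⟨l', rfl⟩
        exact ⟨l + l', (add_tens _ _ _ _).symm⟩
      zero_mem' := ⟨0, (zero_tens _ _).symm⟩
      smul_mem' := by
        rintro a _ ⟨l, rfl⟩
        exact ⟨inclA A B a • l, (smul_tens _ _ _ _).symm⟩ }
  have : ModuleCat.ofHom N.mkQ = 0 := by
    refine tensorComplex_hom_ext fun p' q' h' l y => ?_
    refine (Submodule.Quotient.mk_eq_zero N).2 ?_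
    by_cases hq : q' = q
    · subst hq
      obtain rfl : p' = p := by omega
      obtain ⟨b, rfl⟩ := exists_smul_elementAt y
      exact ⟨_, (tens_balanced _ _ _ _).symm⟩
    · rw [eq_zero_of_isZero (isZero_unitAt_X hq) y, tens_zero]
      exact N.zero_mem
  exact (Submodule.Quotient.mk_eq_zero N).1 (congrArg (fun f => f.hom z) this)

/-- The action map `M ⊗_B B ⟶ M`. -/
def actionMap (M : Bimod A B) : tensorObj M (ModuleCat.of B B) ⟶ (toLeft A B).obj M :=
  tensorLift (Z := (toLeft A B).obj M) (M := M) (N := ModuleCat.of B B)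
    (fun l (b : B) => (inclB A B (MulOpposite.op b) • l : M))
    (fun l l' b => smul_add _ _ _)
    (fun l b b' => (congrArg (fun r => (r • l : M))
      ((congrArg (inclB A B) (MulOpposite.op_add b b')).trans (map_add _ _ _))).trans
        (add_smul _ _ l))
    (fun a l b => by
      change (inclB A B (MulOpposite.op b) • inclA A B a • l : M) =
        inclA A B a • inclB A B (MulOpposite.op b) • l
      rw [smul_smul, smul_smul, inclA_mul_inclB])
    (fun l b b' => by
      change (inclB A B (MulOpposite.op b') • inclB A B (MulOpposite.op b) • l : M) =
        inclB A B (MulOpposite.op (b * b')) • l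
      rw [smul_smul, ← map_mul]
      rfl)

lemma actionMap_tmul_one {M : Bimod A B} (l : M) :
    (actionMap M).hom (tmul (N := ModuleCat.of B B) l (1 : B)) = l := by
  change inclB A B 1 • l = l
  rw [map_one, one_smul]

/-- The coordinate of an element of `L ⊗_B B[-q]`. -/
def coordinate (L : CochainComplex (Bimod A B) ℤ) (q n p : ℤ) (h : p + q = n) :
    (tensorComplex L (unitAt B q)).X n ⟶ (toLeft A B).obj (L.X p) :=
  tensorDesc fun p' q' h' => if hq : q' = q then
    tensorMap (L.XIsoOfEq (show p' = p by omega)).hom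
      (((unitAt B q).XIsoOfEq hq).hom ≫ (unitAtIso q).hom) ≫ actionMap (L.X p)
  else 0

lemma coordinate_tens (q n p : ℤ) (h : p + q = n) (l : L.X p) :
    (coordinate L q n p h).hom (tens n h l (elementAt B q)) = l := by
  refine (tensorDesc_tens _ p q h l _).trans ?_
  rw [dif_pos rfl]
  refine (congrArg (actionMap (L.X p)).hom (tensorMap_tmul _ _ _ _)).trans ?_
  have h₁ : (((unitAt B q).XIsoOfEq rfl).hom ≫ (unitAtIso q).hom).hom (elementAt B q) = (1 : B) := by
    rw [HomologicalComplex.XIsoOfEq_rfl, Iso.refl_hom, Category.id_comp]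
    exact congrArg (fun f => f.hom (1 : B)) (unitAtIso q).inv_hom_id
  rw [h₁, HomologicalComplex.XIsoOfEq_rfl]
  exact actionMap_tmul_one l

lemma tens_elementAt_injective {p q n : ℤ} (h : p + q = n) {l l' : L.X p}
    (hl : tens n h l (elementAt B q) = tens n h l' (elementAt B q)) : l = l' :=
  (coordinate_tens q n p h l).symm.trans
    ((congrArg (coordinate L q n p h).hom hl).trans (coordinate_tens q n p h l'))

lemma d_tens_elementAt {p p' q n n' : ℤ} (h : p + q = n) (hp : p + 1 = p') (hn : n + 1 = n')
    (l : L.X p) :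
    ((tensorComplex L (unitAt B q)).d n n').hom (tens n h l (elementAt B q)) =
      tens n' (by omega) ((L.d p p').hom l) (elementAt B q) := by
  rw [d_tens p q n n' p' (q + 1) h hn hp rfl, unitAt_d, tens_zero, smul_zero, add_zero]

end UnitAt

/-! ### Maps from the dual complex to shifts of the ring are cycles of `Q`. -/

section EvalMap

variable {A B : Type u} [Ring A] [Ring B] {Q : CochainComplex (ModuleCat.{u} Bᵐᵒᵖ) ℤ}

/-- The evaluation at an element. -/
def evalHom {q : ℤ} (x : Q.X (-q)) : (dualComplex Q).X q ⟶ ModuleCat.of B B :=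
  ModuleCat.ofHom (X := (dualComplex Q).X q)
    { toFun := fun φ => dualApply φ x
      map_add' := fun _ _ => rfl
      map_smul' := fun _ _ => rfl }

lemma d_evalHom {q' q : ℤ} (x : Q.X (-q)) :
    (dualComplex Q).d q' q ≫ evalHom x = q.negOnePow • evalHom ((Q.d (-q) (-q')).hom x) := by
  obtain h | h := Int.units_eq_one_or q.negOnePow
  · refine ModuleCat.hom_ext (LinearMap.ext fun φ => (dualApply_d Q φ x).trans ?_)
    rw [h, one_smul, one_smul]
    rfl
  · refine ModuleCat.hom_ext (LinearMap.ext fun φ => (dualApply_d Q φ x).trans ?_)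
    rw [h, Units.neg_smul, one_smul, Units.neg_smul, one_smul]
    rfl

lemma evalHom_zero {q : ℤ} : evalHom (0 : Q.X (-q)) = 0 :=
  ModuleCat.hom_ext (LinearMap.ext fun φ => map_zero (dualApply φ))

/-- The cocycle on the dual complex given by a cycle. -/
def evalCocycle {q : ℤ} (x : Q.X (-q)) (q' : ℤ) (hq : q' + 1 = q)
    (hx : (Q.d (-q) (-q')).hom x = 0) : Cocycle (dualComplex Q) (unitAt B q) 0 :=
  Cocycle.toSingleMk (evalHom x) (add_zero q) q' hq (by
    rw [d_evalHom, hx, evalHom_zero, smul_zero])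

/-- The map from the dual complex to a shift of the ring given by a cycle. -/
def evalMap {q : ℤ} (x : Q.X (-q)) (q' : ℤ) (hq : q' + 1 = q) (hx : (Q.d (-q) (-q')).hom x = 0) :
    dualComplex Q ⟶ unitAt B q :=
  (Cocycle.equivHom _ _).symm (evalCocycle x q' hq hx)

lemma evalMap_f {q : ℤ} (x : Q.X (-q)) (q' : ℤ) (hq : q' + 1 = q)
    (hx : (Q.d (-q) (-q')).hom x = 0) (φ : (dualComplex Q).X q) :
    ((evalMap x q' hq hx).f q).hom φ = dualApply φ x • elementAt B q := by
  have h' : (evalMap x q' hq hx).f q = evalHom x ≫ (unitAtIso q).inv :=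
    Cochain.toSingleMk_v (evalHom x) (add_zero q)
  rw [h']
  exact unitAtIso_inv_apply q _

lemma toHo_map_evalMap_eq_zero {q : ℤ} (x : Q.X (-q)) (q' : ℤ) (hq : q' + 1 = q)
    (hx : (Q.d (-q) (-q')).hom x = 0) (y : Q.X (-(q + 1)))
    (hy : (Q.d (-(q + 1)) (-q)).hom y = x) : (toHo B).map (evalMap x q' hq hx) = 0 := by
  refine (toHo_map_cocycle_eq_zero_iff _).2
    ((Cocycle.toSingleMk_mem_coboundaries_iff _ _ _ _ _ (q + 1) rfl).2 ?_)
  refine ⟨(q + 1).negOnePow • evalHom y, ?_⟩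
  rw [Linear.comp_units_smul, d_evalHom, smul_smul, Int.units_mul_self, one_smul, hy]

variable [∀ i, Module.Finite Bᵐᵒᵖ (Q.X i)] [∀ i, Module.Projective Bᵐᵒᵖ (Q.X i)]

lemma eq_zero_of_evalHom_eq_zero {q : ℤ} {x : Q.X (-q)} (h : evalHom x = 0) : x = 0 := by
  obtain ⟨k, e, e', he, -⟩ := exists_dualComplex_basis Q q
  rw [he x]
  refine Finset.sum_eq_zero fun j _ => ?_
  have : dualApply (e' j) x = 0 := congrArg (fun f => f.hom (e' j)) h
  rw [this, MulOpposite.op_zero, zero_smul]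

/-- Reflexivity of finitely generated projective modules: a functional on the dual is evaluation at
the combination of the `e_j` with coefficients its values on the `e'_j`. -/
lemma evalHom_surjective {q : ℤ} (g : (dualComplex Q).X q ⟶ ModuleCat.of B B) :
    ∃ x : Q.X (-q), evalHom x = g := by
  obtain ⟨k, e, e', he, he'⟩ := exists_dualComplex_basis Q q
  refine ⟨∑ j, MulOpposite.op (show B from g.hom (e' j)) • e j, ?_⟩
  refine ModuleCat.hom_ext (LinearMap.ext fun φ => ?_)
  refine (map_sum (dualApply φ) _ _).trans (Eq.trans ?_ (congrArg g.hom (he' φ)).symm)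
  refine Eq.trans ?_ (map_sum g.hom _ _).symm
  refine Finset.sum_congr rfl fun j _ => ?_
  rw [map_smul, map_smul]
  rfl

lemma evalMap_surjective {q : ℤ} (g : dualComplex Q ⟶ unitAt B q) (q' : ℤ) (hq : q' + 1 = q) :
    ∃ (x : Q.X (-q)) (hx : (Q.d (-q) (-q')).hom x = 0), evalMap x q' hq hx = g := by
  obtain ⟨f, hf, h⟩ := Cocycle.toSingleMk_surjective (Cocycle.equivHom _ _ g) q (add_zero q) q' hq
  obtain ⟨x, rfl⟩ := evalHom_surjective f
  have hx : (Q.d (-q) (-q')).hom x = 0 := by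
    rw [d_evalHom, smul_eq_zero_iff_eq] at hf
    exact eq_zero_of_evalHom_eq_zero hf
  refine ⟨x, hx, ?_⟩
  exact (Cocycle.equivHom _ _).symm_apply_eq.2 h

end EvalMap

/-! ### The test map `w : A ⟶ L ⊗_B W` and its universality at the ring. -/

section DualUnit

variable {A B : Type u} [Ring A] [Ring B] {Q : CochainComplex (ModuleCat.{u} Bᵐᵒᵖ) ℤ}
  {L : CochainComplex (Bimod A B) ℤ}

/-- The element of `Hom_{Bᵒᵖ}(Q, L)` given by a morphism of complexes. -/
def homRightOf (f : Q ⟶ rightComplex L) : HomRightTerm Q L 0 := Cochain.ofHom f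

lemma homRightOf_eval (f : Q ⟶ rightComplex L) {i : ℤ} (x : Q.X i) :
    (homRightOf f).eval (add_zero i) x = (f.f i).hom x :=
  congrArg (fun g : Q.X i ⟶ (rightComplex L).X i => g.hom x) (Cochain.ofHom_v f i)

lemma smul_homRightOf (a : A) (f : Q ⟶ rightComplex L) :
    a • homRightOf f = homRightOf (f ≫ actHom L a) :=
  (Cochain.ofHom_comp f (actHom L a)).symm

lemma toHo_map_eq_zero_iff_homRightD (f : Q ⟶ rightComplex L) :
    (toHo Bᵐᵒᵖ).map f = 0 ↔ ∃ γ, (homRightD Q L (-1) 0).hom γ = homRightOf f :=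
  toHo_map_eq_zero_iff f

lemma dualMap_d_apply {n n' : ℤ} (hn : n + 1 = n')
    (z : (tensorComplex L (dualComplex Q)).X n) :
    (dualMap Q L n').hom (((tensorComplex L (dualComplex Q)).d n n').hom z) =
      (homRightD Q L n n').hom ((dualMap Q L n).hom z) :=
  congrArg (fun f => f.hom z) (dualMap_d hn)

lemma homRightD_homRightOf (f : Q ⟶ rightComplex L) :
    (homRightD Q L 0 1).hom (homRightOf f) = 0 := δ_ofHom f

variable (Q L) in
lemma exists_homRightOf_eq (f : HomRightTerm Q L 0) (hf : (homRightD Q L 0 1).hom f = 0) :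
    ∃ g : Q ⟶ rightComplex L, homRightOf g = f :=
  ⟨(Cocycle.equivHom _ _).symm (Cocycle.mk f.toCochain 1 (by omega) hf),
    congrArg Subtype.val ((Cocycle.equivHom _ _).apply_symm_apply
      (Cocycle.mk f.toCochain 1 (by omega) hf))⟩

section Bijective

variable (hφ : ∀ n, Function.Bijective (dualMap Q L n).hom)

include hφ

lemma exists_unit_to_tensor (ξ : Q ⟶ rightComplex L) :
    ∃ w : unitComplex A ⟶ tensorComplex L (dualComplex Q),
      (dualMap Q L 0).hom ((w.f 0).hom (unitElement A)) = homRightOf ξ := by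
  obtain ⟨z, hz⟩ := (hφ 0).2 (homRightOf ξ)
  have hz' : ((tensorComplex L (dualComplex Q)).d 0 1).hom z = 0 := by
    apply (hφ 1).1
    rw [dualMap_d_apply (by omega), hz, homRightD_homRightOf, map_zero]
  exact ⟨unitDesc z hz', (congrArg (dualMap Q L 0).hom (unitDesc_unitElement z hz')).trans hz⟩

variable {ξ : Q ⟶ rightComplex L} {w : unitComplex A ⟶ tensorComplex L (dualComplex Q)}
  (hw : (dualMap Q L 0).hom ((w.f 0).hom (unitElement A)) = homRightOf ξ)
  (hinj : ∀ a : A, (toHo Bᵐᵒᵖ).map (ξ ≫ actHom L a) = 0 → a = 0)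
  (hsurj : ∀ f : Q ⟶ rightComplex L, ∃ a : A, (toHo Bᵐᵒᵖ).map (f - ξ ≫ actHom L a) = 0)
  (hne : ∀ n : ℤ, n ≠ 0 → ∀ z : Cocycle Q (rightComplex L) n, z ∈ coboundaries _ _ n)

include hw hinj hsurj hne

/-- Under `dualMap` the target of `w` becomes `Hom(Q, L)`. The three hypotheses say that its
cohomology is `A` in degree `0`, generated by the class of `ξ`, and zero in the other degrees. -/
lemma isIso_Qh_map_unit_to_tensor : IsIso (DerivedCategory.Qh.map ((toHo A).map w)) := by
  refine isIso_Qh_map_of_bijective (X := unitHo A) _ fun n => ⟨?_, fun ψ => ?_⟩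
  · suffices h : ∀ φ : unitHo A ⟶ (unitHo A)⟦n⟧, φ ≫ ((toHo A).map w)⟦n⟧' = 0 → φ = 0 by
      intro φ φ' h'
      have h' : φ ≫ ((toHo A).map w)⟦n⟧' = φ' ≫ ((toHo A).map w)⟦n⟧' := h'
      rw [← sub_eq_zero, ← Preadditive.sub_comp] at h'
      exact sub_eq_zero.1 (h _ h')
    intro φ h
    by_cases hn : n = 0
    · subst hn
      obtain ⟨y, hy, rfl⟩ := cycleHom_surjective φ
      replace h := (cycleHom_comp y hy w).symm.trans h
      obtain ⟨z, hz⟩ := (cycleHom_eq_zero_iff _ _ (-1) (by omega)).1 h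
      obtain ⟨a, rfl⟩ := exists_smul_unitElement y
      have ha : a = 0 := by
        apply hinj
        refine (toHo_map_eq_zero_iff_homRightD _).2 ⟨(dualMap Q L (-1)).hom z, ?_⟩
        rw [← dualMap_d_apply (by omega), hz, map_smul, map_smul, ← smul_homRightOf]
        exact congrArg (a • ·) hw
      exact (cycleHom_eq_zero_iff _ _ (-1) (by omega)).2
        ⟨0, by rw [map_zero, ha, zero_smul]⟩
    · exact unitHo_hom_eq_zero (isZero_unitComplex_X hn) φ
  · obtain ⟨z, hz, rfl⟩ := cycleHom_surjective ψ
    by_cases hn : n = 0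
    · subst hn
      obtain ⟨g, hg⟩ := exists_homRightOf_eq Q L ((dualMap Q L 0).hom z)
        ((dualMap_d_apply (by omega) z).symm.trans
          ((congrArg (dualMap Q L 1).hom hz).trans (map_zero _)))
      obtain ⟨a, ha⟩ := hsurj g
      obtain ⟨γ, hγ⟩ := (toHo_map_eq_zero_iff_homRightD _).1 ha
      obtain ⟨z', rfl⟩ := (hφ (-1)).2 γ
      have hz' : z - (w.f 0).hom (a • unitElement A) =
          ((tensorComplex L (dualComplex Q)).d (-1) 0).hom z' := by
        apply (hφ 0).1
        refine Eq.trans ?_ (hγ.symm.trans (dualMap_d_apply (by omega) z').symm)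
        rw [map_sub, map_smul, map_smul, hw, ← hg, smul_homRightOf]
        exact (Cochain.ofHom_sub g (ξ ≫ actHom L a)).symm
      have hw' : ((tensorComplex L (dualComplex Q)).d 0 (0 + 1)).hom
          ((w.f 0).hom (a • unitElement A)) = 0 := by
        rw [d_hom_comm, unitComplex_d, map_zero]
      refine ⟨cycleHom (a • unitElement A) (unitComplex_d _ _ _), ?_⟩
      refine (cycleHom_comp _ _ w).trans ?_
      refine (sub_eq_zero.1 ((cycleHom_sub z _ hz hw').symm.trans ?_)).symm
      exact (cycleHom_eq_zero_iff _ _ (-1) (by omega)).2 ⟨z', hz'.symm⟩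
    · refine ⟨0, zero_comp.trans (Eq.symm ?_)⟩
      have h₀ : δ n (n + 1) ((dualMap Q L n).hom z : HomRightTerm Q L n).toCochain = 0 :=
        (dualMap_d_apply rfl z).symm.trans
          ((congrArg (dualMap Q L (n + 1)).hom hz).trans (map_zero _))
      obtain ⟨γ, hγ⟩ := (mem_coboundaries_iff _ (n - 1) (by omega)).1
        (hne n hn (Cocycle.mk _ (n + 1) rfl h₀))
      obtain ⟨z', hz'⟩ := (hφ (n - 1)).2 (show HomRightTerm Q L (n - 1) from γ)
      refine (cycleHom_eq_zero_iff _ _ (n - 1) (by omega)).2 ⟨z', (hφ n).1 ?_⟩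
      rw [dualMap_d_apply (by omega), hz']
      exact hγ

end Bijective

/-- Tensoring the evaluation at `x` with `L` amounts to evaluating the corresponding cochain at `x`.
Applied to the image of `w`, this produces the value of `ξ` at `x`. -/
lemma tensorFunctor_evalMap {q p n : ℤ} (h : p + q = n) (hp : -q + n = p) (x : Q.X (-q)) (q' : ℤ)
    (hq : q' + 1 = q) (hx : (Q.d (-q) (-q')).hom x = 0)
    (z : (tensorComplex L (dualComplex Q)).X n) :
    (((tensorFunctor L).map (evalMap x q' hq hx)).f n).hom z =
      tens n h (((dualMap Q L n).hom z : HomRightTerm Q L n).eval hp x) (elementAt B q) := by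
  let φ : ModuleCat.of A (HomRightTerm Q L n) ⟶ (tensorComplex L (unitAt B q)).X n :=
    ModuleCat.ofHom
      { toFun := fun f => tens n h (HomRightTerm.eval f hp x) (elementAt B q)
        map_add' := fun f g => add_tens h (HomRightTerm.eval f hp x) (HomRightTerm.eval g hp x) _
        map_smul' := fun a f =>
          (congrArg (fun l => tens n h l (elementAt B q)) (HomRightTerm.eval_smul a f hp x)).trans
            (smul_tens h a _ _) }
  suffices h : ((tensorFunctor L).map (evalMap x q' hq hx)).f n = dualMap Q L n ≫ φ from
    congrArg (fun f => f.hom z) h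
  refine tensorComplex_hom_ext fun p₁ q₁ h₁ l y => ?_
  refine (tensorFunctor_map_tens (evalMap x q' hq hx) h₁ l y).trans ?_
  refine Eq.trans ?_ (congrArg φ.hom (dualMap_tens h₁ l y)).symm
  change _ = tens n h ((elementary n l y).eval hp x) (elementAt B q)
  by_cases hq₁ : q₁ = q
  · subst hq₁
    obtain rfl : p₁ = p := by omega
    rw [evalMap_f, ← tens_balanced, eval_elementary h]
  · rw [eval_elementary_ne hp (by omega), zero_tens]
    rw [eq_zero_of_isZero (isZero_unitAt_X hq₁) (((evalMap x q' hq hx).f q₁).hom y), tens_zero]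

variable [∀ i, Module.Finite Bᵐᵒᵖ (Q.X i)] [∀ i, Module.Projective Bᵐᵒᵖ (Q.X i)]

/-- Maps from the dual of `Q` to the ring in degree `q` are cohomology classes of `Q` in degree
`-q`, and maps from `A` to `L ⊗ B[-q]` are those of `L`. The Yoneda map is the one induced by `ξ`,
so it is bijective because `ξ` is a quasi-isomorphism; homothety plays no role here. -/
lemma yonedaMap_unitAt_bijective {ξ : Q ⟶ rightComplex L}
    [IsIso (DerivedCategory.Qh.map ((toHo Bᵐᵒᵖ).map ξ))]
    {w : unitComplex A ⟶ tensorComplex L (dualComplex Q)}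
    (hw : (dualMap Q L 0).hom ((w.f 0).hom (unitElement A)) = homRightOf ξ) (q : ℤ) :
    Function.Bijective (yonedaMap (tensorFunctorHo L) (W := (toHo B).obj (dualComplex Q))
      (a := unitHo A) ((toHo A).map w) ((toHo B).obj (unitAt B q))) := by
  let G (x : Q.X (-q)) (hx : (Q.d (-q) (-(q - 1))).hom x = 0) :
      unitComplex A ⟶ tensorComplex L (unitAt B q) :=
    w ≫ (tensorFunctor L).map (evalMap x (q - 1) (by omega) hx)
  have key : ∀ (x : Q.X (-q)) (hx : (Q.d (-q) (-(q - 1))).hom x = 0),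
      ((G x hx).f 0).hom (unitElement A) =
        tens 0 (by omega) ((ξ.f (-q)).hom x : L.X (-q)) (elementAt B q) := by
    intro x hx
    refine (tensorFunctor_evalMap (n := 0) (p := -q) (by omega) (by omega) x (q - 1) (by omega) hx
      ((w.f 0).hom (unitElement A))).trans ?_
    rw [hw, homRightOf_eval]
  have hmap : ∀ (g : dualComplex Q ⟶ unitAt B q),
      yonedaMap (tensorFunctorHo L) (W := (toHo B).obj (dualComplex Q))
        (a := unitHo A) ((toHo A).map w) ((toHo B).obj (unitAt B q)) ((toHo B).map g) =
        (toHo A).map (w ≫ (tensorFunctor L).map g) := fun g =>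
    ((toHo A).map_comp w ((tensorFunctor L).map g)).symm
  -- The degrees `-(q - 1)` and `-q + 1` agree only propositionally, hence the transport.
  have hd : ∀ (x : Q.X (-q)) (m : ℤ) (_ : (Q.d (-q) (-(q - 1))).hom x = 0),
      m = -(q - 1) → (Q.d (-q) m).hom x = 0 := by
    rintro x m hx rfl
    exact hx
  constructor
  · refine yonedaMap_injective _ _ fun g hg => ?_
    obtain ⟨g, rfl⟩ := (toHo B).map_surjective g
    obtain ⟨x, hx, rfl⟩ := evalMap_surjective g (q - 1) (by omega)
    have hg' : (toHo A).map (G x hx) = 0 := (hmap _).symm.trans hg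
    obtain ⟨z, hz⟩ := (toHo_map_unit_eq_zero_iff (G x hx)).1 hg'
    rw [key] at hz
    obtain ⟨l, rfl⟩ := exists_tens_elementAt (show -(q + 1) + q = -1 by omega) z
    have hl := (d_tens_elementAt (show -(q + 1) + q = -1 by omega) (show -(q + 1) + 1 = -q by omega)
      (show (-1 : ℤ) + 1 = 0 by omega) l).symm.trans hz
    have hl' := tens_elementAt_injective _ hl
    obtain ⟨y, hy⟩ := exists_boundary_lift ξ (show -(q + 1) + 1 = -q by omega) x
      (hd x _ hx (by omega)) ⟨l, hl'⟩
    exact toHo_map_evalMap_eq_zero x (q - 1) _ hx y hy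
  · intro ψ
    obtain ⟨f, rfl⟩ : ∃ f : unitComplex A ⟶ tensorComplex L (unitAt B q), (toHo A).map f = ψ :=
      (toHo A).map_surjective ψ
    have hf : ((tensorComplex L (unitAt B q)).d 0 1).hom ((f.f 0).hom (unitElement A)) = 0 := by
      rw [d_hom_comm, unitComplex_d, map_zero]
    obtain ⟨l, hl⟩ := exists_tens_elementAt (show -q + q = 0 by omega)
      ((f.f 0).hom (unitElement A))
    rw [hl, d_tens_elementAt (show -q + q = 0 by omega) (rfl : -q + 1 = -q + 1) (by omega)] at hf
    have hl' : (L.d (-q) (-q + 1)).hom l = 0 :=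
      tens_elementAt_injective _ (hf.trans (zero_tens _ _).symm)
    obtain ⟨x, hx, l', h⟩ := exists_cycle_lift ξ (show -(q + 1) + 1 = -q by omega) l hl'
    have hd' : ∀ (m : ℤ), m = -q + 1 → (Q.d (-q) m).hom x = 0 := by
      rintro m rfl
      exact hx
    have hx' := hd' (-(q - 1)) (by omega)
    refine ⟨(toHo B).map (evalMap x (q - 1) (by omega) hx'), (hmap _).trans ?_⟩
    have h₁ : (toHo A).map (f - G x hx') = 0 := by
      refine (toHo_map_unit_eq_zero_iff _).2 ⟨tens (-1) (by omega) l' (elementAt B q), ?_⟩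
      rw [d_tens_elementAt (show -(q + 1) + q = -1 by omega) (show -(q + 1) + 1 = -q by omega)
        (show (-1 : ℤ) + 1 = 0 by omega) l']
      refine Eq.trans ?_ (congrArg₂ (· - ·) hl.symm (key x hx').symm)
      have aux : ∀ (l y z : L.X (-q)), l = y + z →
          tens 0 (show -q + q = 0 by omega) z (elementAt B q) =
            tens 0 (show -q + q = 0 by omega) l (elementAt B q) -
              tens 0 (show -q + q = 0 by omega) y (elementAt B q) := by
        rintro _ y z rfl
        rw [add_tens, add_sub_cancel_left]
      exact aux _ _ _ h
    exact (sub_eq_zero.1 ((toHo A).map_sub.symm.trans h₁)).symm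

lemma yonedaLocal_dual_unit {ξ : Q ⟶ rightComplex L}
    [IsIso (DerivedCategory.Qh.map ((toHo Bᵐᵒᵖ).map ξ))]
    {w : unitComplex A ⟶ tensorComplex L (dualComplex Q)}
    (hw : (dualMap Q L 0).hom ((w.f 0).hom (unitElement A)) = homRightOf ξ) :
    yonedaLocal (tensorFunctorHo L) (W := (toHo B).obj (dualComplex Q)) (a := unitHo A)
      ((toHo A).map w) (unitHo B) := fun n =>
  yonedaMap_bijective_of_iso _ _
    (((HomotopyCategory.singleFunctors (ModuleCat.{u} B)).shiftIso n (-n) 0 (by omega)).app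
      (ModuleCat.of B B))
    (yonedaMap_unitAt_bijective hw (-n))

end DualUnit

/-! ### Realising derived morphisms out of K-projective complexes. -/

section Lifting

variable {R : Type u} [Ring R]

lemma exists_Qh_map_eq {K Y : CochainComplex (ModuleCat.{u} R) ℤ} [K.IsKProjective]
    (φ : DerivedCategory.Qh.obj ((toHo R).obj K) ⟶ DerivedCategory.Qh.obj ((toHo R).obj Y)) :
    ∃ f : K ⟶ Y, DerivedCategory.Qh.map ((toHo R).map f) = φ := by
  obtain ⟨g, hg⟩ := (CochainComplex.IsKProjective.Qh_map_bijective K ((toHo R).obj Y)).2 φ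
  obtain ⟨f, rfl⟩ : ∃ f : K ⟶ Y, (toHo R).map f = g := (toHo R).map_surjective g
  exact ⟨f, hg⟩

lemma exists_quasiIso_of_derivedIso {K Y : CochainComplex (ModuleCat.{u} R) ℤ} [K.IsKProjective]
    (h : DerivedIso K Y) : ∃ f : K ⟶ Y, IsIso (DerivedCategory.Qh.map ((toHo R).map f)) := by
  obtain ⟨e⟩ := h
  let e' : DerivedCategory.Qh.obj ((toHo R).obj K) ≅ DerivedCategory.Qh.obj ((toHo R).obj Y) := e
  obtain ⟨f, hf⟩ := exists_Qh_map_eq e'.hom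
  exact ⟨f, hf ▸ e'.isIso_hom⟩

lemma toHo_map_eq_of_Qh {K Y : CochainComplex (ModuleCat.{u} R) ℤ} [K.IsKProjective] {f g : K ⟶ Y}
    (h : DerivedCategory.Qh.map ((toHo R).map f) = DerivedCategory.Qh.map ((toHo R).map g)) :
    (toHo R).map f = (toHo R).map g :=
  (CochainComplex.IsKProjective.Qh_map_bijective K ((toHo R).obj Y)).1 h

lemma StronglyFinitelyPresented.exists_resolution {Y : CochainComplex (ModuleCat.{u} R) ℤ}
    (h : StronglyFinitelyPresented Y) :
    ∃ (K : CochainComplex (ModuleCat.{u} R) ℤ) (n : ℤ) (f : K ⟶ Y), K.IsStrictlyLE n ∧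
      (∀ m, Module.Finite R (K.X m)) ∧ (∀ m, Module.Projective R (K.X m)) ∧ K.IsKProjective ∧
      IsIso (DerivedCategory.Qh.map ((toHo R).map f)) := by
  obtain ⟨K, ⟨n, hn⟩, hK, e⟩ := h
  have (m : ℤ) : Projective (K.X m) :=
    have := (hK m).2
    (IsProjective.iff_projective (R := R) (K.X m)).1 inferInstance
  have : K.IsKProjective := CochainComplex.isKProjective_of_projective K n
  obtain ⟨f, hf⟩ := exists_quasiIso_of_derivedIso e
  exact ⟨K, n, f, hn, fun m => (hK m).1, fun m => (hK m).2, this, hf⟩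

end Lifting

/-! ### The test maps attached to a pseudo-dualizing complex. -/

section Homothety

variable {A B : Type u} [Ring A] [Ring B] {L : CochainComplex (Bimod A B) ℤ}

/-- The endomorphism of the complex `L` of left `A`-modules given by `b`. -/
def actRight (L : CochainComplex (Bimod A B) ℤ) (b : B) : leftComplex L ⟶ leftComplex L :=
  actB L (MulOpposite.op b)

lemma bijective_Qh_map_actRight (hL : IsPseudoDualizing L) :
    Function.Bijective fun b : B => DerivedCategory.Qh.map ((toHo A).map (actRight L b)) :=
  hL.homothety_right_zero.comp MulOpposite.opEquiv.bijective

lemma bijective_Qh_map_actHom (hL : IsPseudoDualizing L) :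
    Function.Bijective fun a : A => DerivedCategory.Qh.map ((toHo Bᵐᵒᵖ).map (actHom L a)) :=
  hL.homothety_left_zero

/-- A morphism in the derived category to a shift of `Y` vanishes if its source is isomorphic to
`Y` and `Y` has no self-extensions in that degree. -/
lemma eq_zero_of_forall_Q {R : Type u} [Ring R] {Y : CochainComplex (ModuleCat.{u} R) ℤ} {n : ℤ}
    (h : ∀ f : DerivedCategory.Q.obj Y ⟶ (DerivedCategory.Q.obj Y)⟦n⟧, f = 0)
    {X X' : DerivedCategory (ModuleCat.{u} R)} (e : DerivedCategory.Qh.obj ((toHo R).obj Y) ≅ X)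
    (e' : X' ≅ (DerivedCategory.Qh.obj ((toHo R).obj Y))⟦n⟧) (φ : X ⟶ X') : φ = 0 := by
  rw [← cancel_epi e.hom, ← cancel_mono e'.hom, comp_zero, zero_comp]
  exact h _

/-- A resolution `K` of `L` by finitely generated projective left modules turns maps `K → L ⊗ B[m]`
into self-extensions of `L` over `A`. The Yoneda map at the ring is then the right homothety. -/
lemma exists_left_data (hL : IsPseudoDualizing L) :
    ∃ (K : CochainComplex (ModuleCat.{u} A) ℤ) (n : ℤ) (t : K ⟶ tensorComplex L (unitComplex B)),
      K.IsStrictlyLE n ∧ (∀ m, Module.Finite A (K.X m)) ∧ K.IsKProjective ∧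
      IsIso (DerivedCategory.Qh.map ((toHo A).map t)) ∧
      yonedaLocal (tensorFunctorHo L) (W := unitHo B) (a := (toHo A).obj K) ((toHo A).map t)
        (unitHo B) := by
  obtain ⟨K, n, f, hn, hK, -, hK', hf⟩ := hL.sfp_left.exists_resolution
  have hu : IsIso (toTensorUnit L) := (tensorUnitIso L).isIso_hom
  have hu' : IsIso (DerivedCategory.Qh.map ((toHo A).map (toTensorUnit L))) := by
    have : IsIso ((toHo A).map (toTensorUnit L)) := Functor.map_isIso _ _
    exact Functor.map_isIso _ _
  have hcomp : ∀ {X Y Z : CochainComplex (ModuleCat.{u} A) ℤ} (f : X ⟶ Y) (g : Y ⟶ Z),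
      DerivedCategory.Qh.map ((toHo A).map (f ≫ g)) =
        DerivedCategory.Qh.map ((toHo A).map f) ≫ DerivedCategory.Qh.map ((toHo A).map g) :=
    fun f g => by rw [CategoryTheory.Functor.map_comp, CategoryTheory.Functor.map_comp]
  refine ⟨K, n, f ≫ toTensorUnit L, hn, hK, hK', ?_, fun m => ?_⟩
  · rw [hcomp]
    exact IsIso.comp_isIso
  have hmap : ∀ b, (toHo A).map (f ≫ toTensorUnit L) ≫ (tensorFunctorHo L).map
      ((toHo B).map (rightMul b)) = (toHo A).map ((f ≫ actRight L b) ≫ toTensorUnit L) := fun b => by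
    refine ((toHo A).map_comp _ ((tensorFunctor L).map (rightMul b))).symm.trans ?_
    refine congrArg (toHo A).map ?_
    refine (Category.assoc f (toTensorUnit L) ((tensorFunctor L).map (rightMul b))).trans ?_
    refine Eq.trans ?_ (Category.assoc f (actRight L b) (toTensorUnit L)).symm
    exact congrArg (f ≫ ·) (toTensorUnit_rightMul L b)
  -- In degree `0` the Yoneda map sends right multiplication by `b` to the action of `b`, so the
  -- homothety isomorphism gives bijectivity. In other degrees both sides vanish.
  by_cases hm : m = 0
  · subst hm
    refine yonedaMap_bijective_of_iso _ _ ((shiftFunctorZero (HoCat B) ℤ).app (unitHo B)) ⟨?_, ?_⟩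
    · refine yonedaMap_injective _ _ fun g hg => ?_
      obtain ⟨g, rfl⟩ : ∃ g' : unitComplex B ⟶ unitComplex B, (toHo B).map g' = g :=
        (toHo B).map_surjective g
      obtain ⟨b, rfl⟩ := rightMul_surjective g
      have h := congrArg DerivedCategory.Qh.map ((hmap b).symm.trans hg)
      rw [hcomp, hcomp] at h
      have h₁ : DerivedCategory.Qh.map ((toHo A).map f) ≫
          DerivedCategory.Qh.map ((toHo A).map (actRight L b)) = 0 := by
        rw [← cancel_mono (DerivedCategory.Qh.map ((toHo A).map (toTensorUnit L))), zero_comp]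
        exact h.trans (CategoryTheory.Functor.map_zero _ _ _)
      have h₂ : DerivedCategory.Qh.map ((toHo A).map (actRight L b)) = 0 := by
        rw [← cancel_epi (DerivedCategory.Qh.map ((toHo A).map f)), comp_zero]
        exact h₁
      have h₃ : actRight L 0 = 0 := map_zero (actB L)
      have hb : b = 0 := by
        apply (bijective_Qh_map_actRight hL).1
        refine h₂.trans ?_
        change _ = DerivedCategory.Qh.map ((toHo A).map (actRight L 0))
        rw [h₃, CategoryTheory.Functor.map_zero, CategoryTheory.Functor.map_zero]
      have h₄ : rightMul b = 0 := by
        refine unit_hom_ext ((rightMul_unitElement b).trans ?_)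
        rw [hb, zero_smul]
        rfl
      rw [h₄, CategoryTheory.Functor.map_zero]
      rfl
    · intro ψ
      obtain ⟨g, rfl⟩ : ∃ g : K ⟶ tensorComplex L (unitComplex B), (toHo A).map g = ψ :=
        (toHo A).map_surjective ψ
      obtain ⟨b, hb⟩ := (bijective_Qh_map_actRight hL).2
        (inv (DerivedCategory.Qh.map ((toHo A).map f)) ≫ DerivedCategory.Qh.map ((toHo A).map g) ≫
          inv (DerivedCategory.Qh.map ((toHo A).map (toTensorUnit L))))
      refine ⟨(toHo B).map (rightMul b), (hmap b).trans (toHo_map_eq_of_Qh ?_)⟩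
      have hb' : DerivedCategory.Qh.map ((toHo A).map (actRight L b)) = _ := hb
      rw [hcomp, hcomp, hb', IsIso.hom_inv_id_assoc, Category.assoc, IsIso.inv_hom_id,
        Category.comp_id]
  · have h₁ : ∀ φ : unitHo B ⟶ (unitHo B)⟦m⟧, φ = 0 := fun φ =>
      unitHo_hom_eq_zero (isZero_unitComplex_X hm) φ
    refine ⟨fun φ φ' _ => (h₁ φ).trans (h₁ φ').symm, fun ψ => ⟨0, ?_⟩⟩
    refine (yonedaMap_zero _ _).trans ?_
    refine ((CochainComplex.IsKProjective.Qh_map_bijective K _).1 ?_).symm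
    refine Eq.trans ?_ (CategoryTheory.Functor.map_zero _ _ _).symm
    let u : DerivedCategory.Qh.obj ((toHo A).obj (leftComplex L)) ≅
        DerivedCategory.Qh.obj ((tensorFunctorHo L).obj (unitHo B)) :=
      DerivedCategory.Qh.mapIso ((toHo A).mapIso (tensorUnitIso L))
    refine eq_zero_of_forall_Q (hL.homothety_right_ne_zero m hm)
      (asIso (DerivedCategory.Qh.map ((toHo A).map f))).symm ?_ _
    exact DerivedCategory.Qh.mapIso (((tensorFunctorHo L).commShiftIso m).app (unitHo B)) ≪≫
      (DerivedCategory.Qh.commShiftIso m).app ((tensorFunctorHo L).obj (unitHo B)) ≪≫ (shiftFunctor _ m).mapIso u.symm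

instance (Q : CochainComplex (ModuleCat.{u} Bᵐᵒᵖ) ℤ) [∀ i, Module.Finite Bᵐᵒᵖ (Q.X i)]
    [∀ i, Module.Projective Bᵐᵒᵖ (Q.X i)] (q : ℤ) : Module.Finite B ((dualComplex Q).X q) := by
  obtain ⟨k, e, e', -, h⟩ := exists_dualComplex_basis Q q
  have h' : Submodule.span B (Set.range e') = ⊤ := eq_top_iff.2 fun φ _ => by
    rw [h φ]
    exact Submodule.sum_mem _ fun j _ => Submodule.smul_mem _ _ (Submodule.subset_span ⟨j, rfl⟩)
  exact ⟨h' ▸ Submodule.fg_span (Set.finite_range e')⟩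

instance (Q : CochainComplex (ModuleCat.{u} Bᵐᵒᵖ) ℤ) [∀ i, Module.Finite Bᵐᵒᵖ (Q.X i)]
    [∀ i, Module.Projective Bᵐᵒᵖ (Q.X i)] (q : ℤ) : Projective ((dualComplex Q).X q) := by
  obtain ⟨k, e, e', -, h⟩ := exists_dualComplex_basis Q q
  have : Module.Projective B ((dualComplex Q).X q) := by
    let i : (dualComplex Q).X q →ₗ[B] (Fin k → B) :=
      { toFun := fun φ j => dualApply φ (e j)
        map_add' := fun φ ψ => rfl
        map_smul' := fun b φ => rfl }
    refine Module.Projective.of_split i (Fintype.linearCombination B e') ?_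
    refine LinearMap.ext fun φ => ?_
    exact (Fintype.linearCombination_apply B e' _).trans (h φ).symm
  exact (IsProjective.iff_projective (R := B) ((dualComplex Q).X q)).1 inferInstance

lemma dualComplex_isStrictlyGE (Q : CochainComplex (ModuleCat.{u} Bᵐᵒᵖ) ℤ) (n : ℤ)
    [Q.IsStrictlyLE n] : (dualComplex Q).IsStrictlyGE (-n) := by
  rw [CochainComplex.isStrictlyGE_iff]
  intro i hi
  have : Subsingleton (Q.X (-i)) :=
    ModuleCat.subsingleton_of_isZero (CochainComplex.isZero_of_isStrictlyLE Q n (-i) (by omega))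
  have : Subsingleton ((dualComplex Q).X i) := ⟨fun φ ψ =>
    LinearMap.ext fun x => by
      rw [Subsingleton.elim x 0]
      exact (map_zero (dualApply φ)).trans (map_zero (dualApply ψ)).symm⟩
  exact ModuleCat.isZero_of_subsingleton _

/-- `W` is the dual of a resolution `ξ : Q → L` by finitely generated projective right modules,
bounded below because `Q` is bounded above. Since `L ⊗ W` is `Hom(Q, L)`, it computes the
self-extensions of `L` over `Bᵒᵖ`, which the left homothety identifies with `A`; `w` is the map
corresponding to `ξ`. -/
lemma exists_right_data (hL : IsPseudoDualizing L) :
    ∃ (W : CochainComplex (ModuleCat.{u} B) ℤ) (n : ℤ) (w : unitComplex A ⟶ tensorComplex L W),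
      W.IsStrictlyGE n ∧ (∀ m, Module.Finite B (W.X m)) ∧ (∀ m, Projective (W.X m)) ∧
      IsIso (DerivedCategory.Qh.map ((toHo A).map w)) ∧
      yonedaLocal (tensorFunctorHo L) (W := (toHo B).obj W) (a := unitHo A) ((toHo A).map w)
        (unitHo B) := by
  obtain ⟨Q, n, ξ, hn, _, _, hQ, hξ⟩ := hL.sfp_right.exists_resolution
  have hφ : ∀ n, Function.Bijective (dualMap Q L n).hom := fun n => by
    have := isIso_dualMap (Q := Q) hL.finite n
    exact ((asIso (dualMap Q L n)).toLinearEquiv).bijective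
  obtain ⟨w, hw⟩ := exists_unit_to_tensor hφ ξ
  have hcomp : ∀ {X Y Z : CochainComplex (ModuleCat.{u} Bᵐᵒᵖ) ℤ} (f : X ⟶ Y) (g : Y ⟶ Z),
      DerivedCategory.Qh.map ((toHo Bᵐᵒᵖ).map (f ≫ g)) =
        DerivedCategory.Qh.map ((toHo Bᵐᵒᵖ).map f) ≫
          DerivedCategory.Qh.map ((toHo Bᵐᵒᵖ).map g) :=
    fun f g => by rw [CategoryTheory.Functor.map_comp, CategoryTheory.Functor.map_comp]
  have h₀ : actHom L 0 = 0 := map_zero (actA L)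
  refine ⟨dualComplex Q, -n, w, dualComplex_isStrictlyGE Q n, inferInstance, inferInstance,
    isIso_Qh_map_unit_to_tensor hφ hw (fun a ha => ?_) (fun f => ?_) (fun m hm z => ?_),
    yonedaLocal_dual_unit hw⟩
  · apply (bijective_Qh_map_actHom hL).1
    change _ = DerivedCategory.Qh.map ((toHo Bᵐᵒᵖ).map (actHom L 0))
    rw [h₀, CategoryTheory.Functor.map_zero, CategoryTheory.Functor.map_zero,
      ← cancel_epi (DerivedCategory.Qh.map ((toHo Bᵐᵒᵖ).map ξ)), comp_zero]
    refine (hcomp _ _).symm.trans ?_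
    rw [ha, CategoryTheory.Functor.map_zero]
  · obtain ⟨a, ha⟩ := (bijective_Qh_map_actHom hL).2
      (inv (DerivedCategory.Qh.map ((toHo Bᵐᵒᵖ).map ξ)) ≫
        DerivedCategory.Qh.map ((toHo Bᵐᵒᵖ).map f))
    have ha' : DerivedCategory.Qh.map ((toHo Bᵐᵒᵖ).map (actHom L a)) = _ := ha
    refine ⟨a, (CategoryTheory.Functor.map_sub _).trans (sub_eq_zero.2 (toHo_map_eq_of_Qh ?_))⟩
    rw [hcomp, ha', IsIso.hom_inv_id_assoc]
  · rw [← CohomologyClass.toHom_mk_eq_zero_iff]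
    refine (CochainComplex.IsKProjective.Qh_map_bijective Q _).1 ?_
    refine Eq.trans ?_ (CategoryTheory.Functor.map_zero _ _ _).symm
    have h := eq_zero_of_forall_Q (hL.homothety_left_ne_zero m hm)
      (asIso (DerivedCategory.Qh.map ((toHo Bᵐᵒᵖ).map ξ))).symm
      (DerivedCategory.Qh.mapIso (((toHo Bᵐᵒᵖ).commShiftIso m).app (rightComplex L)) ≪≫
        (DerivedCategory.Qh.commShiftIso m).app ((toHo Bᵐᵒᵖ).obj (rightComplex L)))
      (DerivedCategory.Qh.map (CohomologyClass.toHom (CohomologyClass.mk z)))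
    exact h

end Homothety

/-! ### Projective and injective representatives with prescribed bounds. -/

section ProjectiveResolution

variable {R : Type u} [Ring R]

/-- The opposite of a complex, as a complex in the opposite category. -/
def opComplex (K : CochainComplex (ModuleCat.{u} R) ℤ) :
    CochainComplex (ModuleCat.{u} R)ᵒᵖ ℤ where
  X n := Opposite.op (K.X (-n))
  d m n := (K.d (-n) (-m)).op
  shape m n h := by
    rw [K.shape _ _ (fun h' => h (by simp at h' ⊢; omega)), op_zero]
  d_comp_d' i j k _ _ := by rw [← op_comp, K.d_comp_d, op_zero]

/-- The complex of modules given by a complex in the opposite category. -/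
def unopComplex (K : CochainComplex (ModuleCat.{u} R)ᵒᵖ ℤ) :
    CochainComplex (ModuleCat.{u} R) ℤ where
  X n := (K.X (-n)).unop
  d m n := (K.d (-n) (-m)).unop
  shape m n h := by
    rw [K.shape _ _ (fun h' => h (by simp at h' ⊢; omega)), unop_zero]
  d_comp_d' i j k _ _ := by rw [← unop_comp, K.d_comp_d, unop_zero]

/-- The morphism of complexes of modules given by a morphism in the opposite category. -/
def unopComplexMap {K K' : CochainComplex (ModuleCat.{u} R)ᵒᵖ ℤ} (f : K ⟶ K') :
    unopComplex K' ⟶ unopComplex K where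
  f n := (f.f (-n)).unop
  comm' i j _ := congrArg Quiver.Hom.unop (f.comm (-j) (-i)).symm

/-- A complex is isomorphic to the opposite of its opposite. -/
def unopOpComplex (K : CochainComplex (ModuleCat.{u} R) ℤ) : unopComplex (opComplex K) ≅ K :=
  HomologicalComplex.Hom.isoOfComponents (fun n => K.XIsoOfEq (neg_neg n)) (fun i j _ => by
    change _ ≫ K.d i j = K.d (- -i) (- -j) ≫ _
    rw [HomologicalComplex.XIsoOfEq_hom_comp_d, HomologicalComplex.d_comp_XIsoOfEq_hom])

lemma quasiIso_unopComplexMap {K K' : CochainComplex (ModuleCat.{u} R)ᵒᵖ ℤ} (f : K ⟶ K')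
    [QuasiIso f] : QuasiIso (unopComplexMap f) := by
  refine ⟨fun n => ?_⟩
  rw [quasiIsoAt_iff' _ (n - 1) n (n + 1) (by simp) (by simp)]
  have h : QuasiIsoAt f (-n) := inferInstance
  rw [quasiIsoAt_iff' _ (-(n + 1)) (-n) (-(n - 1)) (by simp; omega) (by simp; omega)] at h
  exact (ShortComplex.quasiIso_unopMap
    ((HomologicalComplex.shortComplexFunctor' _ _ (-(n + 1)) (-n) (-(n - 1))).map f))

/-- A complex of modules that vanishes above degree `n` has a resolution by a complex of projective
modules that vanishes above degree `n`. -/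
lemma exists_quasiIso_projective (K : CochainComplex (ModuleCat.{u} R) ℤ) (n : ℤ)
    [K.IsStrictlyLE n] :
    ∃ (P : CochainComplex (ModuleCat.{u} R) ℤ) (f : P ⟶ K),
      QuasiIso f ∧ (∀ m, Projective (P.X m)) ∧ P.IsStrictlyLE n := by
  have hK : (opComplex K).IsStrictlyGE (-n) := by
    rw [CochainComplex.isStrictlyGE_iff]
    exact fun i hi => (CochainComplex.isZero_of_isStrictlyLE K n (-i) (by omega)).op
  -- A projective resolution is an injective resolution in the opposite category.
  obtain ⟨J, i, hi, hJ, hJ'⟩ :=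
    CochainComplex.Plus.modelCategoryQuillen.exists_quasiIso_injective (opComplex K) (-n)
  have := quasiIso_unopComplexMap i
  refine ⟨unopComplex J, unopComplexMap i ≫ (unopOpComplex K).hom, inferInstance,
    fun m => Injective.projective_iff_injective_op.2 (hJ (-m)), ?_⟩
  rw [CochainComplex.isStrictlyLE_iff]
  exact fun i hi => (CochainComplex.isZero_of_isStrictlyGE J (-n) (-i) (by omega)).unop

lemma isIso_Qh_map_of_quasiIso {K Y : CochainComplex (ModuleCat.{u} R) ℤ} (f : K ⟶ Y)
    [QuasiIso f] : IsIso (DerivedCategory.Qh.map ((toHo R).map f)) :=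
  show IsIso (DerivedCategory.Q.map f) from inferInstance

/-- An object of the derived category concentrated in degrees at most `n` is represented by a
complex of projective modules that vanishes above degree `n`. -/
lemma exists_projective_representative (X : DerivedCategory (ModuleCat.{u} R)) (n : ℤ)
    [X.IsLE n] :
    ∃ P : CochainComplex (ModuleCat.{u} R) ℤ,
      (∀ m, Projective (P.X m)) ∧ P.IsStrictlyLE n ∧ Nonempty (DerivedCategory.Q.obj P ≅ X) := by
  obtain ⟨K, hK, ⟨e⟩⟩ := X.exists_iso_Q_obj_of_isLE n
  obtain ⟨P, f, hf, hP, hP'⟩ := exists_quasiIso_projective K n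
  exact ⟨P, hP, hP', ⟨asIso (DerivedCategory.Q.map f) ≪≫ e.symm⟩⟩

/-- An object of the derived category concentrated in degrees at least `n` is represented by a
complex of injective modules that vanishes below degree `n`. -/
lemma exists_injective_representative (X : DerivedCategory (ModuleCat.{u} R)) (n : ℤ)
    [X.IsGE n] :
    ∃ J : CochainComplex (ModuleCat.{u} R) ℤ,
      (∀ m, Injective (J.X m)) ∧ J.IsStrictlyGE n ∧ Nonempty (DerivedCategory.Q.obj J ≅ X) := by
  obtain ⟨K, hK, ⟨e⟩⟩ := X.exists_iso_Q_obj_of_isGE n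
  obtain ⟨J, f, hf, hJ, hJ'⟩ :=
    CochainComplex.Plus.modelCategoryQuillen.exists_quasiIso_injective K n
  exact ⟨J, hJ, hJ', ⟨(asIso (DerivedCategory.Q.map f)).symm ≪≫ e.symm⟩⟩

end ProjectiveResolution

/-! ### Degree bounds for Hom and tensor complexes. -/

section Degrees

variable {A B : Type u} [Ring A] [Ring B] {L : CochainComplex (Bimod A B) ℤ}

lemma isStrictlyGE_homComplex (J : CochainComplex (ModuleCat.{u} A) ℤ) (b c n : ℤ) (h : n + b = c)
    [L.IsStrictlyLE b] [J.IsStrictlyGE c] : (homComplex L J).IsStrictlyGE n := by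
  rw [CochainComplex.isStrictlyGE_iff]
  intro i hi
  rw [IsZero.iff_id_eq_zero]
  refine ModuleCat.hom_ext (LinearMap.ext fun f => homComplex_ext fun p m hm x => ?_)
  by_cases hp : p ≤ b
  · exact (eq_zero_of_isZero (CochainComplex.isZero_of_isStrictlyGE J c m (by omega)) _).trans
      (eq_zero_of_isZero (CochainComplex.isZero_of_isStrictlyGE J c m (by omega)) _).symm
  · rw [eq_zero_of_isZero (CochainComplex.isZero_of_isStrictlyLE L b p (by omega)) x]
    exact (map_zero ((toCochain _).v p m hm).hom).trans (map_zero ((toCochain _).v p m hm).hom).symm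

lemma isStrictlyLE_homComplex (J : CochainComplex (ModuleCat.{u} A) ℤ) (a c n : ℤ) (h : n + a = c)
    [L.IsStrictlyGE a] [J.IsStrictlyLE c] : (homComplex L J).IsStrictlyLE n := by
  rw [CochainComplex.isStrictlyLE_iff]
  intro i hi
  rw [IsZero.iff_id_eq_zero]
  refine ModuleCat.hom_ext (LinearMap.ext fun f => homComplex_ext fun p m hm x => ?_)
  by_cases hp : a ≤ p
  · exact (eq_zero_of_isZero (CochainComplex.isZero_of_isStrictlyLE J c m (by omega)) _).trans
      (eq_zero_of_isZero (CochainComplex.isZero_of_isStrictlyLE J c m (by omega)) _).symm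
  · rw [eq_zero_of_isZero (CochainComplex.isZero_of_isStrictlyGE L a p (by omega)) x]
    exact (map_zero ((toCochain _).v p m hm).hom).trans (map_zero ((toCochain _).v p m hm).hom).symm

lemma isStrictlyLE_tensorComplex (P : CochainComplex (ModuleCat.{u} B) ℤ) (b c n : ℤ)
    (h : b + c = n) [L.IsStrictlyLE b] [P.IsStrictlyLE c] :
    (tensorComplex L P).IsStrictlyLE n := by
  rw [CochainComplex.isStrictlyLE_iff]
  intro i hi
  rw [IsZero.iff_id_eq_zero]
  refine tensorComplex_hom_ext fun p q hpq x y => ?_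
  by_cases hp : p ≤ b
  · rw [eq_zero_of_isZero (CochainComplex.isZero_of_isStrictlyLE P c q (by omega)) y, tens_zero,
      map_zero, map_zero]
  · rw [eq_zero_of_isZero (CochainComplex.isZero_of_isStrictlyLE L b p (by omega)) x, zero_tens,
      map_zero, map_zero]

lemma isStrictlyGE_tensorComplex (P : CochainComplex (ModuleCat.{u} B) ℤ) (a c n : ℤ)
    (h : a + c = n) [L.IsStrictlyGE a] [P.IsStrictlyGE c] :
    (tensorComplex L P).IsStrictlyGE n := by
  rw [CochainComplex.isStrictlyGE_iff]
  intro i hi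
  rw [IsZero.iff_id_eq_zero]
  refine tensorComplex_hom_ext fun p q hpq x y => ?_
  by_cases hp : a ≤ p
  · rw [eq_zero_of_isZero (CochainComplex.isZero_of_isStrictlyGE P c q (by omega)) y, tens_zero,
      map_zero, map_zero]
  · rw [eq_zero_of_isZero (CochainComplex.isZero_of_isStrictlyGE L a p (by omega)) x, zero_tens,
      map_zero, map_zero]

end Degrees

section FiveLemma

open Pretriangulated

universe v₁ v₂ w₁ w₂

variable {C : Type w₁} {D : Type w₂} [Category.{v₁} C] [Category.{v₂} D] (F : C ⥤ D)
  [Preadditive C] [HasZeroObject C] [HasShift C ℤ] [∀ n : ℤ, (shiftFunctor C n).Additive]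
  [Pretriangulated C]
  [Preadditive D] [HasZeroObject D] [HasShift D ℤ] [∀ n : ℤ, (shiftFunctor D n).Additive]
  [Pretriangulated D] [F.CommShift ℤ] [F.IsTriangulated] {W : C} {a : D} (w : a ⟶ F.obj W)

/-- A five lemma in one fixed degree. The third vertex is controlled only in degrees `n` and `n -
1`, which is all that is known about the tail of a bounded above complex. -/
lemma yonedaMap_bijective_of_distinguished (T : Triangle C) (hT : T ∈ distTriang C) (n : ℤ)
    (h₁ : yonedaLocal F w T.obj₁) (h₃ : Function.Bijective (yonedaMap F w (T.obj₃⟦n⟧)))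
    (h₃' : Function.Bijective (yonedaMap F w (T.obj₃⟦n + (-1)⟧))) :
    Function.Bijective (yonedaMap F w (T.obj₂⟦n⟧)) := by
  have hT' := Triangle.shift_distinguished _ hT n
  refine ⟨yonedaMap_injective_of_distinguished F w _ hT' (h₁ n).1 h₃.1 ?_,
    yonedaMap_surjective_of_distinguished F w _ hT' (h₁ n).2 h₃.2 ?_⟩
  · exact (yonedaMap_bijective_of_iso F w ((shiftFunctorAdd C n (-1)).symm.app _) h₃').2
  · exact (yonedaMap_bijective_of_iso F w ((shiftFunctorAdd C n 1).symm.app _) (h₁ (n + 1))).1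

end FiveLemma

/-! ### Morphisms from bounded below to bounded above complexes. -/

section Vanishing

variable {R : Type u} [Ring R]

lemma toHo_hom_eq_zero {K Y : CochainComplex (ModuleCat.{u} R) ℤ} {X X' : HoCat R}
    (e : X ≅ (toHo R).obj K) (e' : X' ≅ (toHo R).obj Y)
    (h : ∀ p, IsZero (K.X p) ∨ IsZero (Y.X p)) (φ : X ⟶ X') : φ = 0 := by
  rw [← cancel_epi e.inv, ← cancel_mono e'.hom, comp_zero, zero_comp]
  obtain ⟨f, hf⟩ : ∃ f : K ⟶ Y, (toHo R).map f = (e.inv ≫ φ) ≫ e'.hom := (toHo R).map_surjective _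
  rw [← hf]
  have : f = 0 := by
    ext p : 1
    exact (h p).elim (fun h => h.eq_of_src _ _) (fun h => h.eq_of_tgt _ _)
  rw [this, CategoryTheory.Functor.map_zero]

lemma toHo_hom_shift_eq_zero {K Y : CochainComplex (ModuleCat.{u} R) ℤ} (a b n : ℤ)
    [K.IsStrictlyGE a] [Y.IsStrictlyLE b] (h : b < a + n)
    (φ : (toHo R).obj K ⟶ ((toHo R).obj Y)⟦n⟧) : φ = 0 := by
  refine toHo_hom_eq_zero (Iso.refl _) (((toHo R).commShiftIso n).symm.app Y) (fun p => ?_) φ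
  by_cases hp : p < a
  · exact Or.inl (CochainComplex.isZero_of_isStrictlyGE K a p hp)
  · exact Or.inr (CochainComplex.isZero_of_isStrictlyLE Y b (p + n) (by omega))

lemma toHo_shift_hom_shift_eq_zero {K Y : CochainComplex (ModuleCat.{u} R) ℤ} (a b m n : ℤ)
    [K.IsStrictlyGE a] [Y.IsStrictlyLE b] (h : b + m < a + n)
    (φ : ((toHo R).obj K)⟦m⟧ ⟶ ((toHo R).obj Y)⟦n⟧) : φ = 0 := by
  refine toHo_hom_eq_zero (((toHo R).commShiftIso m).symm.app K)
    (((toHo R).commShiftIso n).symm.app Y) (fun p => ?_) φ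
  by_cases hp : p + m < a
  · exact Or.inl (CochainComplex.isZero_of_isStrictlyGE K a (p + m) hp)
  · exact Or.inr (CochainComplex.isZero_of_isStrictlyLE Y b (p + n) (by omega))

open Pretriangulated in
-- `Z[n]` lives in degrees at most `b - n < k - 1`, so it receives no nonzero map from the part of
-- `W` in degrees at least `k`, nor from the shift of this part by one.
lemma bijective_comp_stupidπ {W Z : CochainComplex (ModuleCat.{u} R) ℤ} (b n k : ℤ)
    [Z.IsStrictlyLE b] (hk : b + 1 < k + n) :
    Function.Bijective fun φ : (stupidTriangle W k).obj₃ ⟶ ((toHo R).obj Z)⟦n⟧ =>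
      (stupidTriangle W k).mor₂ ≫ φ := by
  have hT := stupidTriangle_distinguished W k
  constructor
  · suffices h : ∀ φ : (stupidTriangle W k).obj₃ ⟶ ((toHo R).obj Z)⟦n⟧,
        (stupidTriangle W k).mor₂ ≫ φ = 0 → φ = 0 by
      intro φ φ' h'
      have h'' : (stupidTriangle W k).mor₂ ≫ φ = (stupidTriangle W k).mor₂ ≫ φ' := h'
      rw [← sub_eq_zero, ← Preadditive.comp_sub] at h''
      exact sub_eq_zero.1 (h _ h'')
    intro φ hφ
    obtain ⟨ψ, rfl⟩ := Triangle.yoneda_exact₃ _ hT φ hφ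
    have : ψ = 0 := toHo_shift_hom_shift_eq_zero (K := stupidGE W k) (Y := Z) k b 1 n
      (by omega) ψ
    rw [this, comp_zero]
  · intro φ
    have h₀ : (stupidTriangle W k).mor₁ ≫ φ = 0 :=
      toHo_hom_shift_eq_zero (K := stupidGE W k) (Y := Z) k b n (by omega) _
    obtain ⟨ψ, hψ⟩ := Triangle.yoneda_exact₂ _ hT φ h₀
    exact ⟨ψ, hψ.symm⟩

/-- Morphisms from a bounded below complex of projective modules to bounded above complexes are
not affected by quasi-isomorphisms. -/
lemma bijective_comp_of_isStrictlyGE {W P Y : CochainComplex (ModuleCat.{u} R) ℤ} (a b : ℤ)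
    [W.IsStrictlyGE a] [∀ m, Projective (W.X m)] [P.IsStrictlyLE b] [Y.IsStrictlyLE b]
    (f : (toHo R).obj P ⟶ (toHo R).obj Y) [IsIso (DerivedCategory.Qh.map f)] (n : ℤ) :
    Function.Bijective fun φ : (toHo R).obj W ⟶ ((toHo R).obj P)⟦n⟧ => φ ≫ f⟦n⟧' := by
  -- The least `k` with `b + 1 < k + n`. The truncation of `W` below `k` is a bounded complex of
  -- projectives, hence K-projective, although `W` itself need not be.
  let k : ℤ := b + 2 - n
  have h₁ := bijective_comp_stupidπ (W := W) (Z := P) b n k (by omega)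
  have h₂ := bijective_comp_stupidπ (W := W) (Z := Y) b n k (by omega)
  have : (stupidLT W k).IsStrictlyLE (k - 1) := stupidLT_isStrictlyLE W k _ (by omega)
  have (m : ℤ) : Projective ((stupidLT W k).X m) := pieceComplex_projective W _ _ m
  have : (stupidLT W k).IsKProjective := CochainComplex.isKProjective_of_projective _ (k - 1)
  have := isIso_Qh_map_shift f n
  have h₃ := bijective_of_isIso_Qh_map (f⟦n⟧') (K := stupidLT W k)
  refine (Function.Bijective.of_comp_iff _ h₁).1 ?_
  have : ((fun φ : (toHo R).obj W ⟶ ((toHo R).obj P)⟦n⟧ => φ ≫ f⟦n⟧') ∘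
      fun φ : (stupidTriangle W k).obj₃ ⟶ ((toHo R).obj P)⟦n⟧ => (stupidTriangle W k).mor₂ ≫ φ) =
      (fun φ : (stupidTriangle W k).obj₃ ⟶ ((toHo R).obj Y)⟦n⟧ => (stupidTriangle W k).mor₂ ≫ φ) ∘
        fun φ : (stupidTriangle W k).obj₃ ⟶ ((toHo R).obj P)⟦n⟧ => φ ≫ f⟦n⟧' :=
    funext fun φ => Category.assoc _ _ _
  exact this ▸ h₂.comp h₃

end Vanishing

/-! ### Universality of `w` at bounded above complexes of projectives. -/

section BoundedAbove

variable {A B : Type u} [Ring A] [Ring B] {L : CochainComplex (Bimod A B) ℤ}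
  {W : CochainComplex (ModuleCat.{u} B) ℤ}
  (w : unitHo A ⟶ (tensorFunctorHo L).obj ((toHo B).obj W))

/-- Both sides are zero: `Z[n]` ends before `W` begins, and `L ⊗ Z` vanishes in degree `n`. -/
lemma yonedaMap_bijective_of_vanishing (a b c n : ℤ) [W.IsStrictlyGE a] [L.IsStrictlyLE b]
    (Z : CochainComplex (ModuleCat.{u} B) ℤ) [Z.IsStrictlyLE c] (ha : c < a + n) (hb : b + c < n) :
    Function.Bijective (yonedaMap (tensorFunctorHo L) w (((toHo B).obj Z)⟦n⟧)) := by
  have hs : ∀ φ : (toHo B).obj W ⟶ ((toHo B).obj Z)⟦n⟧, φ = 0 := fun φ =>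
    toHo_hom_shift_eq_zero a c n (by omega) φ
  have : (tensorComplex L Z).IsStrictlyLE (b + c) := isStrictlyLE_tensorComplex _ b c _ rfl
  have ht : ∀ ψ : unitHo A ⟶ (tensorFunctorHo L).obj (((toHo B).obj Z)⟦n⟧), ψ = 0 := by
    intro ψ
    have h : ψ ≫ ((tensorFunctorHo L).commShiftIso n).hom.app ((toHo B).obj Z) = 0 :=
      unitHo_hom_eq_zero (Y := tensorComplex L Z)
        (CochainComplex.isZero_of_isStrictlyLE _ (b + c) _ (by omega)) _
    exact (cancel_mono (((tensorFunctorHo L).commShiftIso n).hom.app ((toHo B).obj Z))).1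
      (h.trans zero_comp.symm)
  exact ⟨fun φ φ' _ => (hs φ).trans (hs φ').symm, fun ψ => ⟨0, (ht _).trans (ht _).symm⟩⟩

variable [∀ m, Module.Finite B (W.X m)]

lemma yonedaLocal_stupidGE (hL : ∃ a b : ℤ, L.IsStrictlyGE a ∧ L.IsStrictlyLE b)
    (hw : yonedaLocal (tensorFunctorHo L) w (unitHo B)) (b k : ℤ)
    (P : CochainComplex (ModuleCat.{u} B) ℤ) [∀ m, Projective (P.X m)] [P.IsStrictlyLE b] :
    yonedaLocal (tensorFunctorHo L) w ((toHo B).obj (stupidGE P k)) := by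
  have (m : ℤ) : Projective ((stupidGE P k).X m) := pieceComplex_projective P _ _ m
  obtain ⟨l, hl⟩ : ∃ l : ℕ, b ≤ k + l := ⟨(b - k).toNat, by omega⟩
  have : (stupidGE P k).IsStrictlyLE b := pieceComplex_isStrictlyLE' P _ _ b
  have : (stupidGE P k).IsStrictlyLE (k + l) := CochainComplex.isStrictlyLE_of_le _ b _ hl
  exact yonedaLocal_of_bounded w hL hw k l (stupidGE P k)

/-- For fixed `n` the part of `P` in very negative degrees contributes nothing, and the remaining
part is bounded. The argument needs `W` bounded below and the source of `w` to be the ring `A`, so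
it does not cover `t`. -/
lemma yonedaLocal_of_isStrictlyLE (hL : ∃ a b : ℤ, L.IsStrictlyGE a ∧ L.IsStrictlyLE b)
    (hw : yonedaLocal (tensorFunctorHo L) w (unitHo B)) (a b : ℤ) [W.IsStrictlyGE a]
    (P : CochainComplex (ModuleCat.{u} B) ℤ) [∀ m, Projective (P.X m)] [P.IsStrictlyLE b] :
    yonedaLocal (tensorFunctorHo L) w ((toHo B).obj P) := by
  intro n
  obtain ⟨c, d, _, _⟩ := id hL
  -- The first bound kills maps from `W` to the tail, the second the cohomology of `L ⊗` tail in
  -- degree `n`. The tail lies in degrees at most `k - 1`, so the same holds for `n - 1`.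
  obtain ⟨k, hk₁, hk₂⟩ : ∃ k : ℤ, k < a + n ∧ k + d < n := ⟨min (a + n) (n - d) - 1, by omega, by omega⟩
  have : (stupidLT P k).IsStrictlyLE (k - 1) := stupidLT_isStrictlyLE P k _ (by omega)
  exact yonedaMap_bijective_of_distinguished (tensorFunctorHo L) w _
    (stupidTriangle_distinguished P k) n (yonedaLocal_stupidGE w hL hw b k P)
    (yonedaMap_bijective_of_vanishing w a d (k - 1) n (stupidLT P k) (by omega) (by omega))
    (yonedaMap_bijective_of_vanishing w a d (k - 1) (n + (-1)) (stupidLT P k) (by omega) (by omega))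

end BoundedAbove

/-! ### Transfer along the counit of an adjunction. -/

section Counit

universe v₁ v₂ w₁ w₂

variable {C : Type w₁} {D : Type w₂} [Category.{v₁} C] [Category.{v₂} D] [HasShift C ℤ]
  [HasShift D ℤ] {F : C ⥤ D} {G : D ⥤ C} (adj : F ⊣ G) [F.CommShift ℤ] [G.CommShift ℤ]
  [adj.CommShift ℤ] {W : C} {a : D} (w : a ⟶ F.obj W)

/-- Transfer along the counit is the adjunction bijection followed by precomposition with `w`. When
`w` is a quasi-isomorphism and `J` is K-injective, it is therefore bijective. -/
lemma transfer_counit (J : D) (n : ℤ) (x : W ⟶ G.obj (J⟦n⟧)) :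
    transfer F w (adj.counit.app J) n (x ≫ (G.commShiftIso n).hom.app J) =
      w ≫ (adj.homEquiv W (J⟦n⟧)).symm x := by
  have h := adj.commShiftIso_hom_app_counit_app_shift ℤ n J
  rw [Functor.commShiftIso_comp_hom_app] at h
  rw [adj.homEquiv_counit, ← h]
  simp [transfer, yonedaMap]

lemma bijective_transfer_counit (J : D) (n : ℤ)
    (h : Function.Bijective fun φ : F.obj W ⟶ J⟦n⟧ => w ≫ φ) :
    Function.Bijective (transfer F w (adj.counit.app J) n) := by
  rw [← Function.Bijective.of_comp_iff _
    (((G.commShiftIso n).app J).homToEquiv (Z := W)).bijective]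
  have : transfer F w (adj.counit.app J) n ∘ ((G.commShiftIso n).app J).homToEquiv (Z := W) =
      (fun φ : F.obj W ⟶ J⟦n⟧ => w ≫ φ) ∘ (adj.homEquiv W (J⟦n⟧)).symm :=
    funext fun x => transfer_counit adj w J n x
  rw [this]
  exact h.comp (adj.homEquiv W (J⟦n⟧)).symm.bijective

end Counit

section Shift

variable {R : Type u} [Ring R]

lemma bijective_comp_shift {X Y : HoCat R} (f : X ⟶ Y) [IsIso (DerivedCategory.Qh.map f)] (n : ℤ)
    (K : CochainComplex (ModuleCat.{u} R) ℤ) [K.IsKProjective] :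
    Function.Bijective fun φ : (toHo R).obj K ⟶ X⟦n⟧ => φ ≫ f⟦n⟧' :=
  have := isIso_Qh_map_shift f n
  bijective_of_isIso_Qh_map (f⟦n⟧')

lemma bijective_precomp_shift {X Y : HoCat R} (f : X ⟶ Y) [IsIso (DerivedCategory.Qh.map f)]
    (n : ℤ) (J : CochainComplex (ModuleCat.{u} R) ℤ) [J.IsKInjective] :
    Function.Bijective fun φ : Y ⟶ ((toHo R).obj J)⟦n⟧ => f ≫ φ := by
  have h := bijective_of_isIso_Qh_map' f (K := J⟦n⟧)
  let e := ((toHo R).commShiftIso n).app J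
  have : (fun φ : Y ⟶ ((toHo R).obj J)⟦n⟧ => f ≫ φ) =
      (e.homToEquiv (Z := X)) ∘ (fun φ : Y ⟶ (toHo R).obj (J⟦n⟧) => f ≫ φ) ∘
        (e.homToEquiv (Z := Y)).symm := by
    ext φ
    change _ = (f ≫ φ ≫ e.inv) ≫ e.hom
    rw [Category.assoc, Category.assoc, e.inv_hom_id]
    exact (congrArg (f ≫ ·) (Category.comp_id φ)).symm
  rw [this]
  exact (Equiv.bijective _).comp (h.comp (Equiv.bijective _))

end Shift

/-! ### Homothety data and the criterion for invertibility of maps out of `L ⊗ P`. -/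

variable {A B : Type u} [Ring A] [Ring B]

/-- Representatives of the homothety isomorphisms of a complex of bimodules: a resolution
`t : K ⟶ L ⊗_B B` and a quasi-isomorphism `w : A ⟶ L ⊗_B W` such that maps from the ring `B`
(respectively from `W`) are computed after tensoring with `L`. -/
structure HomothetyData (L : CochainComplex (Bimod A B) ℤ) where
  /-- A resolution of `L` by finitely generated projective left `A`-modules. -/
  K : CochainComplex (ModuleCat.{u} A) ℤ
  /-- A bound for the degrees of `K`. -/
  c : ℤ
  /-- The quasi-isomorphism from `K` to `L ⊗_B B`. -/
  t : K ⟶ tensorComplex L (unitComplex B)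
  /-- The dual of a resolution of `L` by finitely generated projective right `B`-modules. -/
  W : CochainComplex (ModuleCat.{u} B) ℤ
  /-- A bound for the degrees of `W`. -/
  a : ℤ
  /-- The quasi-isomorphism from `A` to `L ⊗_B W`. -/
  w : unitComplex A ⟶ tensorComplex L W
  finite : ∃ a b : ℤ, L.IsStrictlyGE a ∧ L.IsStrictlyLE b
  isStrictlyLE_K : K.IsStrictlyLE c
  finite_K : ∀ m, Module.Finite A (K.X m)
  isKProjective_K : K.IsKProjective
  isIso_t : IsIso (DerivedCategory.Qh.map ((toHo A).map t))
  local_t : yonedaLocal (tensorFunctorHo L) (W := unitHo B) (a := (toHo A).obj K)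
    ((toHo A).map t) (unitHo B)
  isStrictlyGE_W : W.IsStrictlyGE a
  finite_W : ∀ m, Module.Finite B (W.X m)
  projective_W : ∀ m, Projective (W.X m)
  isIso_w : IsIso (DerivedCategory.Qh.map ((toHo A).map w))
  local_w : yonedaLocal (tensorFunctorHo L) (W := (toHo B).obj W) (a := unitHo A)
    ((toHo A).map w) (unitHo B)

variable {L : CochainComplex (Bimod A B) ℤ}

lemma IsPseudoDualizing.nonempty_homothetyData (hL : IsPseudoDualizing L) :
    Nonempty (HomothetyData L) := by
  obtain ⟨K, c, t, h₁, h₂, h₃, h₄, h₅⟩ := exists_left_data hL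
  obtain ⟨W, a, w, h₆, h₇, h₈, h₉, h⟩ := exists_right_data hL
  exact ⟨⟨K, c, t, W, a, w, hL.finite, h₁, h₂, h₃, h₄, h₅, h₆, h₇, h₈, h₉, h⟩⟩

namespace HomothetyData

variable (D : HomothetyData L)

/-- The morphism `K ⟶ L ⊗_B B` in the homotopy category. -/
def tHo : (toHo A).obj D.K ⟶ (tensorFunctorHo L).obj (unitHo B) := (toHo A).map D.t

/-- The morphism `A ⟶ L ⊗_B W` in the homotopy category. -/
def wHo : unitHo A ⟶ (tensorFunctorHo L).obj ((toHo B).obj D.W) := (toHo A).map D.w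

instance : D.K.IsStrictlyLE D.c := D.isStrictlyLE_K
instance (m : ℤ) : Module.Finite A (D.K.X m) := D.finite_K m
instance : D.K.IsKProjective := D.isKProjective_K
instance : D.W.IsStrictlyGE D.a := D.isStrictlyGE_W
instance (m : ℤ) : Module.Finite B (D.W.X m) := D.finite_W m
instance (m : ℤ) : Projective (D.W.X m) := D.projective_W m
instance : IsIso (DerivedCategory.Qh.map D.tHo) := D.isIso_t
instance : IsIso (DerivedCategory.Qh.map D.wHo) := D.isIso_w

/-- The objects `P` such that the cohomology of `P` is computed by maps from `L` to
`L ⊗_B P`. -/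
def good : ObjectProperty (HoCat B) := yonedaLocal (tensorFunctorHo L) D.tHo

instance : D.good.IsClosedUnderIsomorphisms :=
  inferInstanceAs ((yonedaLocal (tensorFunctorHo L) D.tHo).IsClosedUnderIsomorphisms)

/-- Since `K` is K-projective, `L ⊗ P` may be replaced by any quasi-isomorphic complex, for instance
a bounded below complex of injectives. -/
lemma good_iff {P : HoCat B} {Y : HoCat A} (f : (tensorFunctorHo L).obj P ⟶ Y)
    [IsIso (DerivedCategory.Qh.map f)] :
    D.good P ↔ ∀ n, Function.Bijective (transfer (tensorFunctorHo L) D.tHo f n) :=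
  forall_congr' fun n =>
    (bijective_transfer_iff (tensorFunctorHo L) D.tHo f n (bijective_comp_shift f n D.K)).symm

/-- A criterion for a map from `L ⊗_B P` to be a quasi-isomorphism. -/
lemma isIso_Qh_map_and_good (b : ℤ) (P : CochainComplex (ModuleCat.{u} B) ℤ)
    [∀ m, Projective (P.X m)] [P.IsStrictlyLE b] {Y : HoCat A}
    (f : (tensorFunctorHo L).obj ((toHo B).obj P) ⟶ Y)
    (hw : ∀ n, Function.Bijective (transfer (tensorFunctorHo L) D.wHo f n))
    (ht : ∀ n, Function.Bijective (transfer (tensorFunctorHo L) D.tHo f n)) :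
    IsIso (DerivedCategory.Qh.map f) ∧ D.good ((toHo B).obj P) := by
  -- Maps `W → P[n]` compute the cohomology of `L ⊗ P`, so bijectivity of the transfer along `w`
  -- says that `f` is bijective on cohomology.
  have h := yonedaLocal_of_isStrictlyLE D.wHo D.finite D.local_w D.a b P
  have : IsIso (DerivedCategory.Qh.map f) := isIso_Qh_map_of_bijective f fun n =>
    bijective_comp_of_transfer (tensorFunctorHo L) D.wHo f n (h n) (hw n)
  exact ⟨this, (D.good_iff f).2 ht⟩

lemma good_of_bounded (a b : ℤ) (P : CochainComplex (ModuleCat.{u} B) ℤ)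
    [∀ m, Projective (P.X m)] [P.IsStrictlyGE a] [P.IsStrictlyLE b] :
    D.good ((toHo B).obj P) := by
  obtain ⟨l, hl⟩ : ∃ l : ℕ, b ≤ a + l := ⟨(b - a).toNat, by omega⟩
  have : P.IsStrictlyLE (a + l) := CochainComplex.isStrictlyLE_of_le _ b _ hl
  exact yonedaLocal_of_bounded D.tHo D.finite D.local_t a l P

lemma bijective_transfer_counit_t (J : CochainComplex (ModuleCat.{u} A) ℤ) [J.IsKInjective]
    (n : ℤ) : Function.Bijective (transfer (tensorFunctorHo L) D.tHo
      ((tensorHomAdjunctionHo L).counit.app ((toHo A).obj J)) n) :=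
  bijective_transfer_counit _ _ _ _ (bijective_precomp_shift D.tHo n J)

lemma bijective_transfer_counit_w (J : CochainComplex (ModuleCat.{u} A) ℤ) [J.IsKInjective]
    (n : ℤ) : Function.Bijective (transfer (tensorFunctorHo L) D.wHo
      ((tensorHomAdjunctionHo L).counit.app ((toHo A).obj J)) n) :=
  bijective_transfer_counit _ _ _ _ (bijective_precomp_shift D.wHo n J)

/-- Bounded complexes of injective modules. -/
lemma isIso_and_good_of_injective {a b c d : ℤ} [L.IsStrictlyGE a]
    (J : CochainComplex (ModuleCat.{u} A) ℤ) [J.IsStrictlyGE c] [J.IsStrictlyLE d]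
    [∀ m, Injective (J.X m)] (P : CochainComplex (ModuleCat.{u} B) ℤ)
    [∀ m, Projective (P.X m)] [P.IsStrictlyLE b]
    (p : (toHo B).obj P ⟶ (toHo B).obj (homComplex L J))
    [IsIso (DerivedCategory.Qh.map p)] :
    IsIso (DerivedCategory.Qh.map ((tensorFunctorHo L).map p ≫
      (tensorHomAdjunctionHo L).counit.app ((toHo A).obj J))) ∧ D.good ((toHo B).obj P) := by
  have : J.IsKInjective := CochainComplex.isKInjective_of_injective J c
  refine D.isIso_Qh_map_and_good b P _ (fun n => ?_) (fun n => ?_)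
  -- `W` is only bounded below and need not be K-projective. That `p` induces bijections on maps out
  -- of `W` relies on a common upper bound for `P` and `Hom_A(L, J)`.
  · refine (bijective_transfer_map_iff _ _ _ _ _ ?_).2 (D.bijective_transfer_counit_w J n)
    have : (homComplex L J).IsStrictlyLE (d - a) := isStrictlyLE_homComplex J a d _ (by omega)
    have : (homComplex L J).IsStrictlyLE (max b (d - a)) :=
      CochainComplex.isStrictlyLE_of_le _ (d - a) _ (le_max_right _ _)
    have : P.IsStrictlyLE (max b (d - a)) :=
      CochainComplex.isStrictlyLE_of_le _ b _ (le_max_left _ _)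
    exact bijective_comp_of_isStrictlyGE (Y := homComplex L J) D.a (max b (d - a)) p n
  · refine (bijective_transfer_map_iff _ _ _ _ _ ?_).2 (D.bijective_transfer_counit_t J n)
    exact bijective_comp_shift p n (unitComplex B)

/-- The tensor product with `L` need not commute with products on the nose. But the cohomology of `L
⊗ P` is given by maps out of `W`, and these commute with products; goodness is inherited in the same
way through `t`. -/
lemma isIso_and_good_of_prod {I : Type u} (b : ℤ) (Z : I → CochainComplex (ModuleCat.{u} B) ℤ)
    [∀ i m, Projective ((Z i).X m)] [∀ i, (Z i).IsStrictlyLE b]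
    [(prodComplex Z).IsStrictlyLE b] (hZ : ∀ i, D.good ((toHo B).obj (Z i)))
    (P : CochainComplex (ModuleCat.{u} B) ℤ) [∀ m, Projective (P.X m)] [P.IsStrictlyLE b]
    (p : P ⟶ prodComplex Z) [IsIso (DerivedCategory.Qh.map ((toHo B).map p))] :
    IsIso (DerivedCategory.Qh.map ((toHo A).map
      (prodLift fun i => (tensorFunctor L).map (p ≫ prodπ Z i)))) ∧
        D.good ((toHo B).obj P) := by
  have key : ∀ {a : HoCat A} {U : HoCat B} (s : a ⟶ (tensorFunctorHo L).obj U) (n : ℤ)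
      (_ : Function.Bijective fun φ : U ⟶ ((toHo B).obj P)⟦n⟧ => φ ≫ ((toHo B).map p)⟦n⟧')
      (_ : ∀ i, yonedaLocal (tensorFunctorHo L) s ((toHo B).obj (Z i))),
      Function.Bijective (transfer (tensorFunctorHo L) s (X := (toHo B).obj P)
        ((toHo A).map (prodLift fun i => (tensorFunctor L).map (p ≫ prodπ Z i))) n) := by
    intro a U s n hp hs
    refine bijective_transfer_of_prod (tensorFunctorHo L) s (P := (toHo B).obj P)
      (Z := fun i => (toHo B).obj (Z i)) (Y := fun i => (tensorFunctorHo L).obj ((toHo B).obj (Z i)))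
      (fun i => (toHo B).map p ≫ prodπHo Z i)
      (prodπHo fun i => (tensorFunctor L).obj (Z i)) _ (fun i => 𝟙 _) n ?_
      (prod_bijective _ a n) (fun i => ?_)
      (fun i => (bijective_transfer_id_iff _ _ n).2 (hs i n))
    · have h : (fun (x : U ⟶ ((toHo B).obj P)⟦n⟧) i => x ≫ ((toHo B).map p ≫ prodπHo Z i)⟦n⟧') =
          (fun (x : U ⟶ ((toHo B).obj (prodComplex Z))⟦n⟧) i => x ≫ (prodπHo Z i)⟦n⟧') ∘
            fun φ : U ⟶ ((toHo B).obj P)⟦n⟧ => φ ≫ ((toHo B).map p)⟦n⟧' := by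
        ext x i
        simp only [CategoryTheory.Functor.map_comp, Function.comp_apply, Category.assoc]
      exact h ▸ (prod_bijective Z U n).comp hp
    · refine ((toHo A).map_comp _ _).symm.trans (Eq.trans ?_ (Category.comp_id _).symm)
      refine Eq.trans ?_ (congrArg (tensorFunctorHo L).map ((toHo B).map_comp p (prodπ Z i)))
      exact congrArg (toHo A).map (prodLift_π _ _ i)
  exact D.isIso_Qh_map_and_good b P _
    (fun n => key D.wHo n (bijective_comp_of_isStrictlyGE D.a b _ n)
      (fun i => yonedaLocal_of_isStrictlyLE D.wHo D.finite D.local_w D.a b (Z i)))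
    (fun n => key D.tHo n (bijective_comp_shift _ n (unitComplex B)) hZ)

end HomothetyData

/-! ### K-projective objects of the homotopy category. -/

section KProjective

variable {R : Type u} [Ring R]

/-- The K-projective objects of the homotopy category. -/
def kproj (R : Type u) [Ring R] : ObjectProperty (HoCat R) :=
  (HomotopyCategory.subcategoryAcyclic (ModuleCat.{u} R)).leftOrthogonal

instance : (kproj R).IsTriangulated :=
  inferInstanceAs
    ((HomotopyCategory.subcategoryAcyclic (ModuleCat.{u} R)).leftOrthogonal.IsTriangulated)

instance : (kproj R).IsClosedUnderIsomorphisms :=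
  inferInstanceAs ((HomotopyCategory.subcategoryAcyclic
    (ModuleCat.{u} R)).leftOrthogonal.IsClosedUnderIsomorphisms)

lemma kproj_toHo (K : CochainComplex (ModuleCat.{u} R) ℤ) [K.IsKProjective] :
    kproj R ((toHo R).obj K) :=
  CochainComplex.IsKProjective.leftOrthogonal K

lemma kproj.bijective {P : HoCat R} (hP : kproj R P) (X : HoCat R) :
    Function.Bijective (DerivedCategory.Qh.map : (P ⟶ X) → _) := by
  obtain ⟨K, rfl⟩ : ∃ K : CochainComplex (ModuleCat.{u} R) ℤ, (toHo R).obj K = P :=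
    HomotopyCategory.quotient_obj_surjective P
  have : K.IsKProjective := (CochainComplex.isKProjective_iff_leftOrthogonal K).2 hP
  exact CochainComplex.IsKProjective.Qh_map_bijective K X

lemma kproj.exists_lift {P X Y : HoCat R} (hP : kproj R P) (f : X ⟶ Y)
    [IsIso (DerivedCategory.Qh.map f)] (g : P ⟶ Y) : ∃ h : P ⟶ X, h ≫ f = g := by
  obtain ⟨h, hh⟩ := (hP.bijective X).2 (DerivedCategory.Qh.map g ≫ inv (DerivedCategory.Qh.map f))
  refine ⟨h, (hP.bijective Y).1 ?_⟩
  rw [CategoryTheory.Functor.map_comp, hh, Category.assoc, IsIso.inv_hom_id, Category.comp_id]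

lemma kproj.nonempty_iso {P P' : HoCat R} (hP : kproj R P) (hP' : kproj R P')
    (e : DerivedCategory.Qh.obj P ≅ DerivedCategory.Qh.obj P') : Nonempty (P ≅ P') := by
  obtain ⟨f, hf⟩ := (hP.bijective P').2 e.hom
  obtain ⟨g, hg⟩ := (hP'.bijective P).2 e.inv
  refine ⟨⟨f, g, (hP.bijective P).1 ?_, (hP'.bijective P').1 ?_⟩⟩
  · rw [CategoryTheory.Functor.map_comp, hf, hg, e.hom_inv_id, CategoryTheory.Functor.map_id]
  · rw [CategoryTheory.Functor.map_comp, hf, hg, e.inv_hom_id, CategoryTheory.Functor.map_id]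

lemma exists_toHo_hom_of_injective {X : HoCat R} {J : CochainComplex (ModuleCat.{u} R) ℤ}
    [J.IsKInjective] (e : DerivedCategory.Qh.obj X ≅ DerivedCategory.Qh.obj ((toHo R).obj J)) :
    ∃ j : X ⟶ (toHo R).obj J, IsIso (DerivedCategory.Qh.map j) := by
  obtain ⟨j, hj⟩ := (CochainComplex.IsKInjective.Qh_map_bijective X J).2 e.hom
  exact ⟨j, hj ▸ e.isIso_hom⟩

end KProjective

/-! ### Matched objects of the two derived categories. -/

namespace HomothetyData

open Pretriangulated

variable {A B : Type u} [Ring A] [Ring B] {L : CochainComplex (Bimod A B) ℤ} (D : HomothetyData L)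

/-- The unit of the derived adjunction is an isomorphism on good objects. -/
lemma isIso_Qh_map_homEquiv {P : HoCat B} (hP : D.good P)
    (J : CochainComplex (ModuleCat.{u} A) ℤ) [J.IsKInjective]
    (j : (tensorFunctorHo L).obj P ⟶ (toHo A).obj J) [IsIso (DerivedCategory.Qh.map j)] :
    IsIso (DerivedCategory.Qh.map
      ((tensorHomAdjunctionHo L).homEquiv P ((toHo A).obj J) j)) := by
  refine isIso_Qh_map_of_bijective _ fun n => ?_
  have h := (D.good_iff j).1 hP n
  -- Factoring `j` through the counit splits its transfer into the action of the adjoint map on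
  -- cohomology followed by the transfer along the counit, which is bijective. Hence goodness of `P`
  -- is bijectivity of the adjoint map on cohomology.
  have hj : j = (tensorFunctorHo L).map ((tensorHomAdjunctionHo L).homEquiv P ((toHo A).obj J) j) ≫
      (tensorHomAdjunctionHo L).counit.app ((toHo A).obj J) :=
    (((tensorHomAdjunctionHo L).homEquiv P ((toHo A).obj J)).symm_apply_apply j).symm.trans
      ((tensorHomAdjunctionHo L).homEquiv_counit P ((toHo A).obj J) _)
  have h' : transfer (tensorFunctorHo L) D.tHo j n =
      transfer (tensorFunctorHo L) D.tHo ((tensorHomAdjunctionHo L).counit.app ((toHo A).obj J)) n ∘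
        fun φ => φ ≫ ((tensorHomAdjunctionHo L).homEquiv P ((toHo A).obj J) j)⟦n⟧' := by
    funext x
    refine Eq.trans ?_ (transfer_map (tensorFunctorHo L) D.tHo
      ((tensorHomAdjunctionHo L).homEquiv P ((toHo A).obj J) j) _ n x).symm
    exact congrArg (fun j => transfer (tensorFunctorHo L) D.tHo j n x) hj
  rw [h'] at h
  exact (Function.Bijective.of_comp_iff' (D.bijective_transfer_counit_t J n) _).1 h

/-- The derived functor of `L ⊗_B -` is full on good objects. -/
lemma exists_tensorFunctorHo_map_eq {P₁ P₂ : HoCat B} (h₁ : kproj B P₁) (h₂ : D.good P₂) (a : ℤ)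
    (ha : (DerivedCategory.Qh.obj ((tensorFunctorHo L).obj P₂)).IsGE a)
    (φ : DerivedCategory.Qh.obj ((tensorFunctorHo L).obj P₁) ⟶
      DerivedCategory.Qh.obj ((tensorFunctorHo L).obj P₂)) :
    ∃ g : P₁ ⟶ P₂, DerivedCategory.Qh.map ((tensorFunctorHo L).map g) = φ := by
  -- The lower bound yields a bounded below complex of injectives. It is K-injective, so morphisms
  -- into it can be moved through the adjunction on homotopy categories.
  obtain ⟨J, hJ, hJ', ⟨e⟩⟩ := exists_injective_representative
    (DerivedCategory.Qh.obj ((tensorFunctorHo L).obj P₂)) a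
  have : J.IsKInjective := CochainComplex.isKInjective_of_injective J a
  obtain ⟨j, hj⟩ := exists_toHo_hom_of_injective (J := J) e.symm
  have hp := D.isIso_Qh_map_homEquiv h₂ J j
  obtain ⟨ψ, hψ⟩ := (CochainComplex.IsKInjective.Qh_map_bijective _ J).2
    (φ ≫ DerivedCategory.Qh.map j)
  obtain ⟨g, hg⟩ := h₁.exists_lift ((tensorHomAdjunctionHo L).homEquiv P₂ ((toHo A).obj J) j)
    ((tensorHomAdjunctionHo L).homEquiv P₁ ((toHo A).obj J) ψ)
  refine ⟨g, ?_⟩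
  rw [← cancel_mono (DerivedCategory.Qh.map j), ← hψ, ← CategoryTheory.Functor.map_comp]
  refine congrArg DerivedCategory.Qh.map
    (((tensorHomAdjunctionHo L).homEquiv P₁ ((toHo A).obj J)).injective ?_)
  rw [← hg, Adjunction.homEquiv_naturality_left]

/-- The relation between an object of `D(B-Mod)` and the object of `D(A-Mod)` obtained from it
by the derived functor of `L ⊗_B -`, when the former can be recovered from the latter. -/
def Matched (X : DerivedCategory (ModuleCat.{u} B)) (Y : DerivedCategory (ModuleCat.{u} A)) :
    Prop :=
  ∃ P : HoCat B, kproj B P ∧ D.good P ∧ Nonempty (DerivedCategory.Qh.obj P ≅ X) ∧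
    Nonempty (DerivedCategory.Qh.obj ((tensorFunctorHo L).obj P) ≅ Y)

variable {D} {X X₁ X₂ : DerivedCategory (ModuleCat.{u} B)}
  {Y Y₁ Y₂ : DerivedCategory (ModuleCat.{u} A)}

lemma Matched.of_iso {X' : DerivedCategory (ModuleCat.{u} B)}
    {Y' : DerivedCategory (ModuleCat.{u} A)} (h : D.Matched X Y) (e : X ≅ X') (e' : Y ≅ Y') :
    D.Matched X' Y' := by
  obtain ⟨P, hP, hP', ⟨i⟩, ⟨i'⟩⟩ := h
  exact ⟨P, hP, hP', ⟨i ≪≫ e⟩, ⟨i' ≪≫ e'⟩⟩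

lemma Matched.shift (h : D.Matched X Y) (n : ℤ) : D.Matched (X⟦n⟧) (Y⟦n⟧) := by
  obtain ⟨P, hP, hP', ⟨i⟩, ⟨i'⟩⟩ := h
  refine ⟨P⟦n⟧, (kproj B).le_shift n _ hP, yonedaLocal_shift _ _ hP' n,
    ⟨(DerivedCategory.Qh.commShiftIso n).app P ≪≫ (shiftFunctor _ n).mapIso i⟩,
    ⟨DerivedCategory.Qh.mapIso (((tensorFunctorHo L).commShiftIso n).app P) ≪≫
      (DerivedCategory.Qh.commShiftIso n).app ((tensorFunctorHo L).obj P) ≪≫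
        (shiftFunctor _ n).mapIso i'⟩⟩

lemma Matched.exists_projective (h : D.Matched X Y) (b : ℤ) [X.IsLE b] :
    ∃ P : CochainComplex (ModuleCat.{u} B) ℤ, P.IsStrictlyLE b ∧ (∀ m, Projective (P.X m)) ∧
      D.good ((toHo B).obj P) ∧ Nonempty (DerivedCategory.Q.obj P ≅ X) ∧
        Nonempty (DerivedCategory.Q.obj (tensorComplex L P) ≅ Y) := by
  obtain ⟨P, hP, hP', ⟨i⟩, ⟨i'⟩⟩ := h
  obtain ⟨K, hK, hK', ⟨e⟩⟩ := exists_projective_representative X b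
  have : K.IsKProjective := CochainComplex.isKProjective_of_projective K b
  obtain ⟨f⟩ := hP.nonempty_iso (kproj_toHo K) (i ≪≫ e.symm)
  exact ⟨K, hK', hK, D.good.prop_of_iso f hP', ⟨e⟩,
    ⟨DerivedCategory.Qh.mapIso ((tensorFunctorHo L).mapIso f.symm) ≪≫ i'⟩⟩

lemma matched_of_projective (b : ℤ) (P : CochainComplex (ModuleCat.{u} B) ℤ) [P.IsStrictlyLE b]
    [∀ m, Projective (P.X m)] (hP : D.good ((toHo B).obj P)) :
    D.Matched (DerivedCategory.Q.obj P) (DerivedCategory.Q.obj (tensorComplex L P)) := by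
  have : P.IsKProjective := CochainComplex.isKProjective_of_projective P b
  exact ⟨(toHo B).obj P, kproj_toHo P, hP, ⟨Iso.refl _⟩, ⟨Iso.refl _⟩⟩

/-- The unit is invertible on good objects, so the `B`-side is recovered from the `A`-side as the
derived Hom out of `L`. -/
lemma Matched.nonempty_iso_homComplex (h : D.Matched X Y) (a : ℤ)
    (J : CochainComplex (ModuleCat.{u} A) ℤ) [J.IsStrictlyGE a] [∀ m, Injective (J.X m)]
    (e : DerivedCategory.Q.obj J ≅ Y) : Nonempty (X ≅ DerivedCategory.Q.obj (homComplex L J)) := by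
  obtain ⟨P, hP, hP', ⟨i⟩, ⟨i'⟩⟩ := h
  have : J.IsKInjective := CochainComplex.isKInjective_of_injective J a
  obtain ⟨j, hj⟩ := exists_toHo_hom_of_injective (J := J) (i' ≪≫ e.symm)
  have := D.isIso_Qh_map_homEquiv hP' J j
  exact ⟨i.symm ≪≫ @asIso _ _ _ _ _ this⟩

lemma exists_cone {P₁ P₂ : HoCat B} (h₁ : kproj B P₁) (h₂ : kproj B P₂) (h₁' : D.good P₁)
    (h₂' : D.good P₂) (g : P₁ ⟶ P₂) :
    ∃ (P₃ : HoCat B) (u : P₂ ⟶ P₃) (v : P₃ ⟶ P₁⟦(1 : ℤ)⟧), Triangle.mk g u v ∈ distTriang _ ∧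
      D.Matched (DerivedCategory.Qh.obj P₃)
        (DerivedCategory.Qh.obj ((tensorFunctorHo L).obj P₃)) := by
  obtain ⟨P₃, u, v, hT⟩ := distinguished_cocone_triangle g
  exact ⟨P₃, u, v, hT, P₃, (kproj B).ext_of_isTriangulatedClosed₃ _ hT h₁ h₂,
    yonedaLocal₃ _ _ _ hT h₁' h₂', ⟨Iso.refl _⟩, ⟨Iso.refl _⟩⟩

/-- The third object of a triangle in `D(B-Mod)`. -/
lemma Matched.cone (T : Triangle (DerivedCategory (ModuleCat.{u} B))) (hT : T ∈ distTriang _)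
    (h₁ : D.Matched T.obj₁ Y₁) (h₂ : D.Matched T.obj₂ Y₂) :
    ∃ T' ∈ distTriang (DerivedCategory (ModuleCat.{u} A)), Nonempty (T'.obj₁ ≅ Y₁) ∧
      Nonempty (T'.obj₂ ≅ Y₂) ∧ D.Matched T.obj₃ T'.obj₃ := by
  obtain ⟨P₁, hP₁, hP₁', ⟨i₁⟩, e₁⟩ := h₁
  obtain ⟨P₂, hP₂, hP₂', ⟨i₂⟩, e₂⟩ := h₂
  obtain ⟨g, hg⟩ := (hP₁.bijective P₂).2 (i₁.hom ≫ T.mor₁ ≫ i₂.inv)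
  obtain ⟨P₃, u, v, hT', h₃⟩ := exists_cone hP₁ hP₂ hP₁' hP₂' g
  have hB := DerivedCategory.Qh.map_distinguished _ hT'
  refine ⟨_, DerivedCategory.Qh.map_distinguished _ ((tensorFunctorHo L).map_distinguished _ hT'),
    e₁, e₂, h₃.of_iso ?_ (Iso.refl _)⟩
  exact Triangle.π₃.mapIso (isoTriangleOfIso₁₂ _ T hB hT i₁ i₂ (by
    change DerivedCategory.Qh.map g ≫ i₂.hom = i₁.hom ≫ T.mor₁
    rw [hg, Category.assoc, Category.assoc, Iso.inv_hom_id, Category.comp_id]))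

/-- The third object of a triangle in `D(A-Mod)`. -/
lemma Matched.cone' (T : Triangle (DerivedCategory (ModuleCat.{u} A))) (hT : T ∈ distTriang _)
    (h₁ : D.Matched X₁ T.obj₁) (h₂ : D.Matched X₂ T.obj₂) (a : ℤ) (ha : T.obj₂.IsGE a) :
    ∃ T' ∈ distTriang (DerivedCategory (ModuleCat.{u} B)), Nonempty (T'.obj₁ ≅ X₁) ∧
      Nonempty (T'.obj₂ ≅ X₂) ∧ D.Matched T'.obj₃ T.obj₃ := by
  obtain ⟨P₁, hP₁, hP₁', e₁, ⟨i₁⟩⟩ := h₁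
  obtain ⟨P₂, hP₂, hP₂', e₂, ⟨i₂⟩⟩ := h₂
  -- Fullness on good objects lifts the first map of the triangle to a map over `B`, whose cone is
  -- the required object.
  obtain ⟨g, hg⟩ := D.exists_tensorFunctorHo_map_eq hP₁ hP₂' a
    (DerivedCategory.TStructure.t.isGE_of_iso i₂.symm a) (i₁.hom ≫ T.mor₁ ≫ i₂.inv)
  obtain ⟨P₃, u, v, hT', h₃⟩ := exists_cone hP₁ hP₂ hP₁' hP₂' g
  have hA := DerivedCategory.Qh.map_distinguished _ ((tensorFunctorHo L).map_distinguished _ hT')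
  refine ⟨_, DerivedCategory.Qh.map_distinguished _ hT', e₁, e₂, h₃.of_iso (Iso.refl _) ?_⟩
  exact Triangle.π₃.mapIso (isoTriangleOfIso₁₂ _ T hA hT i₁ i₂ (by
    change DerivedCategory.Qh.map ((tensorFunctorHo L).map g) ≫ i₂.hom = i₁.hom ≫ T.mor₁
    rw [hg, Category.assoc, Category.assoc, Iso.inv_hom_id, Category.comp_id]))

end HomothetyData

/-! ### Sums and products of quasi-isomorphisms, and of modules in degree zero. -/

section QuasiIso

variable {R : Type u} [Ring R] {I : Type u} {Z Z' : I → CochainComplex (ModuleCat.{u} R) ℤ}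

/-- Cohomology is given by maps out of the ring, and these commute with products. -/
lemma isIso_Qh_prodMap (f : ∀ i, Z i ⟶ Z' i)
    [∀ i, IsIso (DerivedCategory.Qh.map ((toHo R).map (f i)))] :
    IsIso (DerivedCategory.Qh.map ((toHo R).map (prodMap f))) := by
  refine isIso_Qh_map_of_bijective _ fun n => ?_
  rw [← (prod_bijective Z' (unitHo R) n).of_comp_iff']
  have h : (fun (x : unitHo R ⟶ ((toHo R).obj (prodComplex Z'))⟦n⟧) i => x ≫ (prodπHo Z' i)⟦n⟧') ∘
      (fun φ : unitHo R ⟶ ((toHo R).obj (prodComplex Z))⟦n⟧ =>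
        φ ≫ ((toHo R).map (prodMap f))⟦n⟧') =
      (fun (x : ∀ i, unitHo R ⟶ ((toHo R).obj (Z i))⟦n⟧) i => x i ≫ ((toHo R).map (f i))⟦n⟧') ∘
        fun (x : unitHo R ⟶ ((toHo R).obj (prodComplex Z))⟦n⟧) i => x ≫ (prodπHo Z i)⟦n⟧' := by
    ext x i
    have h₁ : (toHo R).map (prodMap f) ≫ prodπHo Z' i = prodπHo Z i ≫ (toHo R).map (f i) :=
      ((toHo R).map_comp _ _).symm.trans ((congrArg (toHo R).map (prodLift_π _ _ i)).trans
        ((toHo R).map_comp _ _))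
    simp only [Function.comp_apply, Category.assoc, ← CategoryTheory.Functor.map_comp, h₁]
  rw [h]
  exact (Function.Bijective.piMap fun i =>
    bijective_comp_shift ((toHo R).map (f i)) n (unitComplex R)).comp (prod_bijective Z _ n)

lemma bijective_transfer_id_functor_iff {W X Y : HoCat R} (f : X ⟶ Y) (n : ℤ) :
    Function.Bijective (transfer (𝟭 (HoCat R)) (𝟙 W) f n) ↔
      Function.Bijective fun x : W ⟶ X⟦n⟧ => x ≫ f⟦n⟧' := by
  have : transfer (𝟭 (HoCat R)) (𝟙 W) f n = fun x => x ≫ f⟦n⟧' := by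
    funext x
    simp [transfer, yonedaMap]
  rw [this]

/-- The transfer argument for direct sums, applied to the identity functor with the ring as source.
-/
lemma isIso_Qh_sumMap (f : ∀ i, Z i ⟶ Z' i)
    [∀ i, IsIso (DerivedCategory.Qh.map ((toHo R).map (f i)))] :
    IsIso (DerivedCategory.Qh.map ((toHo R).map (sumMap f))) := by
  refine isIso_Qh_map_of_bijective _ fun n => ?_
  have hT : ∀ (Z : I → CochainComplex (ModuleCat.{u} R) ℤ), ∀ m ∉ ({0} : Finset ℤ),
      IsZero ((unitComplex R).X m) ∨ ∀ i, IsZero ((Z i).X (m + n)) :=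
    fun Z m hm => Or.inl (isZero_unitComplex_X (by simpa using hm))
  have h := bijective_transfer_of_sum (𝟭 (HoCat R)) (𝟙 (unitHo R))
    (P := (toHo R).obj (sumComplex Z)) (J := (toHo R).obj (sumComplex Z'))
    (Z := fun i => (toHo R).obj (Z i)) (Y := fun i => (toHo R).obj (Z' i))
    (sumπHo Z) (sumιHo Z) (sumπHo Z') (sumιHo Z')
    ((toHo R).map (sumMap f)) (fun i => (toHo R).map (f i)) n
    (sum_decomposition_ho {0} (hT Z)) (sum_decomposition_ho {0} (hT Z')) (fun i => ?_)
    (fun i => ?_) (fun i => ?_)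
  · exact (bijective_transfer_id_functor_iff _ n).1 h
  · refine ((toHo R).map_comp _ _).symm.trans (Eq.trans ?_ ((toHo R).map_comp _ _))
    exact congrArg (toHo R).map (sumι_desc _ i)
  · refine ((toHo R).map_comp _ _).symm.trans (Eq.trans ?_ ((toHo R).map_comp _ _))
    exact congrArg (toHo R).map (sumMap_π f i)
  · exact (bijective_transfer_id_functor_iff _ n).2
      (bijective_comp_shift ((toHo R).map (f i)) n (unitComplex R))

/-- The embedding of modules in the derived category. -/
abbrev S (R : Type u) [Ring R] : ModuleCat.{u} R ⥤ DerivedCategory (ModuleCat.{u} R) :=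
  DerivedCategory.singleFunctor (ModuleCat.{u} R) 0

/-- The complex given by a module is a representative of the module in the derived category. -/
def singleQIso (M : ModuleCat.{u} R) :
    DerivedCategory.Q.obj ((CochainComplex.singleFunctor (ModuleCat.{u} R) 0).obj M) ≅
      (S R).obj M :=
  (DerivedCategory.singleFunctorIsoCompQ (ModuleCat.{u} R) 0).symm.app M

lemma nonempty_iso_single (K : CochainComplex (ModuleCat.{u} R) ℤ) (n : ℤ) [K.IsStrictlyGE n]
    [K.IsStrictlyLE n] {M : ModuleCat.{u} R} (e : K.X n ≅ M) :
    Nonempty (K ≅ (CochainComplex.singleFunctor (ModuleCat.{u} R) n).obj M) := by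
  obtain ⟨M', ⟨i⟩⟩ := K.exists_iso_single n
  let i' : M' ≅ M := (HomologicalComplex.singleObjXSelf (ComplexShape.up ℤ) n M').symm ≪≫
    (HomologicalComplex.eval _ _ n).mapIso i.symm ≪≫ e
  exact ⟨i ≪≫ (CochainComplex.singleFunctor (ModuleCat.{u} R) n).mapIso i'⟩

lemma sumComplex_isStrictlyLE (b : ℤ) [∀ i, (Z i).IsStrictlyLE b] :
    (sumComplex Z).IsStrictlyLE b := by
  rw [CochainComplex.isStrictlyLE_iff]
  intro m hm
  rw [IsZero.iff_id_eq_zero]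
  exact to_sum_ext fun i => ((Z i).isZero_of_isStrictlyLE b m hm).eq_of_tgt _ _

lemma sumComplex_isStrictlyGE (b : ℤ) [∀ i, (Z i).IsStrictlyGE b] :
    (sumComplex Z).IsStrictlyGE b := by
  rw [CochainComplex.isStrictlyGE_iff]
  intro m hm
  rw [IsZero.iff_id_eq_zero]
  exact to_sum_ext fun i => ((Z i).isZero_of_isStrictlyGE b m hm).eq_of_tgt _ _

lemma prodComplex_isStrictlyLE (b : ℤ) [∀ i, (Z i).IsStrictlyLE b] :
    (prodComplex Z).IsStrictlyLE b := by
  rw [CochainComplex.isStrictlyLE_iff]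
  intro m hm
  rw [IsZero.iff_id_eq_zero]
  refine ModuleCat.hom_ext (LinearMap.ext fun x => funext fun i => ?_)
  exact eq_zero_of_isZero ((Z i).isZero_of_isStrictlyLE b m hm) _

lemma prodComplex_isStrictlyGE (b : ℤ) [∀ i, (Z i).IsStrictlyGE b] :
    (prodComplex Z).IsStrictlyGE b := by
  rw [CochainComplex.isStrictlyGE_iff]
  intro m hm
  rw [IsZero.iff_id_eq_zero]
  refine ModuleCat.hom_ext (LinearMap.ext fun x => funext fun i => ?_)
  exact eq_zero_of_isZero ((Z i).isZero_of_isStrictlyGE b m hm) _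

lemma sumComplex_projective [∀ i m, Projective ((Z i).X m)] (m : ℤ) :
    Projective ((sumComplex Z).X m) := by
  have (i : I) : Module.Projective R ((Z i).X m) :=
    (IsProjective.iff_projective (R := R) ((Z i).X m)).2 inferInstance
  have : Module.Projective R (DirectSum I fun i => (Z i).X m) := inferInstance
  exact (IsProjective.iff_projective (R := R) ((sumComplex Z).X m)).1 this

lemma nonempty_sum_single_iso (M : I → ModuleCat.{u} R) :
    Nonempty (sumComplex (fun i => (CochainComplex.singleFunctor (ModuleCat.{u} R) 0).obj (M i)) ≅
      (CochainComplex.singleFunctor (ModuleCat.{u} R) 0).obj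
        (ModuleCat.of R (DirectSum I fun i => M i))) := by
  have := sumComplex_isStrictlyLE
    (Z := fun i => (CochainComplex.singleFunctor (ModuleCat.{u} R) 0).obj (M i)) 0
  have := sumComplex_isStrictlyGE
    (Z := fun i => (CochainComplex.singleFunctor (ModuleCat.{u} R) 0).obj (M i)) 0
  refine nonempty_iso_single _ 0 (LinearEquiv.toModuleIso ?_)
  exact DFinsupp.mapRange.linearEquiv fun i =>
    (HomologicalComplex.singleObjXSelf (ComplexShape.up ℤ) 0 (M i)).toLinearEquiv

lemma nonempty_prod_single_iso (M : I → ModuleCat.{u} R) :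
    Nonempty (prodComplex (fun i => (CochainComplex.singleFunctor (ModuleCat.{u} R) 0).obj (M i)) ≅
      (CochainComplex.singleFunctor (ModuleCat.{u} R) 0).obj (ModuleCat.of R (∀ i, M i))) := by
  have := prodComplex_isStrictlyLE
    (Z := fun i => (CochainComplex.singleFunctor (ModuleCat.{u} R) 0).obj (M i)) 0
  have := prodComplex_isStrictlyGE
    (Z := fun i => (CochainComplex.singleFunctor (ModuleCat.{u} R) 0).obj (M i)) 0
  refine nonempty_iso_single _ 0 (LinearEquiv.toModuleIso ?_)
  exact LinearEquiv.piCongrRight fun i =>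
    (HomologicalComplex.singleObjXSelf (ComplexShape.up ℤ) 0 (M i)).toLinearEquiv

/-- A morphism of complexes realizing an isomorphism in the derived category to a complex of
injective modules. -/
lemma exists_hom_to_injective {K J : CochainComplex (ModuleCat.{u} R) ℤ} (a : ℤ)
    [J.IsStrictlyGE a] [∀ m, Injective (J.X m)]
    (e : DerivedCategory.Q.obj K ≅ DerivedCategory.Q.obj J) :
    ∃ f : K ⟶ J, IsIso (DerivedCategory.Qh.map ((toHo R).map f)) := by
  have : J.IsKInjective := CochainComplex.isKInjective_of_injective J a
  obtain ⟨j, hj⟩ := exists_toHo_hom_of_injective (X := (toHo R).obj K) (J := J) e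
  obtain ⟨f, rfl⟩ : ∃ f : K ⟶ J, (toHo R).map f = j := (toHo R).map_surjective j
  exact ⟨f, hj⟩

end QuasiIso

/-! ### Matching injectives, projectives, direct sums and products. -/

namespace HomothetyData

variable {A B : Type u} [Ring A] [Ring B] {L : CochainComplex (Bimod A B) ℤ} (D : HomothetyData L)

/-- Bounded complexes of injective modules come from `D(B-Mod)`. -/
lemma exists_matched_injective (a c d : ℤ) [L.IsStrictlyGE a]
    (J : CochainComplex (ModuleCat.{u} A) ℤ) [J.IsStrictlyGE c] [J.IsStrictlyLE d]
    [∀ m, Injective (J.X m)] :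
    ∃ X : DerivedCategory (ModuleCat.{u} B), X.IsLE (d - a) ∧
      D.Matched X (DerivedCategory.Q.obj J) := by
  have : (homComplex L J).IsStrictlyLE (d - a) := isStrictlyLE_homComplex J a d _ (by omega)
  obtain ⟨P, f, hf, hP, hP'⟩ := exists_quasiIso_projective (homComplex L J) (d - a)
  have := isIso_Qh_map_of_quasiIso f
  obtain ⟨h₁, h₂⟩ := D.isIso_and_good_of_injective (a := a) (b := d - a) (c := c) (d := d) J P ((toHo B).map f)
  exact ⟨DerivedCategory.Q.obj P, ⟨P, Iso.refl _, hP'⟩,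
    (matched_of_projective (d - a) P h₂).of_iso (Iso.refl _) (@asIso _ _ _ _ _ h₁)⟩

/-- Bounded complexes of projective modules have matching objects in `D(A-Mod)`. -/
lemma exists_matched_projective (a c d : ℤ) [L.IsStrictlyGE a]
    (P : CochainComplex (ModuleCat.{u} B) ℤ) [P.IsStrictlyGE c] [P.IsStrictlyLE d]
    [∀ m, Projective (P.X m)] :
    ∃ Y : DerivedCategory (ModuleCat.{u} A), Y.IsGE (c + a) ∧
      D.Matched (DerivedCategory.Q.obj P) Y :=
  ⟨DerivedCategory.Q.obj (tensorComplex L P),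
    ⟨tensorComplex L P, Iso.refl _, isStrictlyGE_tensorComplex P a c _ (by omega)⟩,
    matched_of_projective d P (D.good_of_bounded c d P)⟩

variable {I : Type u}

/-- The sum of projective representatives `P_i` is again bounded above and projective. For goodness,
replace each `L ⊗ P_i` by injectives `J_i` in degrees at least `0`: maps from `K` into the sum of
the `J_i` decompose, since `K` is bounded above with finitely generated terms. -/
lemma exists_matched_sum (b : ℤ) (M : I → ModuleCat.{u} A)
    (X : I → DerivedCategory (ModuleCat.{u} B)) (hX : ∀ i, (X i).IsLE b)
    (h : ∀ i, D.Matched (X i) ((S A).obj (M i))) :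
    ∃ X' : DerivedCategory (ModuleCat.{u} B), X'.IsLE b ∧
      D.Matched X' ((S A).obj (ModuleCat.of A (DirectSum I fun i => M i))) := by
  choose P hP hP' hP'' e e' using fun i => (h i).exists_projective b
  choose J hJ hJ' i using fun i => exists_injective_representative ((S A).obj (M i)) 0
  choose g hg using fun k => exists_hom_to_injective (K := tensorComplex L (P k)) 0
    ((e' k).some ≪≫ (i k).some.symm)
  choose s hs using fun k => exists_hom_to_injective
    (K := (CochainComplex.singleFunctor (ModuleCat.{u} A) 0).obj (M k)) 0
    (singleQIso (M k) ≪≫ (i k).some.symm)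
  have h₁ := isIso_Qh_sumMap g
  have h₂ := isIso_Qh_sumMap s
  have : (sumComplex P).IsStrictlyLE b := sumComplex_isStrictlyLE b
  have (m : ℤ) : Projective ((sumComplex P).X m) := sumComplex_projective m
  let f : tensorComplex L (sumComplex P) ⟶ sumComplex J := tensorSumHom L P ≫ sumMap g
  have hf : IsIso (DerivedCategory.Qh.map ((toHo A).map f)) := by
    have h₀ : IsIso (DerivedCategory.Qh.map ((toHo A).map (tensorSumHom L P))) := by
      have : IsIso ((toHo A).map (tensorSumHom L P)) := Functor.map_isIso _ _
      exact Functor.map_isIso _ _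
    have : DerivedCategory.Qh.map ((toHo A).map f) =
        DerivedCategory.Qh.map ((toHo A).map (tensorSumHom L P)) ≫
          DerivedCategory.Qh.map ((toHo A).map (sumMap g)) :=
      (congrArg DerivedCategory.Qh.map ((toHo A).map_comp (tensorSumHom L P) (sumMap g))).trans
        (DerivedCategory.Qh.map_comp _ _)
    rw [this]
    exact IsIso.comp_isIso' h₀ h₁
  have hgood : D.good ((toHo B).obj (sumComplex P)) := by
    let F : (tensorFunctorHo L).obj ((toHo B).obj (sumComplex P)) ⟶ (toHo A).obj (sumComplex J) :=
      (toHo A).map f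
    have hF : IsIso (DerivedCategory.Qh.map F) := hf
    let g' (k : I) : (tensorFunctorHo L).obj ((toHo B).obj (P k)) ⟶ (toHo A).obj (J k) :=
      (toHo A).map (g k)
    have hg' (k : I) : IsIso (DerivedCategory.Qh.map (g' k)) := hg k
    refine (D.good_iff F).2 fun n => ?_
    -- Only degrees `m ≤ c` with `m + n ≥ 0` can carry a nonzero map from `K` to `J_k[n]`.
    refine bijective_transfer_sum (U := unitComplex B) (V := D.K) D.tHo g n {0}
      (Finset.Icc (-n) D.c) (fun m hm => Or.inl (isZero_unitComplex_X (by simpa using hm)))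
      (fun m hm => ?_) (fun k => (D.good_iff (g' k)).1 (hP'' k) n)
    by_cases hmc : m ≤ D.c
    · refine Or.inr fun k => (J k).isZero_of_isStrictlyGE 0 _ ?_
      by_contra hm'
      exact hm (by simp; omega)
    · exact Or.inl (D.K.isZero_of_isStrictlyLE D.c m (by omega))
  refine ⟨DerivedCategory.Q.obj (sumComplex P), ⟨sumComplex P, Iso.refl _, inferInstance⟩,
    (matched_of_projective b _ hgood).of_iso (Iso.refl _) ?_⟩
  exact @asIso _ _ _ _ _ hf ≪≫ (@asIso _ _ _ _ _ h₂).symm ≪≫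
    DerivedCategory.Q.mapIso (nonempty_sum_single_iso M).some ≪≫ singleQIso _

/-- A product of complexes of projectives need not have projective terms, so it is resolved once
more. By `isIso_and_good_of_prod`, tensoring this resolution with `L` still gives the product of the
`L ⊗ Z_i`. -/
lemma exists_matched_prod (a : ℤ) (N : I → ModuleCat.{u} B)
    (Y : I → DerivedCategory (ModuleCat.{u} A)) (hY : ∀ i, (Y i).IsGE a)
    (h : ∀ i, D.Matched ((S B).obj (N i)) (Y i)) :
    ∃ Y' : DerivedCategory (ModuleCat.{u} A), Y'.IsGE a ∧
      D.Matched ((S B).obj (ModuleCat.of B (∀ i, N i))) Y' := by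
  choose Z hZ hZ' hZ'' e e' using fun i => (h i).exists_projective 0
  choose J hJ hJ' i using fun i => exists_injective_representative (Y i) a
  choose g hg using fun k => exists_hom_to_injective (K := tensorComplex L (Z k)) a
    ((e' k).some ≪≫ (i k).some.symm)
  have (k : I) : (Z k).IsKProjective := CochainComplex.isKProjective_of_projective (Z k) 0
  choose s hs using fun k => exists_quasiIso_of_derivedIso (K := Z k)
    (Y := (CochainComplex.singleFunctor (ModuleCat.{u} B) 0).obj (N k))
    ⟨(e k).some ≪≫ (singleQIso (N k)).symm⟩
  have h₁ := isIso_Qh_prodMap (Z := fun k => tensorComplex L (Z k)) g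
  have h₂ := isIso_Qh_prodMap s
  have : (prodComplex Z).IsStrictlyLE 0 := prodComplex_isStrictlyLE 0
  obtain ⟨P, p, hp, hP, hP'⟩ := exists_quasiIso_projective (prodComplex Z) 0
  have hp' := isIso_Qh_map_of_quasiIso p
  obtain ⟨hf, hgood⟩ := D.isIso_and_good_of_prod 0 Z hZ'' P p
  refine ⟨DerivedCategory.Q.obj (prodComplex J),
    ⟨prodComplex J, Iso.refl _, prodComplex_isStrictlyGE a⟩,
    (matched_of_projective 0 P hgood).of_iso ?_ ?_⟩
  · exact @asIso _ _ _ _ _ hp' ≪≫ @asIso _ _ _ _ _ h₂ ≪≫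
      DerivedCategory.Q.mapIso (nonempty_prod_single_iso N).some ≪≫ singleQIso _
  · exact @asIso _ _ _ _ _ hf ≪≫ @asIso _ _ _ _ _ h₁

end HomothetyData

/-! ### Degree bounds on cones and complexes concentrated in one degree. -/

section SingleShift

open Pretriangulated

variable {R : Type u} [Ring R]

lemma isLE₃ (T : Triangle (DerivedCategory (ModuleCat.{u} R))) (hT : T ∈ distTriang _) (n m : ℤ)
    (hm : n + 1 = m) (h₁ : T.obj₁.IsLE m) (h₂ : T.obj₂.IsLE n) : T.obj₃.IsLE n :=
  DerivedCategory.TStructure.t.isLE₂ T.rotate (rot_of_distTriang _ hT) n h₂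
    (DerivedCategory.TStructure.t.isLE_shift T.obj₁ m 1 n (by omega))

lemma isGE₃ (T : Triangle (DerivedCategory (ModuleCat.{u} R))) (hT : T ∈ distTriang _) (n m : ℤ)
    (hm : n + 1 = m) (h₁ : T.obj₁.IsGE m) (h₂ : T.obj₂.IsGE n) : T.obj₃.IsGE n :=
  DerivedCategory.TStructure.t.isGE₂ T.rotate (rot_of_distTriang _ hT) n h₂
    (DerivedCategory.TStructure.t.isGE_shift T.obj₁ m 1 n (by omega))

/-- A complex concentrated in one degree is a shift of a module. -/
lemma nonempty_iso_shift_single (K : CochainComplex (ModuleCat.{u} R) ℤ) (n : ℤ)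
    [K.IsStrictlyGE n] [K.IsStrictlyLE n] {M : ModuleCat.{u} R} (e : K.X n ≅ M) :
    Nonempty ((DerivedCategory.Q.obj K)⟦n⟧ ≅ (S R).obj M) := by
  obtain ⟨i⟩ := nonempty_iso_single K n e
  exact ⟨(shiftFunctor _ n).mapIso (DerivedCategory.Q.mapIso i ≪≫
      (DerivedCategory.singleFunctorIsoCompQ (ModuleCat.{u} R) n).symm.app M) ≪≫
    ((DerivedCategory.singleFunctors (ModuleCat.{u} R)).shiftIso n 0 n (by omega)).app M⟩

instance isGE_S (M : ModuleCat.{u} R) : ((S R).obj M).IsGE 0 := inferInstance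

instance isLE_S (M : ModuleCat.{u} R) : ((S R).obj M).IsLE 0 := inferInstance

end SingleShift

/-! ### The maximal classes and their closure properties. -/

namespace HomothetyData

open Pretriangulated

variable {A B : Type u} [Ring A] [Ring B] {L : CochainComplex (Bimod A B) ℤ} (D : HomothetyData L)

variable {D} {X X₁ X₂ : DerivedCategory (ModuleCat.{u} B)}
  {Y Y₁ Y₂ : DerivedCategory (ModuleCat.{u} A)}

lemma Matched.cone_isGE (T : Triangle (DerivedCategory (ModuleCat.{u} B))) (hT : T ∈ distTriang _)
    (h₁ : D.Matched T.obj₁ Y₁) (h₂ : D.Matched T.obj₂ Y₂) (a b : ℤ) (hb : a + 1 = b)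
    (hY₁ : Y₁.IsGE b) (hY₂ : Y₂.IsGE a) :
    ∃ Y₃ : DerivedCategory (ModuleCat.{u} A), Y₃.IsGE a ∧ D.Matched T.obj₃ Y₃ := by
  obtain ⟨T', hT', ⟨e₁⟩, ⟨e₂⟩, h⟩ := h₁.cone T hT h₂
  exact ⟨T'.obj₃, isGE₃ T' hT' a b hb (DerivedCategory.TStructure.t.isGE_of_iso e₁.symm b)
    (DerivedCategory.TStructure.t.isGE_of_iso e₂.symm a), h⟩

lemma Matched.cone'_isLE (T : Triangle (DerivedCategory (ModuleCat.{u} A)))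
    (hT : T ∈ distTriang _) (h₁ : D.Matched X₁ T.obj₁) (h₂ : D.Matched X₂ T.obj₂) (c : ℤ)
    (hc : T.obj₂.IsGE c) (a b : ℤ) (hb : a + 1 = b) (hX₁ : X₁.IsLE b) (hX₂ : X₂.IsLE a) :
    ∃ X₃ : DerivedCategory (ModuleCat.{u} B), X₃.IsLE a ∧ D.Matched X₃ T.obj₃ := by
  obtain ⟨T', hT', ⟨e₁⟩, ⟨e₂⟩, h⟩ := h₁.cone' T hT h₂ c hc
  exact ⟨T'.obj₃, isLE₃ T' hT' a b hb (DerivedCategory.TStructure.t.isLE_of_iso e₁.symm b)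
    (DerivedCategory.TStructure.t.isLE_of_iso e₂.symm a), h⟩

variable (D)

/-- The maximal class in `A-Mod`: the modules corresponding to objects of `D(B-Mod)` in
cohomological degrees `≤ l`. -/
def E₀ (l : ℤ) : ObjectProperty (ModuleCat.{u} A) := fun M =>
  ∃ X : DerivedCategory (ModuleCat.{u} B), X.IsLE l ∧ D.Matched X ((S A).obj M)

/-- The maximal class in `B-Mod`: the modules corresponding to objects of `D(A-Mod)` in
cohomological degrees `≥ -l`. -/
def F₀ (l : ℤ) : ObjectProperty (ModuleCat.{u} B) := fun N =>
  ∃ Y : DerivedCategory (ModuleCat.{u} A), Y.IsGE (-l) ∧ D.Matched ((S B).obj N) Y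

variable {D} {l : ℤ}

/-- The middle term is the cone of a map from `X₃[-1]` to `X₁`. The object matched with the former
lies in degrees at most `l + 1`, which is what a cone in degrees at most `l` allows. -/
lemma E₀_of_shortExact (S' : ShortComplex (ModuleCat.{u} A)) (hS : S'.ShortExact)
    (h₁ : D.E₀ l S'.X₁) (h₃ : D.E₀ l S'.X₃) : D.E₀ l S'.X₂ := by
  obtain ⟨X₁, hX₁, h₁⟩ := h₁
  obtain ⟨X₃, hX₃, h₃⟩ := h₃
  exact Matched.cone'_isLE _ (inv_rot_of_distTriang _ hS.singleTriangle_distinguished)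
    (h₃.shift (-1)) h₁ 0 (isGE_S S'.X₁) l (l + 1) rfl
    (DerivedCategory.TStructure.t.isLE_shift X₃ l (-1) (l + 1) (by omega)) hX₁

lemma E₀_cokernel (S' : ShortComplex (ModuleCat.{u} A)) (hS : S'.ShortExact)
    (h₁ : D.E₀ l S'.X₁) (h₂ : D.E₀ l S'.X₂) : D.E₀ l S'.X₃ := by
  obtain ⟨X₁, hX₁, h₁⟩ := h₁
  obtain ⟨X₂, hX₂, h₂⟩ := h₂
  exact Matched.cone'_isLE _ hS.singleTriangle_distinguished h₁ h₂ 0 (isGE_S S'.X₂) l (l + 1) rfl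
    (DerivedCategory.TStructure.t.isLE_of_le X₁ l (l + 1) (by omega)) hX₂

lemma F₀_of_shortExact (S' : ShortComplex (ModuleCat.{u} B)) (hS : S'.ShortExact)
    (h₁ : D.F₀ l S'.X₁) (h₃ : D.F₀ l S'.X₃) : D.F₀ l S'.X₂ := by
  obtain ⟨Y₁, hY₁, h₁⟩ := h₁
  obtain ⟨Y₃, hY₃, h₃⟩ := h₃
  exact Matched.cone_isGE _ (inv_rot_of_distTriang _ hS.singleTriangle_distinguished)
    (h₃.shift (-1)) h₁ (-l) (-l + 1) rfl
    (DerivedCategory.TStructure.t.isGE_shift Y₃ (-l) (-1) (-l + 1) (by omega)) hY₁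

lemma Matched.of_shift {n : ℤ} (h : D.Matched (X⟦n⟧) Y) : D.Matched X (Y⟦-n⟧) :=
  (h.shift (-n)).of_iso ((shiftEquiv _ n).unitIso.symm.app X) (Iso.refl _)

lemma Matched.of_shift' {n : ℤ} (h : D.Matched X (Y⟦n⟧)) : D.Matched (X⟦-n⟧) Y :=
  (h.shift (-n)).of_iso (Iso.refl _) ((shiftEquiv _ n).unitIso.symm.app Y)

/-- The cone of the surjection is the kernel shifted by one. Its partner lies in degrees at least
`-l - 1`, and undoing the shift restores `-l`. -/
lemma F₀_kernel (S' : ShortComplex (ModuleCat.{u} B)) (hS : S'.ShortExact)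
    (h₂ : D.F₀ l S'.X₂) (h₃ : D.F₀ l S'.X₃) : D.F₀ l S'.X₁ := by
  obtain ⟨Y₂, hY₂, h₂⟩ := h₂
  obtain ⟨Y₃, hY₃, h₃⟩ := h₃
  obtain ⟨Y, hY, h⟩ := Matched.cone_isGE _ (rot_of_distTriang _ hS.singleTriangle_distinguished)
    h₂ h₃ (-l - 1) (-l) (by omega) hY₂
    (DerivedCategory.TStructure.t.isGE_of_ge Y₃ (-l - 1) (-l) (by omega))
  exact ⟨_, DerivedCategory.TStructure.t.isGE_shift Y (-l - 1) (-1) (-l) (by omega),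
    Matched.of_shift (n := 1) h⟩

variable (D)

/-- Since `L` begins in degree `-l` or later, `Hom_A(L, J)` ends in degree `l` or earlier. Together
with `F₀_projective` this is the role of the equality `l₁ = d₁`. -/
lemma E₀_injective [L.IsStrictlyGE (-l)] (J : ModuleCat.{u} A) (hJ : Injective J) :
    D.E₀ l J := by
  obtain ⟨X, hX, h⟩ := D.exists_matched_injective (-l) 0 0
    ((CochainComplex.singleFunctor (ModuleCat.{u} A) 0).obj J)
  exact ⟨X, DerivedCategory.TStructure.t.isLE_of_le X (0 - -l) l (by omega),
    h.of_iso (Iso.refl _) (singleQIso J)⟩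

lemma F₀_projective [L.IsStrictlyGE (-l)] (P : ModuleCat.{u} B) (hP : Projective P) :
    D.F₀ l P := by
  obtain ⟨Y, hY, h⟩ := D.exists_matched_projective (-l) 0 0
    ((CochainComplex.singleFunctor (ModuleCat.{u} B) 0).obj P)
  exact ⟨Y, DerivedCategory.TStructure.t.isGE_of_ge Y (-l) (0 + -l) (by omega),
    h.of_iso (singleQIso P) (Iso.refl _)⟩

lemma E₀_sum {I : Type u} (M : I → ModuleCat.{u} A) (h : ∀ i, D.E₀ l (M i)) :
    D.E₀ l (ModuleCat.of A (DirectSum I fun i => M i)) := by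
  choose X hX hX' using h
  exact D.exists_matched_sum l M X hX hX'

lemma F₀_prod {I : Type u} (N : I → ModuleCat.{u} B) (h : ∀ i, D.F₀ l (N i)) :
    D.F₀ l (ModuleCat.of B (∀ i, N i)) := by
  choose Y hY hY' using h
  exact D.exists_matched_prod (-l) N Y hY hY'

variable {D}

/-- The projective part in degrees above `a` is matched with an object in degrees at least `a + 1 -
l`, and `Y` lies in degrees at least `0 ≥ a - l`. So the cone, which is `P.X a` placed in degree
`a`, is matched with an object in degrees at least `a - l`, and a shift by `a` gives the bound `-l`.
-/
lemma Matched.F₀_bottom [L.IsStrictlyGE (-l)] {a b : ℤ} (hal : a ≤ l)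
    (P : CochainComplex (ModuleCat.{u} B) ℤ) [P.IsStrictlyGE a] [P.IsStrictlyLE b]
    (hP : ∀ m, a < m → Projective (P.X m)) (h : D.Matched (DerivedCategory.Q.obj P) Y)
    (hY : Y.IsGE 0) : D.F₀ l (P.X a) := by
  have (m : ℤ) : Projective ((stupidGE P (a + 1)).X m) := by
    by_cases hm : a < m
    · have := hP m hm
      exact (pieceRetract P _ _ m).projective
    · exact ((stupidGE P (a + 1)).isZero_of_isStrictlyGE (a + 1) m (by omega)).projective
  have : (stupidGE P (a + 1)).IsStrictlyLE b := pieceComplex_isStrictlyLE' _ _ _ b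
  obtain ⟨Y₁, hY₁, h₁⟩ := D.exists_matched_projective (-l) (a + 1) b (stupidGE P (a + 1))
  obtain ⟨Y₃, hY₃, h₃⟩ := Matched.cone_isGE _
    (DerivedCategory.Qh.map_distinguished _ (stupidTriangle_distinguished P (a + 1))) h₁ h
    (a - l) (a + 1 - l) (by omega) hY₁
    (DerivedCategory.TStructure.t.isGE_of_ge Y (a - l) 0 (by omega))
  have : (stupidLT P (a + 1)).IsStrictlyGE a := pieceComplex_isStrictlyGE' _ _ _ a
  have : (stupidLT P (a + 1)).IsStrictlyLE a := stupidLT_isStrictlyLE P _ _ (by omega)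
  obtain ⟨e⟩ := nonempty_iso_shift_single (stupidLT P (a + 1)) a
    (pieceXIso P _ _ a (by omega))
  exact ⟨_, DerivedCategory.TStructure.t.isGE_shift Y₃ (a - l) a (-l) (by omega),
    (h₃.shift a).of_iso e (Iso.refl _)⟩

/-- The injective part in degrees below `b` is matched with an object in degrees at most `b - 1 +
l`, and `X` lies in degrees at most `0 ≤ b + l`. The cone of the projection onto that part is the
top term shifted by `1 - b`, and undoing this shift turns the bound `b - 1 + l` into `l`. -/
lemma Matched.E₀_top [L.IsStrictlyGE (-l)] {a b : ℤ} (hbl : -l ≤ b)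
    (J : CochainComplex (ModuleCat.{u} A) ℤ) [J.IsStrictlyGE a] [J.IsStrictlyLE b]
    (hJ : ∀ m, m < b → Injective (J.X m)) (h : D.Matched X (DerivedCategory.Q.obj J))
    (hX : X.IsLE 0) : D.E₀ l (J.X b) := by
  have hlt : (stupidLT J b).IsStrictlyLE (b - 1) := stupidLT_isStrictlyLE J _ _ (by omega)
  have (m : ℤ) : Injective ((stupidLT J b).X m) := by
    by_cases hm : m < b
    · have := hJ m hm
      exact (pieceRetract J _ _ m).injective
    · exact ((stupidLT J b).isZero_of_isStrictlyLE (b - 1) m (by omega)).injective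
  have hge : (stupidLT J b).IsStrictlyGE a := pieceComplex_isStrictlyGE' _ _ _ a
  obtain ⟨X₂, hX₂, h₂⟩ := D.exists_matched_injective (-l) a (b - 1) (stupidLT J b)
  obtain ⟨X₃, hX₃, h₃⟩ := Matched.cone'_isLE _ (rot_of_distTriang _
    (DerivedCategory.Qh.map_distinguished _ (stupidTriangle_distinguished J b))) h h₂
    a ⟨stupidLT J b, Iso.refl _, hge⟩ (b - 1 - -l) (b + l) (by omega)
    (DerivedCategory.TStructure.t.isLE_of_le X 0 (b + l) (by omega)) hX₂
  have : (stupidGE J b).IsStrictlyLE b := pieceComplex_isStrictlyLE' _ _ _ b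
  obtain ⟨e⟩ := nonempty_iso_shift_single (stupidGE J b) b (pieceXIso J _ _ b (by omega))
  have hX₃' := DerivedCategory.TStructure.t.isLE_shift X₃ (b - 1 - -l) (-1) (b + l) (by omega)
  exact ⟨_, DerivedCategory.TStructure.t.isLE_shift (X₃⟦(-1 : ℤ)⟧) (b + l) b l (by omega),
    ((Matched.of_shift' (n := 1) h₃).shift b).of_iso (Iso.refl _) e⟩

end HomothetyData

/-! ### Canonical truncations of projective and injective representatives. -/

section Truncation

variable {R : Type u} [Ring R] (K : CochainComplex (ModuleCat.{u} R) ℤ)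

lemma truncGE_isStrictlyGE (a : ℤ) : (K.truncGE a).IsStrictlyGE a := inferInstance

lemma truncLE_isStrictlyLE (a : ℤ) : (K.truncLE a).IsStrictlyLE a := inferInstance

lemma truncGE_isStrictlyLE (a b : ℤ) [K.IsStrictlyLE b] : (K.truncGE a).IsStrictlyLE b :=
  inferInstance

lemma truncLE_isStrictlyGE (a b : ℤ) [K.IsStrictlyGE a] : (K.truncLE b).IsStrictlyGE a :=
  inferInstance

lemma truncGE_X_projective [∀ m, Projective (K.X m)] (a m : ℤ) (hm : a < m) :
    Projective ((K.truncGE a).X m) :=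
  Projective.of_iso (K.truncGEXIso a m hm).symm inferInstance

lemma truncLE_X_injective [∀ m, Injective (K.X m)] (b m : ℤ) (hm : m < b) :
    Injective ((K.truncLE b).X m) :=
  Injective.of_iso (K.truncLEXIso b m hm).symm inferInstance

/-- The canonical truncation of a complex whose cohomology is concentrated in degrees `≥ a`. -/
def truncGEQIso (a : ℤ) (h : (DerivedCategory.Q.obj K).IsGE a) :
    DerivedCategory.Q.obj (K.truncGE a) ≅ DerivedCategory.Q.obj K :=
  have : K.IsGE a := (DerivedCategory.isGE_Q_obj_iff K a).1 h
  have : QuasiIso (K.πTruncGE a) := (K.quasiIso_πTruncGE_iff a).2 this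
  (asIso (DerivedCategory.Q.map (K.πTruncGE a))).symm

/-- The canonical truncation of a complex whose cohomology is concentrated in degrees `≤ b`. -/
def truncLEQIso (b : ℤ) (h : (DerivedCategory.Q.obj K).IsLE b) :
    DerivedCategory.Q.obj (K.truncLE b) ≅ DerivedCategory.Q.obj K :=
  have : K.IsLE b := (DerivedCategory.isLE_Q_obj_iff K b).1 h
  have : QuasiIso (K.ιTruncLE b) := (K.quasiIso_ιTruncLE_iff b).2 this
  asIso (DerivedCategory.Q.map (K.ιTruncLE b))

end Truncation

/-! ### The maximal classes satisfy (III) and (IV). -/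

namespace HomothetyData

variable {A B : Type u} [Ring A] [Ring B] {L : CochainComplex (Bimod A B) ℤ} {D : HomothetyData L}
  {X : DerivedCategory (ModuleCat.{u} B)} {Y : DerivedCategory (ModuleCat.{u} A)} {l : ℤ}

lemma Matched.nonempty_iso_tensorComplex (h : D.Matched X Y)
    (P : CochainComplex (ModuleCat.{u} B) ℤ) [P.IsKProjective] (e : DerivedCategory.Q.obj P ≅ X) :
    Nonempty (DerivedCategory.Q.obj (tensorComplex L P) ≅ Y) := by
  obtain ⟨P', hP, -, ⟨i⟩, ⟨i'⟩⟩ := h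
  obtain ⟨f⟩ := hP.nonempty_iso (kproj_toHo P) (i ≪≫ e.symm)
  exact ⟨DerivedCategory.Qh.mapIso ((tensorFunctorHo L).mapIso f.symm) ≪≫ i'⟩

lemma Matched.nonempty_iso_LTensor {N : ModuleCat.{u} B} (h : D.Matched ((S B).obj N) Y) :
    Nonempty (DerivedCategory.Q.obj (LTensor L N) ≅ Y) :=
  have : (projectiveResolution N).cochainComplex.IsKProjective :=
    CochainComplex.isKProjective_of_projective _ 0
  h.nonempty_iso_tensorComplex (projectiveResolution N).cochainComplex
    (asIso (DerivedCategory.Q.map (projectiveResolution N).π') ≪≫ singleQIso N)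

lemma Matched.nonempty_iso_RHom {M : ModuleCat.{u} A} (h : D.Matched X ((S A).obj M)) :
    Nonempty (X ≅ DerivedCategory.Q.obj (RHom L M)) :=
  h.nonempty_iso_homComplex 0 (injectiveResolution M).cochainComplex
    ((asIso (DerivedCategory.Q.map (injectiveResolution M).ι')).symm ≪≫ singleQIso M)

lemma isGE_RHom (b : ℤ) [L.IsStrictlyLE b] (M : ModuleCat.{u} A) :
    (DerivedCategory.Q.obj (RHom L M)).IsGE (-b) :=
  ⟨RHom L M, Iso.refl _, isStrictlyGE_homComplex _ b 0 _ (by omega)⟩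

lemma isLE_LTensor (b : ℤ) [L.IsStrictlyLE b] (N : ModuleCat.{u} B) :
    (DerivedCategory.Q.obj (LTensor L N)).IsLE b :=
  ⟨LTensor L N, Iso.refl _, isStrictlyLE_tensorComplex _ b 0 _ (by omega)⟩

variable (D)

/-- `RHom(L, M)` is represented by projectives in degrees at most `l`, and it has no cohomology
below `-b ≥ -c`. The canonical truncation at `-c` therefore represents it, with projective terms
except at the bottom, where `Matched.F₀_bottom` applies. -/
lemma E₀_to_F₀ [L.IsStrictlyGE (-l)] {b c : ℤ} [L.IsStrictlyLE b] (hbc : b ≤ c)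
    (M : ModuleCat.{u} A) (hM : D.E₀ l M) : RepresentableIn (D.F₀ l) (-c) l (RHom L M) := by
  obtain ⟨X, hX, h⟩ := hM
  obtain ⟨e⟩ := h.nonempty_iso_RHom
  obtain ⟨P, hP, hP', ⟨i⟩⟩ := exists_projective_representative X l
  have := isGE_RHom (L := L) b M
  have := DerivedCategory.TStructure.t.isGE_of_iso (i ≪≫ e).symm (-b)
  let t := truncGEQIso P (-c) (DerivedCategory.TStructure.t.isGE_of_ge _ (-c) (-b) (by omega))
  refine ⟨P.truncGE (-c), truncGE_isStrictlyGE P _, truncGE_isStrictlyLE P _ l, fun m hm hm' => ?_,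
    ⟨t ≪≫ i ≪≫ e⟩⟩
  have hproj := truncGE_X_projective P (-c)
  obtain rfl | hm := hm.eq_or_lt
  · exact (h.of_iso (i.symm ≪≫ t.symm) (Iso.refl _)).F₀_bottom (b := l) hm' _ hproj
      (isGE_S M)
  · exact D.F₀_projective _ (hproj m hm)

/-- Dually, an injective representative in degrees at least `-l` is truncated at `c`, and the top
term is handled by `Matched.E₀_top`. -/
lemma F₀_to_E₀ [L.IsStrictlyGE (-l)] {b c : ℤ} [L.IsStrictlyLE b] (hbc : b ≤ c)
    (N : ModuleCat.{u} B) (hN : D.F₀ l N) : RepresentableIn (D.E₀ l) (-l) c (LTensor L N) := by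
  obtain ⟨Y, hY, h⟩ := hN
  obtain ⟨e⟩ := h.nonempty_iso_LTensor
  obtain ⟨J, hJ, hJ', ⟨i⟩⟩ := exists_injective_representative Y (-l)
  have := isLE_LTensor (L := L) b N
  have := DerivedCategory.TStructure.t.isLE_of_iso (e ≪≫ i.symm) b
  let t := truncLEQIso J c (DerivedCategory.TStructure.t.isLE_of_le _ b c hbc)
  refine ⟨J.truncLE c, truncLE_isStrictlyGE J (-l) c, truncLE_isStrictlyLE J c, fun m hm hm' => ?_,
    ⟨t ≪≫ i ≪≫ e.symm⟩⟩
  have hinj := truncLE_X_injective J c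
  obtain rfl | hm' := hm'.eq_or_lt
  · exact (h.of_iso (Iso.refl _) (i.symm ≪≫ t.symm)).E₀_top (a := -l) hm _ hinj
      (isLE_S N)
  · exact D.E₀_injective _ (hinj m hm')

/-- The pair of maximal classes is a closed pair of corresponding classes. -/
theorem closedCorrespondingClasses [L.IsStrictlyGE (-l)] {b c : ℤ} [L.IsStrictlyLE b]
    (hbc : b ≤ c) : ClosedCorrespondingClasses L l c (D.E₀ l, D.F₀ l) where
  corresponding :=
    { E_extensions := E₀_of_shortExact
      E_cokernels := E₀_cokernel
      E_injectives := D.E₀_injective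
      F_extensions := F₀_of_shortExact
      F_kernels := F₀_kernel
      F_projectives := D.F₀_projective
      E_to_F := D.E₀_to_F₀ hbc
      F_to_E := D.F₀_to_E₀ hbc }
  directSums _ := D.E₀_sum
  products _ := D.F₀_prod

end HomothetyData

/-! ### Resolving and coresolving classes: independence of the truncated resolution from the class.
-/

section Resolving

open Pretriangulated

variable {R : Type u} [Ring R]

/-- The short exact sequences of cycles of an acyclic complex. -/
def cyclesShortComplex (C : CochainComplex (ModuleCat.{u} R) ℤ) (m : ℤ) :
    ShortComplex (ModuleCat.{u} R) :=
  ShortComplex.mk (C.iCycles m) (C.toCycles m (m + 1)) (by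
    rw [← cancel_mono (C.iCycles (m + 1)), Category.assoc, C.toCycles_i, C.iCycles_d, zero_comp])

lemma cyclesShortComplex_shortExact {C : CochainComplex (ModuleCat.{u} R) ℤ} (hC : C.Acyclic)
    (m : ℤ) : (cyclesShortComplex C m).ShortExact where
  exact := by
    let S' : ShortComplex (ModuleCat.{u} R) :=
      ShortComplex.mk (C.iCycles m) (C.d m (m + 1)) (C.iCycles_d m (m + 1))
    let φ : cyclesShortComplex C m ⟶ S' :=
      { τ₁ := 𝟙 _
        τ₂ := 𝟙 _
        τ₃ := C.iCycles (m + 1)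
        comm₁₂ := (Category.id_comp _).trans (Category.comp_id _).symm
        comm₂₃ := (Category.id_comp _).trans (C.toCycles_i m (m + 1)).symm }
    have : Epi φ.τ₁ := inferInstanceAs (Epi (𝟙 _))
    have : IsIso φ.τ₂ := inferInstanceAs (IsIso (𝟙 _))
    have : Mono φ.τ₃ := inferInstanceAs (Mono (C.iCycles (m + 1)))
    rw [ShortComplex.exact_iff_of_epi_of_isIso_of_mono φ]
    exact S'.exact_of_f_is_kernel (C.cyclesIsKernel m (m + 1) (by simp))
  mono_f := inferInstanceAs (Mono (C.iCycles m))
  epi_g := by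
    have h := (C.exactAt_iff' m (m + 1) (m + 2) (by simp) (by simp; omega)).1 (hC (m + 1))
    have := h.epi_toCycles
    have h' := C.toCycles_cyclesIsoSc'_hom m (m + 1) (m + 2) (by simp) (by simp; omega)
    change Epi (C.toCycles m (m + 1))
    rw [(Iso.eq_comp_inv _).2 h']
    exact epi_comp' this inferInstance

/-- The degreewise split exact sequences of a mapping cone. -/
def coneShortComplex {K G : CochainComplex (ModuleCat.{u} R) ℤ} (f : K ⟶ G) (m : ℤ) :
    ShortComplex (ModuleCat.{u} R) :=
  ShortComplex.mk ((CochainComplex.mappingCone.inr f).f m)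
    ((CochainComplex.mappingCone.fst f).1.v m (m + 1) rfl)
    (CochainComplex.mappingCone.inr_f_fst_v f m (m + 1) rfl)

/-- The splitting of `coneShortComplex`. -/
def coneShortComplexSplitting {K G : CochainComplex (ModuleCat.{u} R) ℤ} (f : K ⟶ G) (m : ℤ) :
    (coneShortComplex f m).Splitting where
  r := (CochainComplex.mappingCone.snd f).v m m (add_zero m)
  s := (CochainComplex.mappingCone.inl f).v (m + 1) m (by omega)
  f_r := CochainComplex.mappingCone.inr_f_snd_v f m
  s_g := CochainComplex.mappingCone.inl_v_fst_v f (m + 1) m rfl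
  id := by
    rw [add_comm]
    exact CochainComplex.mappingCone.id_X f m (m + 1) rfl

/-- The degreewise split exact sequences of a mapping cone, in the other direction. -/
def coneShortComplex' {K G : CochainComplex (ModuleCat.{u} R) ℤ} (f : K ⟶ G) (m : ℤ) :
    ShortComplex (ModuleCat.{u} R) :=
  ShortComplex.mk ((CochainComplex.mappingCone.inl f).v (m + 1) m (by omega))
    ((CochainComplex.mappingCone.snd f).v m m (add_zero m))
    (CochainComplex.mappingCone.inl_v_snd_v f (m + 1) m (by omega))

/-- The splitting of `coneShortComplex'`. -/
def coneShortComplexSplitting' {K G : CochainComplex (ModuleCat.{u} R) ℤ} (f : K ⟶ G) (m : ℤ) :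
    (coneShortComplex' f m).Splitting where
  r := (CochainComplex.mappingCone.fst f).1.v m (m + 1) rfl
  s := (CochainComplex.mappingCone.inr f).f m
  f_r := CochainComplex.mappingCone.inl_v_fst_v f (m + 1) m rfl
  s_g := CochainComplex.mappingCone.inr_f_snd_v f m
  id := CochainComplex.mappingCone.id_X f m (m + 1) rfl

lemma mappingCone_acyclic {K G : CochainComplex (ModuleCat.{u} R) ℤ} (f : K ⟶ G) [QuasiIso f] :
    (CochainComplex.mappingCone f).Acyclic := by
  rw [← HomotopyCategory.quotient_obj_mem_subcategoryAcyclic_iff_acyclic]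
  have h := HomotopyCategory.mappingCone_triangleh_distinguished f
  refine ((HomotopyCategory.subcategoryAcyclic
    (ModuleCat.{u} R)).trW_iff_of_distinguished _ h).1 ?_
  rw [← HomotopyCategory.quasiIso_eq_trW_subcategoryAcyclic]
  exact (HomotopyCategory.quotient_map_mem_quasiIso_iff f).2 ‹_›

/-- The classes of modules as in condition (II). -/
structure IsResolving (F : ObjectProperty (ModuleCat.{u} R)) : Prop where
  extensions : ∀ S : ShortComplex (ModuleCat.{u} R), S.ShortExact → F S.X₁ → F S.X₃ → F S.X₂
  kernels : ∀ S : ShortComplex (ModuleCat.{u} R), S.ShortExact → F S.X₂ → F S.X₃ → F S.X₁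
  projectives : ∀ P : ModuleCat.{u} R, Projective P → F P

/-- The classes of modules as in condition (I). -/
structure IsCoresolving (E : ObjectProperty (ModuleCat.{u} R)) : Prop where
  extensions : ∀ S : ShortComplex (ModuleCat.{u} R), S.ShortExact → E S.X₁ → E S.X₃ → E S.X₂
  cokernels : ∀ S : ShortComplex (ModuleCat.{u} R), S.ShortExact → E S.X₁ → E S.X₂ → E S.X₃
  injectives : ∀ J : ModuleCat.{u} R, Injective J → E J

lemma isZero_cycles (C : CochainComplex (ModuleCat.{u} R) ℤ) {m : ℤ} (h : IsZero (C.X m)) :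
    IsZero (C.cycles m) := by
  rw [IsZero.iff_id_eq_zero, ← cancel_mono (C.iCycles m)]
  exact h.eq_of_tgt _ _

lemma isZero_cycles_succ {C : CochainComplex (ModuleCat.{u} R) ℤ} (hC : C.Acyclic) {m n : ℤ}
    (hn : m + 1 = n) (h : IsZero (C.X m)) : IsZero (C.cycles n) := by
  subst hn
  have : Epi (C.toCycles m (m + 1)) := (cyclesShortComplex_shortExact hC m).epi_g
  rw [IsZero.iff_id_eq_zero, ← cancel_epi (C.toCycles m (m + 1))]
  exact h.eq_of_src _ _

namespace IsResolving

variable {F : ObjectProperty (ModuleCat.{u} R)} (hF : IsResolving F)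

include hF

/-- The complex is spliced from short exact sequences of cycles. Working down from the right end,
the cycles above `k` lie in `F` by closure under kernels. The cycles in degree `k` vanish, so the
lowest term is an extension of the next cycles by zero. -/
lemma of_acyclic {C : CochainComplex (ModuleCat.{u} R) ℤ} (hC : C.Acyclic) (k b : ℤ)
    [C.IsStrictlyGE k] [C.IsStrictlyLE b] (h : ∀ m, k < m → F (C.X m)) : F (C.X k) := by
  -- Induction on the distance to the upper end; beyond `b` the cycles vanish.
  have h' (n : ℕ) : ∀ m, k < m → b < m + n → F (C.cycles m) := by
    induction n with
    | zero =>
      intro m _ hm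
      exact hF.projectives _ (isZero_cycles C
        (C.isZero_of_isStrictlyLE b m (by simpa using hm))).projective
    | succ n hn =>
      intro m hm hm'
      exact hF.kernels _ (cyclesShortComplex_shortExact hC m) (h m hm)
        (hn (m + 1) (by omega) (by push_cast at hm'; omega))
  exact hF.extensions _ (cyclesShortComplex_shortExact hC k)
    (hF.projectives _ (isZero_cycles_succ hC (m := k - 1) (by omega)
      (C.isZero_of_isStrictlyGE k (k - 1) (by omega))).projective)
    (h' (b - k).toNat (k + 1) (by omega) (by omega))

/-- As `G` starts in degree `a`, the comparison `P → G` factors through the truncation by a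
quasi-isomorphism. In the degrees from `a` on, the terms of its acyclic cone are extensions of
projectives by terms of `G`, so the term in degree `a - 1` lies in `F`. The lowest term of the
truncation is the kernel of the map from it to a term of `G`. -/
lemma truncGE_X {P G : CochainComplex (ModuleCat.{u} R) ℤ} (a b : ℤ) [∀ m, Projective (P.X m)]
    [P.IsStrictlyLE b] [G.IsStrictlyGE a] [G.IsStrictlyLE b]
    (hG : ∀ m, a ≤ m → m ≤ b → F (G.X m))
    (e : DerivedCategory.Q.obj P ≅ DerivedCategory.Q.obj G) (m : ℤ) : F ((P.truncGE a).X m) := by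
  have hG' (m : ℤ) : F (G.X m) := by
    by_cases h₁ : a ≤ m
    · by_cases h₂ : m ≤ b
      · exact hG m h₁ h₂
      · exact hF.projectives _ (G.isZero_of_isStrictlyLE b m (by omega)).projective
    · exact hF.projectives _ (G.isZero_of_isStrictlyGE a m (by omega)).projective
  have : P.IsKProjective := CochainComplex.isKProjective_of_projective P b
  obtain ⟨f, hf⟩ := exists_quasiIso_of_derivedIso (K := P) (Y := G) ⟨e⟩
  have hf' : IsIso (DerivedCategory.Q.map f) := hf
  rw [DerivedCategory.isIso_Q_map_iff_quasiIso] at hf'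
  have hP : P.IsGE a := (DerivedCategory.isGE_Q_obj_iff P a).1 ⟨G, e, inferInstance⟩
  have : QuasiIso (P.πTruncGE a) := (P.quasiIso_πTruncGE_iff a).2 hP
  let g : P.truncGE a ⟶ G := CochainComplex.truncGEMap f a ≫ inv (G.πTruncGE a)
  have hg : P.πTruncGE a ≫ g = f := by
    rw [← Category.assoc, CochainComplex.πTruncGE_naturality, Category.assoc, IsIso.hom_inv_id,
      Category.comp_id]
  have : QuasiIso (P.πTruncGE a ≫ g) := by rwa [hg]
  have : QuasiIso g := quasiIso_of_comp_left (P.πTruncGE a) g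
  have hproj := truncGE_X_projective P a
  obtain hm | rfl | hm := lt_trichotomy m a
  · exact hF.projectives _ ((P.truncGE a).isZero_of_isStrictlyGE a m hm).projective
  · have hle := truncGE_isStrictlyLE P m b
    obtain ⟨k, rfl⟩ : ∃ k, k + 1 = m := ⟨m - 1, by omega⟩
    have h₁ : (CochainComplex.mappingCone g).IsStrictlyGE k := by
      rw [CochainComplex.isStrictlyGE_iff]
      intro i hi
      rw [CochainComplex.mappingCone.isZero_X_iff]
      exact ⟨(P.truncGE (k + 1)).isZero_of_isStrictlyGE (k + 1) _ (by omega),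
        G.isZero_of_isStrictlyGE (k + 1) _ (by omega)⟩
    have h₂ : (CochainComplex.mappingCone g).IsStrictlyLE b := by
      rw [CochainComplex.isStrictlyLE_iff]
      intro i hi
      rw [CochainComplex.mappingCone.isZero_X_iff]
      exact ⟨(P.truncGE (k + 1)).isZero_of_isStrictlyLE b _ (by omega),
        G.isZero_of_isStrictlyLE b _ (by omega)⟩
    exact hF.kernels _ (coneShortComplexSplitting' g k).shortExact
      (hF.of_acyclic (mappingCone_acyclic g) k b fun m hm =>
        hF.extensions _ (coneShortComplexSplitting g m).shortExact (hG' m)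
          (hF.projectives _ (hproj (m + 1) (by omega)))) (hG' k)
  · exact hF.projectives _ (hproj m hm)

end IsResolving

namespace IsCoresolving

variable {E : ObjectProperty (ModuleCat.{u} R)} (hE : IsCoresolving E)

include hE

/-- The cycles are reached from the left end by closure under cokernels, and the top term coincides
with its cycles. -/
lemma of_acyclic {C : CochainComplex (ModuleCat.{u} R) ℤ} (hC : C.Acyclic) (a k : ℤ)
    [C.IsStrictlyGE a] [C.IsStrictlyLE k] (h : ∀ m, m < k → E (C.X m)) : E (C.X k) := by
  have h' (n : ℕ) : ∀ m, m ≤ k → m < a + n → E (C.cycles m) := by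
    induction n with
    | zero =>
      intro m _ hm
      exact hE.injectives _ (isZero_cycles C
        (C.isZero_of_isStrictlyGE a m (by simpa using hm))).injective
    | succ n hn =>
      intro m hm hm'
      obtain ⟨m, rfl⟩ : ∃ j, j + 1 = m := ⟨m - 1, by omega⟩
      exact hE.cokernels _ (cyclesShortComplex_shortExact hC m)
        (hn m (by omega) (by push_cast at hm'; omega)) (h m (by omega))
  exact hE.extensions _ (cyclesShortComplex_shortExact hC k)
    (h' (k + 1 - a).toNat k le_rfl (by omega))
    (hE.injectives _ (isZero_cycles C (C.isZero_of_isStrictlyLE k (k + 1) (by omega))).injective)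

/-- The dual of the argument with projectives: the comparison `G → J` lands in the truncation
because `G` ends in degree `b`, and the top term of the truncation is a cokernel of a map from a
term of `G` to the top term of the cone. -/
lemma truncLE_X {J G : CochainComplex (ModuleCat.{u} R) ℤ} (a b : ℤ) [∀ m, Injective (J.X m)]
    [J.IsStrictlyGE a] [G.IsStrictlyGE a] [G.IsStrictlyLE b]
    (hG : ∀ m, a ≤ m → m ≤ b → E (G.X m))
    (e : DerivedCategory.Q.obj G ≅ DerivedCategory.Q.obj J) (m : ℤ) : E ((J.truncLE b).X m) := by
  have hG' (m : ℤ) : E (G.X m) := by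
    by_cases h₁ : a ≤ m
    · by_cases h₂ : m ≤ b
      · exact hG m h₁ h₂
      · exact hE.injectives _ (G.isZero_of_isStrictlyLE b m (by omega)).injective
    · exact hE.injectives _ (G.isZero_of_isStrictlyGE a m (by omega)).injective
  obtain ⟨f, hf⟩ := exists_hom_to_injective a e
  have hf' : IsIso (DerivedCategory.Q.map f) := hf
  rw [DerivedCategory.isIso_Q_map_iff_quasiIso] at hf'
  have hJ : J.IsLE b := (DerivedCategory.isLE_Q_obj_iff J b).1 ⟨G, e.symm, inferInstance⟩
  have : QuasiIso (J.ιTruncLE b) := (J.quasiIso_ιTruncLE_iff b).2 hJ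
  let g : G ⟶ J.truncLE b := inv (G.ιTruncLE b) ≫ CochainComplex.truncLEMap f b
  have hg : g ≫ J.ιTruncLE b = f := by
    rw [Category.assoc, CochainComplex.ιTruncLE_naturality, IsIso.inv_hom_id_assoc]
  have : QuasiIso (g ≫ J.ιTruncLE b) := by rwa [hg]
  have : QuasiIso g := quasiIso_of_comp_right g (J.ιTruncLE b)
  have hinj := truncLE_X_injective J b
  obtain hm | rfl | hm := lt_trichotomy m b
  · exact hE.injectives _ (hinj m hm)
  · have hge := truncLE_isStrictlyGE J a m
    have h₁ : (CochainComplex.mappingCone g).IsStrictlyGE (a - 1) := by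
      rw [CochainComplex.isStrictlyGE_iff]
      intro i hi
      rw [CochainComplex.mappingCone.isZero_X_iff]
      exact ⟨G.isZero_of_isStrictlyGE a _ (by omega),
        (J.truncLE m).isZero_of_isStrictlyGE a _ (by omega)⟩
    have h₂ : (CochainComplex.mappingCone g).IsStrictlyLE m := by
      rw [CochainComplex.isStrictlyLE_iff]
      intro i hi
      rw [CochainComplex.mappingCone.isZero_X_iff]
      exact ⟨G.isZero_of_isStrictlyLE m _ (by omega),
        (J.truncLE m).isZero_of_isStrictlyLE m _ (by omega)⟩
    exact hE.cokernels _ (coneShortComplexSplitting' g m).shortExact (hG' (m + 1))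
      (hE.of_acyclic (mappingCone_acyclic g) (a - 1) m fun k hk =>
        hE.extensions _ (coneShortComplexSplitting g k).shortExact
          (hE.injectives _ (hinj k hk)) (hG' (k + 1)))
  · exact hE.injectives _ ((J.truncLE b).isZero_of_isStrictlyLE b m hm).injective

end IsCoresolving

end Resolving

/-! ### Intersections of closed pairs and the least closed pair. -/

section Intersection

variable {R : Type u} [Ring R] {ι : Sort*} {a b : ℤ} {K : CochainComplex (ModuleCat.{u} R) ℤ}

lemma RepresentableIn.isLE {F : ObjectProperty (ModuleCat.{u} R)} (h : RepresentableIn F a b K) :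
    (DerivedCategory.Q.obj K).IsLE b := by
  obtain ⟨G, _, hG, -, ⟨e⟩⟩ := h
  exact ⟨G, e.symm, hG⟩

lemma RepresentableIn.isGE {F : ObjectProperty (ModuleCat.{u} R)} (h : RepresentableIn F a b K) :
    (DerivedCategory.Q.obj K).IsGE a := by
  obtain ⟨G, hG, _, -, ⟨e⟩⟩ := h
  exact ⟨G, e.symm, hG⟩

/-- One complex, the truncated projective resolution, has terms in all the classes simultaneously.
Nonemptiness of the family is what bounds the cohomology on both sides. -/
lemma IsResolving.representableIn_forall [Nonempty ι] {F : ι → ObjectProperty (ModuleCat.{u} R)}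
    (hF : ∀ i, IsResolving (F i)) (h : ∀ i, RepresentableIn (F i) a b K) :
    RepresentableIn (fun M => ∀ i, F i M) a b K := by
  have := (h (Classical.arbitrary ι)).isLE
  have := (h (Classical.arbitrary ι)).isGE
  obtain ⟨P, hP, hP', ⟨e⟩⟩ := exists_projective_representative (DerivedCategory.Q.obj K) b
  refine ⟨P.truncGE a, truncGE_isStrictlyGE P a, truncGE_isStrictlyLE P a b, fun m _ _ i => ?_,
    ⟨truncGEQIso P a (DerivedCategory.TStructure.t.isGE_of_iso e.symm a) ≪≫ e⟩⟩
  obtain ⟨G, _, _, hG, ⟨e'⟩⟩ := h i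
  exact (hF i).truncGE_X a b hG (e ≪≫ e'.symm) m

lemma IsCoresolving.representableIn_forall [Nonempty ι] {E : ι → ObjectProperty (ModuleCat.{u} R)}
    (hE : ∀ i, IsCoresolving (E i)) (h : ∀ i, RepresentableIn (E i) a b K) :
    RepresentableIn (fun M => ∀ i, E i M) a b K := by
  have := (h (Classical.arbitrary ι)).isLE
  have := (h (Classical.arbitrary ι)).isGE
  obtain ⟨J, hJ, hJ', ⟨e⟩⟩ := exists_injective_representative (DerivedCategory.Q.obj K) a
  refine ⟨J.truncLE b, truncLE_isStrictlyGE J a b, truncLE_isStrictlyLE J b, fun m _ _ i => ?_,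
    ⟨truncLEQIso J b (DerivedCategory.TStructure.t.isLE_of_iso e.symm b) ≪≫ e⟩⟩
  obtain ⟨G, _, _, hG, ⟨e'⟩⟩ := h i
  exact (hE i).truncLE_X a b hG (e' ≪≫ e.symm) m

variable {A B : Type u} [Ring A] [Ring B] {L : CochainComplex (Bimod A B) ℤ} {l₁ l₂ : ℤ}
  {E : ObjectProperty (ModuleCat.{u} A)} {F : ObjectProperty (ModuleCat.{u} B)}

lemma CorrespondingClasses.isCoresolving (h : CorrespondingClasses L l₁ l₂ E F) :
    IsCoresolving E :=
  ⟨h.E_extensions, h.E_cokernels, h.E_injectives⟩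

lemma CorrespondingClasses.isResolving (h : CorrespondingClasses L l₁ l₂ E F) :
    IsResolving F :=
  ⟨h.F_extensions, h.F_kernels, h.F_projectives⟩

/-- The intersection of a nonempty family of closed pairs is a closed pair. -/
lemma ClosedCorrespondingClasses.forall [Nonempty ι]
    {p : ι → ObjectProperty (ModuleCat.{u} A) × ObjectProperty (ModuleCat.{u} B)}
    (hp : ∀ i, ClosedCorrespondingClasses L l₁ l₂ (p i)) :
    ClosedCorrespondingClasses L l₁ l₂ (fun M => ∀ i, (p i).1 M, fun N => ∀ i, (p i).2 N) where
  corresponding :=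
    { E_extensions := fun S hS h₁ h₃ i => (hp i).corresponding.E_extensions S hS (h₁ i) (h₃ i)
      E_cokernels := fun S hS h₁ h₂ i => (hp i).corresponding.E_cokernels S hS (h₁ i) (h₂ i)
      E_injectives := fun J hJ i => (hp i).corresponding.E_injectives J hJ
      F_extensions := fun S hS h₁ h₃ i => (hp i).corresponding.F_extensions S hS (h₁ i) (h₃ i)
      F_kernels := fun S hS h₂ h₃ i => (hp i).corresponding.F_kernels S hS (h₂ i) (h₃ i)
      F_projectives := fun P hP i => (hp i).corresponding.F_projectives P hP
      E_to_F := fun M hM => IsResolving.representableIn_forall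
        (fun i => (hp i).corresponding.isResolving) fun i => (hp i).corresponding.E_to_F M (hM i)
      F_to_E := fun N hN => IsCoresolving.representableIn_forall
        (fun i => (hp i).corresponding.isCoresolving) fun i => (hp i).corresponding.F_to_E N (hN i) }
  directSums I M h i := (hp i).directSums I M fun k => h k i
  products I N h i := (hp i).products I N fun k => h k i

/-- If there is a closed pair, then there is a least closed pair. -/
lemma exists_isLeast_closedCorrespondingClasses
    (h : ∃ p, ClosedCorrespondingClasses L l₁ l₂ p) :
    ∃ p, IsLeast {q | ClosedCorrespondingClasses L l₁ l₂ q} p := by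
  have : Nonempty {p // ClosedCorrespondingClasses L l₁ l₂ p} := nonempty_subtype.2 h
  exact ⟨_, ClosedCorrespondingClasses.forall
    (p := fun q : {p // ClosedCorrespondingClasses L l₁ l₂ p} => q.1) fun q => q.2,
    fun q hq => ⟨fun M hM => hM ⟨q, hq⟩, fun N hN => hN ⟨q, hq⟩⟩⟩

end Intersection

end PseudoDualizing

end


theorem mainTheorem10 {A B : Type u} [Ring A] [Ring B]
    (L : CochainComplex (PseudoDualizing.Bimod A B) ℤ)
    (hL : PseudoDualizing.IsPseudoDualizing L)
    (d₁ d₂ : ℤ) (hd₁ : L.IsStrictlyGE (-d₁)) (hd₂ : L.IsStrictlyLE d₂)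
    (l₁ l₂ : ℤ) (hl₁ : l₁ = d₁) (hl₂ : d₂ ≤ l₂) :
    (∃! p : ObjectProperty (ModuleCat.{u} A) × ObjectProperty (ModuleCat.{u} B),
      Minimal (PseudoDualizing.ClosedCorrespondingClasses L l₁ l₂) p) ∧
    (∀ p : ObjectProperty (ModuleCat.{u} A) × ObjectProperty (ModuleCat.{u} B),
      Minimal (PseudoDualizing.ClosedCorrespondingClasses L l₁ l₂) p →
      ∀ q : ObjectProperty (ModuleCat.{u} A) × ObjectProperty (ModuleCat.{u} B),
        PseudoDualizing.ClosedCorrespondingClasses L l₁ l₂ q → p.1 ≤ q.1 ∧ p.2 ≤ q.2) := by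
  subst hl₁
  obtain ⟨D⟩ := hL.nonempty_homothetyData
  obtain ⟨p, hp, hp'⟩ := PseudoDualizing.exists_isLeast_closedCorrespondingClasses
    ⟨_, D.closedCorrespondingClasses (l := l₁) hl₂⟩
  -- A minimal pair lies above the least one, and minimality gives the reverse inclusion.
  have hmin : ∀ q, Minimal (PseudoDualizing.ClosedCorrespondingClasses L l₁ l₂) q → q = p :=
    fun q hq => le_antisymm (hq.le_of_le hp (hp' hq.prop)) (hp' hq.prop)
  refine ⟨⟨p, ⟨hp, fun q hq _ => hp' hq⟩, hmin⟩, fun q hq r hr => ?_⟩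
  rw [hmin q hq]
  exact hp' hr
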